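/- Let $m\ge 0$, $\Lambda\ge 0$, $\Omega_\Lambda=(-\infty,-\Lambda)\cup(\Lambda,\infty)$ and $\mathcal H=L^2(\Omega_\Lambda)\oplus L^2(\Omega_\Lambda)$, with elements $\psi=(\psi_\uparrow,\psi_\downarrow)$. Let $AC^1$ be the space of $f\in L^2(\Omega_\Lambda)$ that are absolutely continuous on each of the closed half-lines $(-\infty,-\Lambda]$ and $[\Lambda,\infty)$ with $f'\in L^2(\Omega_\Lambda)$, and write $f(-\Lambda)$, $f(+\Lambda)$ for the boundary values at the end points of the left and of the right half-line (these are the two one-sided boundary values at $0$ if $\Lambda=0$). The minimal Dirac operator $H_0$ has the domain $$D(H_0)=\{\psi : \psi_\uparrow,\psi_\downarrow\in AC^1,\ \psi_\uparrow(\pm\Lambda)=\psi_\downarrow(\pm\Lambda)=0\}$$ and acts by $H_0\psi=(-i\psi_\downarrow'+m\psi_\uparrow,\,-i\psi_\uparrow'-m\psi_\downarrow)$. Let $H_0^*$ be its adjoint and $K_\pm=\ker(\pm i-H_0^*)$. Put $\kappa=\sqrt{1+m^2}$, $\mu=(1+im)/\sqrt{1+m^2}$, $N=(1+m^2)^{1/4}e^{-\kappa\Lambda}$,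 and let $\chi_L,\chi_R$ be the characteristic functions of the left and the right half-line. The space $K_+$ has the orthogonal basis $\psi_L^+=N\chi_Le^{\kappa x}(1,-\mu)$, $\psi_R^+=N\chi_Re^{-\kappa x}(1,\mu)$, and $K_-$ has the orthogonal basis $\psi_L^-=N\chi_Le^{\kappa x}(1,\mu^*)$, $\psi_R^-=N\chi_Re^{-\kappa x}(1,-\mu^*)$, all four vectors having the same norm. A unitary matrix $U=(u_{jk})\in U(2)$ is identified with the unitary operator $K_+\to K_-$ given by $U\psi_L^+=u_{11}\psi_L^-+u_{12}\psi_R^-$, $U\psi_R^+=u_{21}\psi_L^-+u_{22}\psi_R^-$, and $H_U$ is the restriction of $H_0^*$ to $$D(H_U)=\{\psi_0+\psi^++U\psi^+ : \psi_0\in D(H_0),\ \psi^+\in K_+\}.$$ For $\rho=(\rho_+,\rho_-)\in(\mathbb R\cup\{+\infty\})^2$, let $H_\rho$ be the restriction of $H_0^*$ to the set $D(H_\rho)$ of those $\psi\in D(H_0^*)$ that satisfy $i\rho_+\psi_\uparrow(+\Lambda)=\psi_\downarrow(+\Lambda)$ if $\rho_+\in\mathbb R$ and $\psi_\uparrow(+\Lambda)=0$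 if $\rho_+=+\infty$, and likewise $i\rho_-\psi_\uparrow(-\Lambda)=\psi_\downarrow(-\Lambda)$ if $\rho_-\in\mathbb R$ and $\psi_\uparrow(-\Lambda)=0$ if $\rho_-=+\infty$. Let $\mathcal C$ be the set of $\alpha=(\alpha_1,\alpha_2,\alpha_3,\alpha_4)\in\mathbb C^4$ with $\Re(\alpha_1\alpha_2^*)=\Re(\alpha_1\alpha_3^*)=\Re(\alpha_2\alpha_4^*)=\Re(\alpha_3\alpha_4^*)=0$ and $\alpha_1\alpha_4^*+\alpha_2\alpha_3^*=\alpha_1\alpha_4^*+\alpha_2^*\alpha_3=1$. For $\alpha\in\mathcal C$, let $H_\alpha$ be the restriction of $H_0^*$ to $$D(H_\alpha)=\left\{\psi\in D(H_0^*) : \begin{pmatrix}\psi_\uparrow(+\Lambda)\\ \psi_\downarrow(+\Lambda)\end{pmatrix}=\begin{pmatrix}\alpha_1&\alpha_2\\ \alpha_3&\alpha_4\end{pmatrix}\begin{pmatrix}\psi_\uparrow(-\Lambda)\\ \psi_\downarrow(-\Lambda)\end{pmatrix}\right\}.$$ **Theorem.** An operator $A$ in $\mathcal H$ is a self-adjoint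 extension of $H_0$ if and only if $A=H_U$ for some $U\in U(2)$, and this $U$ is then unique. Moreover: (i) Every diagonal $U\in U(2)$ is of the form $U=\mathrm{diag}(\gamma_L,\gamma_R)$ with $|\gamma_L|=|\gamma_R|=1$. For all such $\gamma_L,\gamma_R$ and all $\rho\in(\mathbb R\cup\{+\infty\})^2$, one has $D(H_U)=D(H_\rho)$ if and only if $$\rho_-=\frac{\tan(\theta_L/2)-m}{\sqrt{1+m^2}}\ \text{ if }\gamma_L\ne-1,\qquad \rho_-=+\infty\ \text{ if }\gamma_L=-1,$$ $$\rho_+=-\frac{\tan(\theta_R/2)-m}{\sqrt{1+m^2}}\ \text{ if }\gamma_R\ne-1,\qquad \rho_+=+\infty\ \text{ if }\gamma_R=-1,$$ where $\theta_L=\arg\gamma_L$ and $\theta_R=\arg\gamma_R$ are taken in $[0,2\pi)$. (ii) Every non-diagonal $U\in U(2)$ is of the form $$U=\gamma_3\begin{pmatrix}\gamma_1&-\gamma_2^*\\ \gamma_2&\gamma_1^*\end{pmatrix},\qquad |\gamma_1|^2+|\gamma_2|^2=|\gamma_3|=1,\quad \gamma_2\neq0.$$ For all such $\gamma_1,\gamma_2,\gamma_3$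 and all $\alpha\in\mathbb C^4$, one has $\alpha\in\mathcal C$ and $D(H_U)=D(H_\alpha)$ if and only if $$\begin{aligned}\alpha_1&=i\gamma_2^{-1}\sqrt{1+m^2}\,\bigl(\Im(\gamma_1^*\mu)+\Im(\gamma_3^*\mu)\bigr), & \alpha_2&=\gamma_2^{-1}\sqrt{1+m^2}\,\bigl(\Re\gamma_1+\Re\gamma_3\bigr),\\ \alpha_3&=\gamma_2^{-1}\sqrt{1+m^2}\,\bigl(-\Re\gamma_1+\Re(\gamma_3^*\mu^2)\bigr), & \alpha_4&=i\gamma_2^{-1}\sqrt{1+m^2}\,\bigl(\Im(\gamma_1\mu)+\Im(\gamma_3^*\mu)\bigr).\end{aligned}$$ -/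

import Mathlib

open MeasureTheory Set
open scoped LinearPMap InnerProductSpace

noncomputable section

namespace DiracJunction

/-! ### Absolutely continuous functions on one island -/

/-- `f` restricted to the closure of the open interval `s` lies in `AC¹(closure s)`: it is absolutely
continuous on every compact interval with end points in the closure of `s`, and `f` and its
(almost everywhere defined) derivative are square integrable on `s`. -/
structure IsAC1On (f : ℝ → ℂ) (s : Set ℝ) : Prop where
  ac : ∀ a ∈ closure s, ∀ b ∈ closure s, AbsolutelyContinuousOnInterval f a b
  memLp : MemLp f 2 (volume.restrict s)
  memLp_deriv : MemLp (deriv f) 2 (volume.restrict s)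

namespace IsAC1On

variable {f g : ℝ → ℂ} {s : Set ℝ}

theorem continuousOn (hf : IsAC1On f s) (hs : IsOpen s) : ContinuousOn f s := by
  intro x hx
  obtain ⟨ε, hε, hsub⟩ := Metric.isOpen_iff.1 hs x hx
  have h1 : x - ε / 2 ∈ s := hsub (by
    rw [Metric.mem_ball, Real.dist_eq, abs_lt]; constructor <;> linarith)
  have h2 : x + ε / 2 ∈ s := hsub (by
    rw [Metric.mem_ball, Real.dist_eq, abs_lt]; constructor <;> linarith)
  have h := (hf.ac _ (subset_closure h1) _ (subset_closure h2)).continuousOn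
  refine (h.continuousAt ?_).continuousWithinAt
  rw [uIcc_of_le (by linarith)]
  exact Icc_mem_nhds (by linarith) (by linarith)

theorem ae_differentiableAt (hf : IsAC1On f s) (hs : IsOpen s) :
    ∀ᵐ x ∂volume.restrict s, DifferentiableAt ℝ f x := by
  rw [ae_restrict_iff' hs.measurableSet]
  have h : ∀ᵐ x : ℝ, ∀ a b : ℚ, (a : ℝ) ∈ closure s → (b : ℝ) ∈ closure s →
      x ∈ uIcc (a : ℝ) b → DifferentiableAt ℝ f x := by
    rw [ae_all_iff]; intro a
    rw [ae_all_iff]; intro b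
    by_cases ha : (a : ℝ) ∈ closure s
    · by_cases hb : (b : ℝ) ∈ closure s
      · filter_upwards [(hf.ac _ ha _ hb).boundedVariationOn.ae_differentiableAt_of_mem_uIcc]
          with x hx _ _ using hx
      · exact Filter.Eventually.of_forall fun x _ h => absurd h hb
    · exact Filter.Eventually.of_forall fun x h => absurd h ha
  filter_upwards [h] with x hx hxs
  obtain ⟨ε, hε, hsub⟩ := Metric.isOpen_iff.1 hs x hxs
  obtain ⟨a, ha1, ha2⟩ := exists_rat_btwn (show x - ε < x by linarith)
  obtain ⟨b, hb1, hb2⟩ := exists_rat_btwn (show x < x + ε by linarith)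
  have has : (a : ℝ) ∈ s := hsub (by rw [Metric.mem_ball, Real.dist_eq, abs_lt]; constructor <;> linarith)
  have hbs : (b : ℝ) ∈ s := hsub (by rw [Metric.mem_ball, Real.dist_eq, abs_lt]; constructor <;> linarith)
  refine hx a b (subset_closure has) (subset_closure hbs) ?_
  rw [uIcc_of_le (by linarith)]
  exact ⟨ha2.le, hb1.le⟩

theorem deriv_add_ae (hf : IsAC1On f s) (hg : IsAC1On g s) (hs : IsOpen s) :
    deriv (f + g) =ᵐ[volume.restrict s] deriv f + deriv g := by
  filter_upwards [hf.ae_differentiableAt hs, hg.ae_differentiableAt hs] with x hx hy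
  exact deriv_add hx hy

theorem add (hf : IsAC1On f s) (hg : IsAC1On g s) (hs : IsOpen s) : IsAC1On (f + g) s where
  ac a ha b hb := (hf.ac a ha b hb).add (hg.ac a ha b hb)
  memLp := hf.memLp.add hg.memLp
  memLp_deriv := (memLp_congr_ae (hf.deriv_add_ae hg hs)).2 (hf.memLp_deriv.add hg.memLp_deriv)

theorem deriv_const_smul' (c : ℂ) (f : ℝ → ℂ) : deriv (c • f) = c • deriv f := by
  funext x
  exact deriv_const_smul_field c f

theorem smul (c : ℂ) (hf : IsAC1On f s) : IsAC1On (c • f) s where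
  ac a ha b hb := (hf.ac a ha b hb).const_smul c
  memLp := hf.memLp.const_smul c
  memLp_deriv := by
    rw [deriv_const_smul']
    exact hf.memLp_deriv.const_smul c

theorem zero (s : Set ℝ) : IsAC1On 0 s where
  ac a _ b _ := by
    have h : LipschitzOnWith 0 (0 : ℝ → ℂ) (uIcc a b) :=
      (LipschitzWith.const (0 : ℂ)).lipschitzOnWith
    exact h.absolutelyContinuousOnInterval
  memLp := MemLp.zero
  memLp_deriv := by
    have h : deriv (0 : ℝ → ℂ) = 0 := by funext x; exact deriv_const x (0 : ℂ)
    rw [h]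
    exact MemLp.zero

theorem deriv_eqOn (hf : IsAC1On f s) (hg : IsAC1On g s) (hs : IsOpen s)
    (h : f =ᵐ[volume.restrict s] g) : EqOn (deriv f) (deriv g) s :=
  (Measure.eqOn_open_of_ae_eq h hs (hf.continuousOn hs) (hg.continuousOn hs)).deriv hs

end IsAC1On

/-! ### The configuration space and the Hilbert space -/

/-- The left island `(-∞, -Λ)`. -/
abbrev leftIsland (Λ : ℝ) : Set ℝ := Iio (-Λ)

/-- The right island `(Λ, ∞)`. -/
abbrev rightIsland (Λ : ℝ) : Set ℝ := Ioi Λ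

/-- The configuration space `Ω_Λ = (-∞, -Λ) ∪ (Λ, ∞)`. -/
abbrev config (Λ : ℝ) : Set ℝ := leftIsland Λ ∪ rightIsland Λ

/-- `L²(Ω_Λ)`. -/
abbrev L2 (Λ : ℝ) : Type := Lp ℂ 2 (volume.restrict (config Λ))

/-- The Hilbert space `ℂ² ⊗ L²(Ω_Λ) = L²(Ω_Λ) ⊕ L²(Ω_Λ)` of pairs `(ψ↑, ψ↓)`. -/
abbrev Spinor (Λ : ℝ) : Type := WithLp 2 (L2 Λ × L2 Λ)

theorem left_ac (Λ : ℝ) :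
    ae (volume.restrict (leftIsland Λ)) ≤ ae (volume.restrict (config Λ)) :=
  ae_mono (Measure.restrict_mono subset_union_left le_rfl)

theorem right_ac (Λ : ℝ) :
    ae (volume.restrict (rightIsland Λ)) ≤ ae (volume.restrict (config Λ)) :=
  ae_mono (Measure.restrict_mono subset_union_right le_rfl)

/-! ### Functions of class `AC¹` on the closed islands and their boundary values -/

/-- `fL` and `fR` form the absolutely continuous representative of `u ∈ L²(Ω_Λ)` on the closed
islands `(-∞, -Λ]` and `[Λ, ∞)`. Two functions are used so that the end points `-Λ` and `+Λ` stay
distinct also for `Λ = 0`. -/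
structure IsACRep (Λ : ℝ) (u : L2 Λ) (fL fR : ℝ → ℂ) : Prop where
  left : IsAC1On fL (leftIsland Λ)
  right : IsAC1On fR (rightIsland Λ)
  eq_left : u =ᵐ[volume.restrict (leftIsland Λ)] fL
  eq_right : u =ᵐ[volume.restrict (rightIsland Λ)] fR

namespace IsACRep

variable {Λ : ℝ} {u v : L2 Λ} {fL fR gL gR : ℝ → ℂ}

theorem add (hu : IsACRep Λ u fL fR) (hv : IsACRep Λ v gL gR) :
    IsACRep Λ (u + v) (fL + gL) (fR + gR) where
  left := hu.left.add hv.left isOpen_Iio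
  right := hu.right.add hv.right isOpen_Ioi
  eq_left := ((Lp.coeFn_add u v).filter_mono (left_ac Λ)).trans (hu.eq_left.add hv.eq_left)
  eq_right := ((Lp.coeFn_add u v).filter_mono (right_ac Λ)).trans (hu.eq_right.add hv.eq_right)

theorem smul (c : ℂ) (hu : IsACRep Λ u fL fR) : IsACRep Λ (c • u) (c • fL) (c • fR) where
  left := hu.left.smul c
  right := hu.right.smul c
  eq_left := ((Lp.coeFn_smul c u).filter_mono (left_ac Λ)).trans (hu.eq_left.const_smul c)
  eq_right := ((Lp.coeFn_smul c u).filter_mono (right_ac Λ)).trans (hu.eq_right.const_smul c)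

theorem zero (Λ : ℝ) : IsACRep Λ 0 0 0 where
  left := IsAC1On.zero _
  right := IsAC1On.zero _
  eq_left := (Lp.coeFn_zero ℂ 2 _).filter_mono (left_ac Λ)
  eq_right := (Lp.coeFn_zero ℂ 2 _).filter_mono (right_ac Λ)

theorem memLp_glue_deriv (hu : IsACRep Λ u fL fR) :
    MemLp ((leftIsland Λ).piecewise (deriv fL) (deriv fR)) 2 (volume.restrict (config Λ)) := by
  refine MemLp.piecewise measurableSet_Iio ?_ ?_
  · refine hu.left.memLp_deriv.mono_measure ?_
    rw [Measure.restrict_restrict measurableSet_Iio]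
    exact Measure.restrict_mono inter_subset_left le_rfl
  · refine hu.right.memLp_deriv.mono_measure ?_
    rw [Measure.restrict_restrict measurableSet_Iio.compl]
    refine Measure.restrict_mono ?_ le_rfl
    rintro x ⟨h1, h2 | h2⟩
    · exact absurd h2 h1
    · exact h2

/-- The class in `L²(Ω_Λ)` of the derivative of the representative. -/
def derivLp (hu : IsACRep Λ u fL fR) : L2 Λ := hu.memLp_glue_deriv.toLp _

theorem ae_config_of {p : ℝ → Prop} (hl : ∀ᵐ x ∂volume.restrict (leftIsland Λ), p x)
    (hr : ∀ᵐ x ∂volume.restrict (rightIsland Λ), x ∉ leftIsland Λ → p x) :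
    ∀ᵐ x ∂volume.restrict (config Λ), p x := by
  rw [ae_restrict_iff' (measurableSet_Iio.union measurableSet_Ioi)]
  rw [ae_restrict_iff' measurableSet_Iio] at hl
  rw [ae_restrict_iff' measurableSet_Ioi] at hr
  filter_upwards [hl, hr] with x h1 h2 hx
  by_cases h : x ∈ leftIsland Λ
  · exact h1 h
  · exact h2 (hx.resolve_left h) h

theorem derivLp_ext (hu : IsACRep Λ u fL fR) {w : L2 Λ}
    (hl : ∀ᵐ x ∂volume.restrict (leftIsland Λ), w x = deriv fL x)
    (hr : ∀ᵐ x ∂volume.restrict (rightIsland Λ), x ∉ leftIsland Λ → w x = deriv fR x) :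
    hu.derivLp = w := by
  refine Lp.ext (hu.memLp_glue_deriv.coeFn_toLp.trans ?_)
  have hmem : ∀ᵐ x ∂volume.restrict (leftIsland Λ), x ∈ leftIsland Λ :=
    ae_restrict_mem measurableSet_Iio
  refine ae_config_of ?_ ?_
  · filter_upwards [hl, hmem] with x hx hm
    rw [piecewise_eq_of_mem _ _ _ hm, hx]
  · filter_upwards [hr] with x hx hm
    rw [piecewise_eq_of_notMem _ _ _ hm, hx hm]

theorem derivLp_left (hu : IsACRep Λ u fL fR) :
    ∀ᵐ x ∂volume.restrict (leftIsland Λ), hu.derivLp x = deriv fL x := by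
  filter_upwards [hu.memLp_glue_deriv.coeFn_toLp.filter_mono (left_ac Λ),
    ae_restrict_mem (measurableSet_Iio (a := -Λ))] with x hx hm
  exact hx.trans (piecewise_eq_of_mem _ _ _ hm)

theorem derivLp_right (hu : IsACRep Λ u fL fR) :
    ∀ᵐ x ∂volume.restrict (rightIsland Λ), x ∉ leftIsland Λ → hu.derivLp x = deriv fR x := by
  filter_upwards [hu.memLp_glue_deriv.coeFn_toLp.filter_mono (right_ac Λ)] with x hx hm
  exact hx.trans (piecewise_eq_of_notMem _ _ _ hm)

theorem derivLp_unique (hu : IsACRep Λ u fL fR) (hv : IsACRep Λ u gL gR) :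
    hu.derivLp = hv.derivLp := by
  refine hu.derivLp_ext ?_ ?_
  · filter_upwards [hv.derivLp_left, ae_restrict_mem (measurableSet_Iio (a := -Λ))] with x hx hm
    rw [hx, hu.left.deriv_eqOn hv.left isOpen_Iio (hu.eq_left.symm.trans hv.eq_left) hm]
  · filter_upwards [hv.derivLp_right, ae_restrict_mem (measurableSet_Ioi (a := Λ))] with x hx hm hn
    rw [hx hn, hu.right.deriv_eqOn hv.right isOpen_Ioi (hu.eq_right.symm.trans hv.eq_right) hm]

theorem derivLp_add (hu : IsACRep Λ u fL fR) (hv : IsACRep Λ v gL gR) :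
    (hu.add hv).derivLp = hu.derivLp + hv.derivLp := by
  have h := Lp.coeFn_add hu.derivLp hv.derivLp
  refine (hu.add hv).derivLp_ext ?_ ?_
  · filter_upwards [h.filter_mono (left_ac Λ), hu.derivLp_left, hv.derivLp_left,
      hu.left.deriv_add_ae hv.left isOpen_Iio] with x h1 h2 h3 h4
    rw [h1, h4, Pi.add_apply, Pi.add_apply, h2, h3]
  · filter_upwards [h.filter_mono (right_ac Λ), hu.derivLp_right, hv.derivLp_right,
      hu.right.deriv_add_ae hv.right isOpen_Ioi] with x h1 h2 h3 h4 hn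
    rw [h1, h4, Pi.add_apply, Pi.add_apply, h2 hn, h3 hn]

theorem derivLp_smul (c : ℂ) (hu : IsACRep Λ u fL fR) :
    (hu.smul c).derivLp = c • hu.derivLp := by
  have h := Lp.coeFn_smul c hu.derivLp
  refine (hu.smul c).derivLp_ext ?_ ?_
  · filter_upwards [h.filter_mono (left_ac Λ), hu.derivLp_left] with x h1 h2
    rw [h1, IsAC1On.deriv_const_smul', Pi.smul_apply, Pi.smul_apply, h2]
  · filter_upwards [h.filter_mono (right_ac Λ), hu.derivLp_right] with x h1 h2 hn
    rw [h1, IsAC1On.deriv_const_smul', Pi.smul_apply, Pi.smul_apply, h2 hn]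

end IsACRep

/-- `u` belongs to `AC¹` of the closed islands, with boundary values `u(-Λ) = l` and `u(+Λ) = r`. -/
def HasBoundaryValues (Λ : ℝ) (u : L2 Λ) (l r : ℂ) : Prop :=
  ∃ fL fR : ℝ → ℂ, IsACRep Λ u fL fR ∧ fL (-Λ) = l ∧ fR Λ = r

namespace HasBoundaryValues

variable {Λ : ℝ} {u v : L2 Λ} {l r l' r' : ℂ}

theorem add (hu : HasBoundaryValues Λ u l r) (hv : HasBoundaryValues Λ v l' r') :
    HasBoundaryValues Λ (u + v) (l + l') (r + r') := by
  obtain ⟨fL, fR, h, rfl, rfl⟩ := hu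
  obtain ⟨gL, gR, h', rfl, rfl⟩ := hv
  exact ⟨_, _, h.add h', rfl, rfl⟩

theorem smul (c : ℂ) (hu : HasBoundaryValues Λ u l r) :
    HasBoundaryValues Λ (c • u) (c * l) (c * r) := by
  obtain ⟨fL, fR, h, rfl, rfl⟩ := hu
  exact ⟨_, _, h.smul c, rfl, rfl⟩

theorem zero (Λ : ℝ) : HasBoundaryValues Λ 0 0 0 := ⟨_, _, IsACRep.zero Λ, rfl, rfl⟩

end HasBoundaryValues

/-- The space `AC¹₀` of `AC¹` functions that vanish at the boundary points `-Λ` and `+Λ`. -/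
def AC0 (Λ : ℝ) : Submodule ℂ (L2 Λ) where
  carrier := {u | HasBoundaryValues Λ u 0 0}
  add_mem' hu hv := by simpa using HasBoundaryValues.add hu hv
  zero_mem' := HasBoundaryValues.zero Λ
  smul_mem' c u hu := by simpa using HasBoundaryValues.smul c hu

theorem AC0.exists_rep {Λ : ℝ} (u : AC0 Λ) :
    ∃ f : (ℝ → ℂ) × (ℝ → ℂ), IsACRep Λ (u : L2 Λ) f.1 f.2 := by
  obtain ⟨fL, fR, h, -⟩ := u.2
  exact ⟨(fL, fR), h⟩

/-- The derivative `u ↦ u'` on `AC¹₀`. -/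
def derivMap (Λ : ℝ) : AC0 Λ →ₗ[ℂ] L2 Λ where
  toFun u := (AC0.exists_rep u).choose_spec.derivLp
  map_add' u v := by
    rw [← IsACRep.derivLp_add]
    exact IsACRep.derivLp_unique _ _
  map_smul' c u := by
    rw [RingHom.id_apply, ← IsACRep.derivLp_smul]
    exact IsACRep.derivLp_unique _ _

theorem derivMap_eq {Λ : ℝ} (u : AC0 Λ) {fL fR : ℝ → ℂ} (h : IsACRep Λ (u : L2 Λ) fL fR) :
    derivMap Λ u = h.derivLp :=
  IsACRep.derivLp_unique (AC0.exists_rep u).choose_spec h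

/-! ### The minimal and the maximal Dirac operator -/

/-- The minimal Dirac operator `H₀ = σₓ ⊗ p + m σ_z ⊗ I` with `p = -i d/dx`, that is
`H₀ (ψ↑, ψ↓) = (-i ψ↓' + m ψ↑, -i ψ↑' - m ψ↓)`, on the domain `ℂ² ⊗ AC¹₀`. -/
def minimalDirac (m Λ : ℝ) : Spinor Λ →ₗ.[ℂ] Spinor Λ where
  domain :=
    { carrier := {ψ | ψ.fst ∈ AC0 Λ ∧ ψ.snd ∈ AC0 Λ}
      add_mem' := fun h h' => ⟨add_mem h.1 h'.1, add_mem h.2 h'.2⟩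
      zero_mem' := ⟨zero_mem _, zero_mem _⟩
      smul_mem' := fun c _ h => ⟨Submodule.smul_mem _ c h.1, Submodule.smul_mem _ c h.2⟩ }
  toFun :=
    { toFun := fun ψ => WithLp.toLp 2
        (-Complex.I • derivMap Λ ⟨ψ.1.snd, ψ.2.2⟩ + (m : ℂ) • ψ.1.fst,
          -Complex.I • derivMap Λ ⟨ψ.1.fst, ψ.2.1⟩ - (m : ℂ) • ψ.1.snd)
      map_add' := by
        intro ψ φ
        have h1 : derivMap Λ ⟨(ψ + φ).1.snd, (ψ + φ).2.2⟩
            = derivMap Λ ⟨ψ.1.snd, ψ.2.2⟩ + derivMap Λ ⟨φ.1.snd, φ.2.2⟩ :=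
          (derivMap Λ).map_add ⟨ψ.1.snd, ψ.2.2⟩ ⟨φ.1.snd, φ.2.2⟩
        have h2 : derivMap Λ ⟨(ψ + φ).1.fst, (ψ + φ).2.1⟩
            = derivMap Λ ⟨ψ.1.fst, ψ.2.1⟩ + derivMap Λ ⟨φ.1.fst, φ.2.1⟩ :=
          (derivMap Λ).map_add ⟨ψ.1.fst, ψ.2.1⟩ ⟨φ.1.fst, φ.2.1⟩
        have h3 : (ψ + φ).1.fst = ψ.1.fst + φ.1.fst := rfl
        have h4 : (ψ + φ).1.snd = ψ.1.snd + φ.1.snd := rfl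
        rw [h1, h2, h3, h4, ← WithLp.toLp_add, Prod.mk_add_mk]
        congr 2 <;> module
      map_smul' := by
        intro c ψ
        have h1 : derivMap Λ ⟨(c • ψ).1.snd, (c • ψ).2.2⟩ = c • derivMap Λ ⟨ψ.1.snd, ψ.2.2⟩ :=
          (derivMap Λ).map_smul c ⟨ψ.1.snd, ψ.2.2⟩
        have h2 : derivMap Λ ⟨(c • ψ).1.fst, (c • ψ).2.1⟩ = c • derivMap Λ ⟨ψ.1.fst, ψ.2.1⟩ :=
          (derivMap Λ).map_smul c ⟨ψ.1.fst, ψ.2.1⟩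
        have h3 : (c • ψ).1.fst = c • ψ.1.fst := rfl
        have h4 : (c • ψ).1.snd = c • ψ.1.snd := rfl
        rw [h1, h2, h3, h4, RingHom.id_apply, ← WithLp.toLp_smul, Prod.smul_mk]
        congr 2 <;> module }

/-- The maximal Dirac operator `H₀*`, the Hilbert space adjoint of the minimal one. -/
def maximalDirac (m Λ : ℝ) : Spinor Λ →ₗ.[ℂ] Spinor Λ := (minimalDirac m Λ)†

/-- `ker (z - H₀*)`; for `z = i` and `z = -i` these are the deficiency subspaces `K₊(H₀)` and
`K₋(H₀)`. -/
def deficiencySubspace (m Λ : ℝ) (z : ℂ) : Submodule ℂ (Spinor Λ) where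
  carrier := {ψ | ∃ h : ψ ∈ (maximalDirac m Λ).domain, maximalDirac m Λ ⟨ψ, h⟩ = z • ψ}
  add_mem' := by
    rintro ψ φ ⟨h, e⟩ ⟨h', e'⟩
    refine ⟨add_mem h h', ?_⟩
    rw [smul_add, ← e, ← e']
    exact (maximalDirac m Λ).map_add ⟨ψ, h⟩ ⟨φ, h'⟩
  zero_mem' := ⟨zero_mem _, by rw [smul_zero]; exact (maximalDirac m Λ).map_zero⟩
  smul_mem' := by
    rintro c ψ ⟨h, e⟩
    refine ⟨Submodule.smul_mem _ c h, ?_⟩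
    rw [smul_comm, ← e]
    exact (maximalDirac m Λ).map_smul c ⟨ψ, h⟩

/-! ### The deficiency functions and the von Neumann extensions -/

/-- `μ = (1 + i m) / √(1 + m²)`. -/
def mu (m : ℝ) : ℂ := (1 + Complex.I * m) / (Real.sqrt (1 + m ^ 2) : ℝ)

/-- `N = (1 + m²)^(1/4) exp(-√(1 + m²) Λ)`. -/
def normConst (m Λ : ℝ) : ℝ :=
  (1 + m ^ 2) ^ (1 / 4 : ℝ) * Real.exp (-(Real.sqrt (1 + m ^ 2) * Λ))

/-- The function `N χ_L(x) exp(√(1 + m²) x)`. -/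
def expLeftFun (m Λ : ℝ) : ℝ → ℂ :=
  (Iic (-Λ)).indicator fun x => ((normConst m Λ * Real.exp (Real.sqrt (1 + m ^ 2) * x) : ℝ) : ℂ)

/-- The function `N χ_R(x) exp(-√(1 + m²) x)`. -/
def expRightFun (m Λ : ℝ) : ℝ → ℂ :=
  (Ici Λ).indicator fun x => ((normConst m Λ * Real.exp (-Real.sqrt (1 + m ^ 2) * x) : ℝ) : ℂ)

theorem sqrt_pos' (m : ℝ) : 0 < Real.sqrt (1 + m ^ 2) := Real.sqrt_pos.2 (by positivity)

theorem memLp_two_exp {k c : ℝ} {s : Set ℝ} (hs : MeasurableSet s)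
    (h : IntegrableOn (fun x => Real.exp (2 * k * x)) s) (μ : Measure ℝ) (hμ : μ ≤ volume) :
    MemLp (s.indicator fun x => ((c * Real.exp (k * x) : ℝ) : ℂ)) 2 μ := by
  refine MemLp.mono_measure hμ ((memLp_indicator_iff_restrict hs).2 ?_)
  have hm : Measurable fun x : ℝ => ((c * Real.exp (k * x) : ℝ) : ℂ) := by fun_prop
  rw [memLp_two_iff_integrable_sq_norm hm.aestronglyMeasurable]
  refine (Integrable.const_mul h (c ^ 2)).congr (Filter.Eventually.of_forall fun x => ?_)
  simp only [Complex.norm_real, Real.norm_eq_abs, sq_abs, mul_pow, ← Real.exp_nat_mul]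
  congr 2
  push_cast
  ring

theorem memLp_expLeft (m Λ : ℝ) : MemLp (expLeftFun m Λ) 2 (volume.restrict (config Λ)) :=
  memLp_two_exp measurableSet_Iic
    (integrableOn_exp_mul_Iic (mul_pos two_pos (sqrt_pos' m)) (-Λ)) _ Measure.restrict_le_self

theorem memLp_expRight (m Λ : ℝ) : MemLp (expRightFun m Λ) 2 (volume.restrict (config Λ)) :=
  memLp_two_exp measurableSet_Ici
    (((integrableOn_exp_mul_Ioi (by linarith [sqrt_pos' m]) Λ).congr_set_ae
      Ioi_ae_eq_Ici.symm)) _ Measure.restrict_le_self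

/-- `N χ_L exp(√(1 + m²) x)` in `L²(Ω_Λ)`. -/
def expLeft (m Λ : ℝ) : L2 Λ := (memLp_expLeft m Λ).toLp _

/-- `N χ_R exp(-√(1 + m²) x)` in `L²(Ω_Λ)`. -/
def expRight (m Λ : ℝ) : L2 Λ := (memLp_expRight m Λ).toLp _

/-- The basis `ψ_L⁺` (index `0`), `ψ_R⁺` (index `1`) of `K₊(H₀)`. -/
def psiPlus (m Λ : ℝ) : Fin 2 → Spinor Λ :=
  ![WithLp.toLp 2 (expLeft m Λ, -mu m • expLeft m Λ),
    WithLp.toLp 2 (expRight m Λ, mu m • expRight m Λ)]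

/-- The basis `ψ_L⁻` (index `0`), `ψ_R⁻` (index `1`) of `K₋(H₀)`. -/
def psiMinus (m Λ : ℝ) : Fin 2 → Spinor Λ :=
  ![WithLp.toLp 2 (expLeft m Λ, star (mu m) • expLeft m Λ),
    WithLp.toLp 2 (expRight m Λ, -star (mu m) • expRight m Λ)]

/-- The operator on the span of the orthogonal vectors `ψ_L⁺, ψ_R⁺` that the matrix `U = (u_jk)`
stands for, `ψ_j⁺ ↦ ∑ₖ u_jk ψ_k⁻`, extended by zero to the orthogonal complement. The coefficient
of `ψ` along `ψ_j⁺` is `⟨ψ_j⁺, ψ⟩ / ⟨ψ_j⁺, ψ_j⁺⟩`. -/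
def matrixOperator (m Λ : ℝ) (U : Matrix (Fin 2) (Fin 2) ℂ) : Spinor Λ →ₗ[ℂ] Spinor Λ :=
  ∑ j, ((⟪psiPlus m Λ j, psiPlus m Λ j⟫_ℂ)⁻¹ • (innerₛₗ ℂ (psiPlus m Λ j))).smulRight
    (∑ k, U j k • psiMinus m Λ k)

theorem inner_expLeft_expRight {m Λ : ℝ} (hΛ : 0 ≤ Λ) :
    ⟪expLeft m Λ, expRight m Λ⟫_ℂ = 0 := by
  rw [L2.inner_def]
  refine integral_eq_zero_of_ae ?_
  filter_upwards [(memLp_expLeft m Λ).coeFn_toLp, (memLp_expRight m Λ).coeFn_toLp,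
    ae_restrict_mem (measurableSet_Iio.union measurableSet_Ioi)] with x h1 h2 hx
  rw [expLeft, expRight, h1, h2]
  rcases hx with hx | hx
  · have h : x ∉ Ici Λ := by
      simp only [leftIsland, mem_Iio, mem_Ici, not_le] at *
      linarith
    simp [expRightFun, h]
  · have h : x ∉ Iic (-Λ) := by
      simp only [rightIsland, mem_Ioi, mem_Iic, not_le] at *
      linarith
    simp [expLeftFun, h]

theorem normConst_pos (m Λ : ℝ) : 0 < normConst m Λ := by
  unfold normConst
  positivity

theorem expLeft_ne_zero (m Λ : ℝ) : expLeft m Λ ≠ 0 := by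
  intro h0
  have h : ∀ᵐ x ∂volume.restrict (leftIsland Λ), False := by
    have h1 := (memLp_expLeft m Λ).coeFn_toLp.filter_mono (left_ac Λ)
    have h2 := (Lp.coeFn_zero ℂ 2 (volume.restrict (config Λ))).filter_mono (left_ac Λ)
    rw [← h0] at h2
    filter_upwards [h1, h2, ae_restrict_mem (measurableSet_Iio (a := -Λ))] with x e1 e2 hx
    have hx' : x ∈ Iic (-Λ) := Iio_subset_Iic_self hx
    have e3 := e1.symm.trans e2
    rw [expLeftFun, indicator_of_mem hx', Pi.zero_apply, Complex.ofReal_eq_zero] at e3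
    exact (mul_pos (normConst_pos m Λ) (Real.exp_pos _)).ne' e3
  rw [Filter.eventually_false_iff_eq_bot, ae_eq_bot, Measure.restrict_eq_zero] at h
  simp at h

theorem expRight_ne_zero (m Λ : ℝ) : expRight m Λ ≠ 0 := by
  intro h0
  have h : ∀ᵐ x ∂volume.restrict (rightIsland Λ), False := by
    have h1 := (memLp_expRight m Λ).coeFn_toLp.filter_mono (right_ac Λ)
    have h2 := (Lp.coeFn_zero ℂ 2 (volume.restrict (config Λ))).filter_mono (right_ac Λ)
    rw [← h0] at h2
    filter_upwards [h1, h2, ae_restrict_mem (measurableSet_Ioi (a := Λ))] with x e1 e2 hx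
    have hx' : x ∈ Ici Λ := Ioi_subset_Ici_self hx
    have e3 := e1.symm.trans e2
    rw [expRightFun, indicator_of_mem hx', Pi.zero_apply, Complex.ofReal_eq_zero] at e3
    exact (mul_pos (normConst_pos m Λ) (Real.exp_pos _)).ne' e3
  rw [Filter.eventually_false_iff_eq_bot, ae_eq_bot, Measure.restrict_eq_zero] at h
  simp at h

theorem inner_psiPlus_self_ne_zero (m Λ : ℝ) (j : Fin 2) :
    ⟪psiPlus m Λ j, psiPlus m Λ j⟫_ℂ ≠ 0 := by
  rw [inner_self_ne_zero]
  intro h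
  fin_cases j
  · exact expLeft_ne_zero m Λ (congrArg WithLp.fst h)
  · exact expRight_ne_zero m Λ (congrArg WithLp.fst h)

theorem inner_psiPlus_of_ne {m Λ : ℝ} (hΛ : 0 ≤ Λ) {j k : Fin 2} (hjk : j ≠ k) :
    ⟪psiPlus m Λ j, psiPlus m Λ k⟫_ℂ = 0 := by
  have h := inner_expLeft_expRight (m := m) hΛ
  have h' : ⟪expRight m Λ, expLeft m Λ⟫_ℂ = 0 := inner_eq_zero_symm.1 h
  fin_cases j <;> fin_cases k
  · exact absurd rfl hjk
  · simp [psiPlus, inner_smul_left, inner_smul_right, h]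
  · simp [psiPlus, inner_smul_left, inner_smul_right, h']
  · exact absurd rfl hjk

/-- The operator of the matrix `U = (u_jk)` sends `ψ_j⁺` to `∑ₖ u_jk ψ_k⁻`. -/
theorem matrixOperator_psiPlus {m Λ : ℝ} (hΛ : 0 ≤ Λ) (U : Matrix (Fin 2) (Fin 2) ℂ) (j : Fin 2) :
    matrixOperator m Λ U (psiPlus m Λ j) = ∑ k, U j k • psiMinus m Λ k := by
  have h : ∀ i, (⟪psiPlus m Λ i, psiPlus m Λ i⟫_ℂ)⁻¹ * ⟪psiPlus m Λ i, psiPlus m Λ j⟫_ℂ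
      = if i = j then 1 else 0 := by
    intro i
    split_ifs with hij
    · rw [hij, inv_mul_cancel₀ (inner_psiPlus_self_ne_zero m Λ j)]
    · rw [inner_psiPlus_of_ne hΛ hij, mul_zero]
  simp only [matrixOperator, LinearMap.sum_apply, LinearMap.smulRight_apply, LinearMap.smul_apply,
    innerₛₗ_apply_apply, smul_eq_mul, h]
  rw [Finset.sum_eq_single j] <;> simp +contextual

/-- The domain `D(H_U) = {ψ₀ + ψ⁺ + U ψ⁺ | ψ₀ ∈ D(H₀), ψ⁺ ∈ K₊(H₀)}`. -/
def vonNeumannDomain (m Λ : ℝ) (U : Matrix (Fin 2) (Fin 2) ℂ) : Submodule ℂ (Spinor Λ) :=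
  (minimalDirac m Λ).domain ⊔
    (deficiencySubspace m Λ Complex.I).map (LinearMap.id + matrixOperator m Λ U)

/-- The operator `H_U`, the restriction of `H₀*` to `D(H_U)`. -/
def HU (m Λ : ℝ) (U : Matrix (Fin 2) (Fin 2) ℂ) : Spinor Λ →ₗ.[ℂ] Spinor Λ :=
  (maximalDirac m Λ).domRestrict (vonNeumannDomain m Λ U)

/-- `A` is a self-adjoint extension of the minimal Dirac operator. -/
def IsSelfAdjointExtension (m Λ : ℝ) (A : Spinor Λ →ₗ.[ℂ] Spinor Λ) : Prop :=
  minimalDirac m Λ ≤ A ∧ IsSelfAdjoint A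

/-! ### The boundary conditions -/

/-- The condition `i ρ a = b` if `ρ ∈ ℝ` and `a = 0` if `ρ = +∞`, on a spin-up boundary value `a`
and a spin-down boundary value `b`. -/
def RhoCondition (ρ : WithTop ℝ) (a b : ℂ) : Prop :=
  (∀ r : ℝ, ρ = (r : WithTop ℝ) → Complex.I * r * a = b) ∧ (ρ = ⊤ → a = 0)

theorem RhoCondition.add {ρ : WithTop ℝ} {a b a' b' : ℂ} (h : RhoCondition ρ a b)
    (h' : RhoCondition ρ a' b') : RhoCondition ρ (a + a') (b + b') :=
  ⟨fun r hr => by rw [← h.1 r hr, ← h'.1 r hr]; ring,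
    fun hr => by rw [h.2 hr, h'.2 hr, add_zero]⟩

theorem RhoCondition.smul {ρ : WithTop ℝ} {a b : ℂ} (c : ℂ) (h : RhoCondition ρ a b) :
    RhoCondition ρ (c * a) (c * b) :=
  ⟨fun r hr => by rw [← h.1 r hr]; ring, fun hr => by rw [h.2 hr, mul_zero]⟩

theorem RhoCondition.zero (ρ : WithTop ℝ) : RhoCondition ρ 0 0 :=
  ⟨fun r _ => by simp, fun _ => rfl⟩

/-- `D(H_ρ)`, `ρ = (ρ₊, ρ₋)`: the `ψ ∈ D(H₀*)` with `i ρ₊ ψ↑(+Λ) = ψ↓(+Λ)` (or `ψ↑(+Λ) = 0` if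
`ρ₊ = +∞`) and `i ρ₋ ψ↑(-Λ) = ψ↓(-Λ)` (or `ψ↑(-Λ) = 0` if `ρ₋ = +∞`). -/
def rhoDomain (m Λ : ℝ) (ρp ρm : WithTop ℝ) : Submodule ℂ (Spinor Λ) where
  carrier := {ψ | ψ ∈ (maximalDirac m Λ).domain ∧ ∃ upL upR downL downR : ℂ,
    HasBoundaryValues Λ ψ.fst upL upR ∧ HasBoundaryValues Λ ψ.snd downL downR ∧
      RhoCondition ρp upR downR ∧ RhoCondition ρm upL downL}
  add_mem' := by
    rintro ψ φ ⟨h, a, b, c, d, h1, h2, h3, h4⟩ ⟨h', a', b', c', d', h1', h2', h3', h4'⟩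
    exact ⟨add_mem h h', _, _, _, _, h1.add h1', h2.add h2', h3.add h3', h4.add h4'⟩
  zero_mem' := ⟨zero_mem _, 0, 0, 0, 0, HasBoundaryValues.zero Λ, HasBoundaryValues.zero Λ,
    RhoCondition.zero _, RhoCondition.zero _⟩
  smul_mem' := by
    rintro c ψ ⟨h, _, _, _, _, h1, h2, h3, h4⟩
    exact ⟨Submodule.smul_mem _ c h, _, _, _, _, h1.smul c, h2.smul c, h3.smul c, h4.smul c⟩

/-- The operator `H_ρ`, the restriction of `H₀*` to `D(H_ρ)`. -/
def HRho (m Λ : ℝ) (ρp ρm : WithTop ℝ) : Spinor Λ →ₗ.[ℂ] Spinor Λ :=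
  (maximalDirac m Λ).domRestrict (rhoDomain m Λ ρp ρm)

/-- The class of admissible vectors `α = (α₁, α₂, α₃, α₄)`. -/
def AlphaClass (α₁ α₂ α₃ α₄ : ℂ) : Prop :=
  (α₁ * star α₂).re = 0 ∧ (α₁ * star α₃).re = 0 ∧
  (α₂ * star α₄).re = 0 ∧ (α₃ * star α₄).re = 0 ∧
  α₁ * star α₄ + α₂ * star α₃ = 1 ∧ α₁ * star α₄ + star α₂ * α₃ = 1

/-- `D(H_α)`: the `ψ ∈ D(H₀*)` with `ψ(+Λ) = B ψ(-Λ)`, where `B` is the boundary matrix with rows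
`(α₁, α₂)` and `(α₃, α₄)`. -/
def alphaDomain (m Λ : ℝ) (B : Matrix (Fin 2) (Fin 2) ℂ) : Submodule ℂ (Spinor Λ) where
  carrier := {ψ | ψ ∈ (maximalDirac m Λ).domain ∧ ∃ upL upR downL downR : ℂ,
    HasBoundaryValues Λ ψ.fst upL upR ∧ HasBoundaryValues Λ ψ.snd downL downR ∧
      ![upR, downR] = B.mulVec ![upL, downL]}
  add_mem' := by
    rintro ψ φ ⟨h, a, b, c, d, h1, h2, h3⟩ ⟨h', a', b', c', d', h1', h2', h3'⟩
    refine ⟨add_mem h h', _, _, _, _, h1.add h1', h2.add h2', ?_⟩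
    have e : ∀ x y x' y' : ℂ, ![x + x', y + y'] = ![x, y] + ![x', y'] := by simp
    rw [e, e, Matrix.mulVec_add, h3, h3']
  zero_mem' := ⟨zero_mem _, 0, 0, 0, 0, HasBoundaryValues.zero Λ, HasBoundaryValues.zero Λ, by
    have e : (![0, 0] : Fin 2 → ℂ) = 0 := by simp
    rw [e, Matrix.mulVec_zero]⟩
  smul_mem' := by
    rintro k ψ ⟨h, a, b, c, d, h1, h2, h3⟩
    refine ⟨Submodule.smul_mem _ k h, _, _, _, _, h1.smul k, h2.smul k, ?_⟩
    have e : ∀ x y : ℂ, ![k * x, k * y] = k • ![x, y] := by simp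
    rw [e, e, Matrix.mulVec_smul, h3]

/-- The operator `H_α`, the restriction of `H₀*` to `D(H_α)`. -/
def HAlpha (m Λ : ℝ) (α₁ α₂ α₃ α₄ : ℂ) : Spinor Λ →ₗ.[ℂ] Spinor Λ :=
  (maximalDirac m Λ).domRestrict (alphaDomain m Λ !![α₁, α₂; α₃, α₄])

/-- The argument of a complex number, normalised to lie in `[0, 2π)`. -/
def arg0 (z : ℂ) : ℝ := toIcoMod Real.two_pi_pos 0 (Complex.arg z)

end DiracJunction

end

/-!
# Self-adjoint extensions of the one-dimensional Dirac operator with a junction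

Write `T` for the minimal operator. The argument has an analytic, an abstract and an algebraic part.

*The adjoint.* Testing `ψ ∈ D(T*)` against `(0, f)` and `(f, 0)`, with `f ∈ AC¹` vanishing at the
two edges, shows that both components of `ψ` have a weak derivative in `L²`. A du Bois-Reymond
argument (`IsWeakDeriv.exists_const`, `IsWeakDeriv.exists_rep`) then gives `AC¹` representatives, so
every such `ψ` has four boundary values (`exists_spinorBoundary`). Integration by parts on the two
half-lines (`IsACRep.inner_derivLp`) gives the converse (`adjoint_of_rep`).

*Von Neumann's theorem in coordinates.* `DeficiencyBases T p q n` collects what is needed: families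
`p`, `q` of orthogonal eigenvectors of `T*` for the eigenvalues `i` and `-i`, of common squared norm
`n`, such that `D(T*)` is the sum of `D(T)` and their spans. If `ψ, ψ'` have coordinates `(x, y)` and
`(x', y')` along `(p, q)`, then `⟪T*ψ, ψ'⟫ - ⟪ψ, T*ψ'⟫` is a nonzero multiple of `x*·x' - y*·y'`
(`DeficiencyBases.green`). Self-adjoint extensions are therefore the maximal isotropic subspaces of
this form, which are the graphs `y = xU` of unitary matrices (`DeficiencyBases.isSelfAdjoint_iff`).
The same form shows that the eigenspace of `T*` for `i` is spanned by `p`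
(`DeficiencyBases.mem_span_plus`), so that no differential equation has to be solved.

*Boundary values.* The four exponential functions are eigenvectors of `T*`, and the map from their
four coefficients to the four boundary values is a linear bijection
(`HasSpinorBoundary.hasCoords_iff'`). This yields the decomposition of `D(T*)` and the formula
`y = xU` as a pair of linear equations between boundary values (`HasSpinorBoundary.mem_HU_iff`).
All boundary values occur, so two domains agree if and only if their boundary conditions have the
same solutions in `ℂ⁴` (`domain_eq_iff`).

*Linear algebra.* For diagonal `U` the conditions separate; on each side they fix the ratio of the
two components, and `(1 + γ) i tan (θ / 2) = γ - 1` for `γ = exp (iθ)` turns it into the stated form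
(`left_condition_iff`, `right_condition_iff`). For non-diagonal `U` the two equations can be solved
for the values at `+Λ`, because `γ₂ ≠ 0`; the resulting matrix `α` is determined by its graph, and
the class `AlphaClass` follows from one quadratic identity (`IsTransmission.mul_add_mul`).
-/

noncomputable section

namespace DiracJunction

/-! ### Complex-valued absolutely continuous functions -/

open Filter Topology

/-- Absolute continuity passes to any function whose increments are dominated. -/
theorem absolutelyContinuousOnInterval_of_dist_le {X Y : Type*} [PseudoMetricSpace X]
    [PseudoMetricSpace Y] {f : ℝ → X} {g : ℝ → Y} {a b : ℝ}
    (hf : AbsolutelyContinuousOnInterval f a b) (h : ∀ x y, dist (g x) (g y) ≤ dist (f x) (f y)) :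
    AbsolutelyContinuousOnInterval g a b :=
  squeeze_zero (fun _ => Finset.sum_nonneg fun _ _ => dist_nonneg)
    (fun _ => Finset.sum_le_sum fun _ _ => h _ _) hf

section ComplexAC

variable {f g : ℝ → ℂ} {a b : ℝ}

theorem ac_re (hf : AbsolutelyContinuousOnInterval f a b) :
    AbsolutelyContinuousOnInterval (fun x => (f x).re) a b :=
  absolutelyContinuousOnInterval_of_dist_le hf fun x y => by
    rw [Real.dist_eq, ← Complex.sub_re, Complex.dist_eq]
    exact Complex.abs_re_le_norm _

theorem ac_im (hf : AbsolutelyContinuousOnInterval f a b) :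
    AbsolutelyContinuousOnInterval (fun x => (f x).im) a b :=
  absolutelyContinuousOnInterval_of_dist_le hf fun x y => by
    rw [Real.dist_eq, ← Complex.sub_im, Complex.dist_eq]
    exact Complex.abs_im_le_norm _

theorem ac_ofReal {f : ℝ → ℝ} (hf : AbsolutelyContinuousOnInterval f a b) :
    AbsolutelyContinuousOnInterval (fun x => (f x : ℂ)) a b :=
  absolutelyContinuousOnInterval_of_dist_le hf fun _ _ => (Complex.isometry_ofReal.dist_eq _ _).le

theorem intervalIntegrable_ofReal {f : ℝ → ℝ} (hf : IntervalIntegrable f volume a b) :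
    IntervalIntegrable (fun x => (f x : ℂ)) volume a b :=
  ⟨hf.1.ofReal, hf.2.ofReal⟩

theorem ac_star (hf : AbsolutelyContinuousOnInterval f a b) :
    AbsolutelyContinuousOnInterval (fun x => star (f x)) a b :=
  absolutelyContinuousOnInterval_of_dist_le hf fun _ _ => (dist_star_star _ _).le

theorem ac_const (k : ℂ) (a b : ℝ) : AbsolutelyContinuousOnInterval (fun _ => k) a b :=
  ((LipschitzWith.const k).lipschitzOnWith).absolutelyContinuousOnInterval

theorem ae_differentiableAt_of_ac (hf : AbsolutelyContinuousOnInterval f a b) :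
    ∀ᵐ x : ℝ, x ∈ uIcc a b → DifferentiableAt ℝ f x :=
  hf.boundedVariationOn.ae_differentiableAt_of_mem_uIcc

theorem hasDerivAt_re {x : ℝ} (h : DifferentiableAt ℝ f x) :
    HasDerivAt (fun x => (f x).re) (deriv f x).re x :=
  Complex.reCLM.hasFDerivAt.comp_hasDerivAt x h.hasDerivAt

theorem hasDerivAt_im {x : ℝ} (h : DifferentiableAt ℝ f x) :
    HasDerivAt (fun x => (f x).im) (deriv f x).im x :=
  Complex.imCLM.hasFDerivAt.comp_hasDerivAt x h.hasDerivAt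

theorem integral_deriv_eq_sub_of_ac (hf : AbsolutelyContinuousOnInterval f a b) :
    ∫ x in a..b, deriv f x = f b - f a := by
  have h1 := (ac_re hf).intervalIntegrable_deriv
  have h2 := (ac_im hf).intervalIntegrable_deriv
  have e : ∫ x in a..b, deriv f x = ∫ x in a..b,
      ((deriv (fun x => (f x).re) x : ℝ) : ℂ) +
        ((deriv (fun x => (f x).im) x : ℝ) : ℂ) * Complex.I := by
    refine intervalIntegral.integral_congr_ae ?_
    filter_upwards [ae_differentiableAt_of_ac hf] with x hx hm
    have hd := hx (uIoc_subset_uIcc hm)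
    rw [(hasDerivAt_re hd).deriv, (hasDerivAt_im hd).deriv, Complex.re_add_im]
  rw [e, intervalIntegral.integral_add (intervalIntegrable_ofReal h1)
      ((intervalIntegrable_ofReal h2).mul_const _),
    intervalIntegral.integral_mul_const, intervalIntegral.integral_ofReal,
    intervalIntegral.integral_ofReal, (ac_re hf).integral_deriv_eq_sub,
    (ac_im hf).integral_deriv_eq_sub]
  apply Complex.ext <;> simp

theorem ac_integral (hf : ∀ a b, IntervalIntegrable f volume a b) (c a b : ℝ) :
    AbsolutelyContinuousOnInterval (fun x => ∫ t in c..x, f t) a b := by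
  have hre : ∀ a b, IntervalIntegrable (fun t => (f t).re) volume a b := fun a b =>
    ⟨(hf a b).1.re, (hf a b).2.re⟩
  have him : ∀ a b, IntervalIntegrable (fun t => (f t).im) volume a b := fun a b =>
    ⟨(hf a b).1.im, (hf a b).2.im⟩
  have hsub : uIcc a b ⊆ uIcc (min c (min a b)) (max c (max a b)) := by
    rw [uIcc_of_le (a := min c (min a b)) (by grind)]
    exact Icc_subset_Icc (min_le_right _ _) (le_max_right _ _)
  have hc : c ∈ uIcc (min c (min a b)) (max c (max a b)) := by
    rw [uIcc_of_le (by grind)]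
    exact ⟨min_le_left _ _, le_max_left _ _⟩
  have h1 := ac_ofReal (((hre _ _).absolutelyContinuousOnInterval_intervalIntegral hc).mono hsub)
  have h2 := ac_ofReal (((him _ _).absolutelyContinuousOnInterval_intervalIntegral hc).mono hsub)
  have e : (fun x => ∫ t in c..x, f t) = fun x => ((∫ t in c..x, (f t).re : ℝ) : ℂ) +
      Complex.I • ((∫ t in c..x, (f t).im : ℝ) : ℂ) := by
    funext x
    rw [← intervalIntegral.integral_ofReal, ← intervalIntegral.integral_ofReal, smul_eq_mul,
      ← intervalIntegral.integral_const_mul, ← intervalIntegral.integral_add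
        (intervalIntegrable_ofReal (hre c x)) ((intervalIntegrable_ofReal (him c x)).const_mul _)]
    congr 1
    funext t
    rw [mul_comm, Complex.re_add_im]
  rw [e]
  exact h1.fun_add (h2.const_smul Complex.I)

theorem ae_hasDerivAt_integral (hf : ∀ a b, IntervalIntegrable f volume a b) (c : ℝ) :
    ∀ᵐ x : ℝ, HasDerivAt (fun x => ∫ t in c..x, f t) (f x) x := by
  have h : ∀ᵐ x : ℝ, ∀ n : ℕ, x ∈ uIcc (c - n) (c + n) →
      HasDerivAt (fun x => ∫ t in c..x, f t) (f x) x := by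
    rw [ae_all_iff]
    intro n
    filter_upwards [(hf (c - n) (c + n)).ae_hasDerivAt_integral] with x hx hm
    refine hx hm c ?_
    rw [uIcc_of_le (by linarith [n.cast_nonneg (α := ℝ)])]
    constructor <;> linarith [n.cast_nonneg (α := ℝ)]
  filter_upwards [h] with x hx
  obtain ⟨n, hn⟩ := exists_nat_ge |x - c|
  refine hx n ?_
  rw [uIcc_of_le (by linarith [n.cast_nonneg (α := ℝ)])]
  have := abs_le.1 hn
  constructor <;> linarith

end ComplexAC

/-! ### Integration by parts on the half-lines -/

theorem eq_zero_of_tendsto_atTop {F : ℝ → ℂ} {a : ℝ} {L : ℂ} (hF : IntegrableOn F (Ioi a))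
    (h : Tendsto F atTop (𝓝 L)) : L = 0 :=
  IntegrableAtFilter.eq_zero_of_tendsto ⟨Ioi a, Ioi_mem_atTop a, hF⟩
    (fun s hs => by
      obtain ⟨b, hb⟩ := mem_atTop_sets.1 hs
      exact top_unique (Real.volume_Ici (a := b) ▸ measure_mono hb)) h

theorem eq_zero_of_tendsto_atBot {F : ℝ → ℂ} {a : ℝ} {L : ℂ} (hF : IntegrableOn F (Iio a))
    (h : Tendsto F atBot (𝓝 L)) : L = 0 :=
  IntegrableAtFilter.eq_zero_of_tendsto ⟨Iio a, Iio_mem_atBot a, hF⟩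
    (fun s hs => by
      obtain ⟨b, hb⟩ := mem_atBot_sets.1 hs
      exact top_unique (Real.volume_Iic (a := b) ▸ measure_mono hb)) h

/-- An integrable locally absolutely continuous function with integrable derivative tends to zero
at infinity, so only the boundary term at `a` survives. -/
theorem integral_Ioi_deriv_of_ac {F : ℝ → ℂ} {a : ℝ}
    (hac : ∀ x, a ≤ x → AbsolutelyContinuousOnInterval F a x) (hF : IntegrableOn F (Ioi a))
    (hF' : IntegrableOn (deriv F) (Ioi a)) : ∫ x in Ioi a, deriv F x = -F a := by
  have h := intervalIntegral_tendsto_integral_Ioi a hF' tendsto_id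
  have h2 : Tendsto F atTop (𝓝 ((∫ x in Ioi a, deriv F x) + F a)) := by
    refine (h.add_const (F a)).congr' ?_
    filter_upwards [eventually_ge_atTop a] with x hx
    simp [integral_deriv_eq_sub_of_ac (hac x hx)]
  exact eq_neg_of_add_eq_zero_left (eq_zero_of_tendsto_atTop hF h2)

theorem integral_Iio_deriv_of_ac {F : ℝ → ℂ} {a : ℝ}
    (hac : ∀ x, x ≤ a → AbsolutelyContinuousOnInterval F x a) (hF : IntegrableOn F (Iio a))
    (hF' : IntegrableOn (deriv F) (Iio a)) : ∫ x in Iio a, deriv F x = F a := by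
  have h := intervalIntegral_tendsto_integral_Iic a (hF'.congr_set_ae Iio_ae_eq_Iic.symm) tendsto_id
  rw [integral_Iic_eq_integral_Iio] at h
  have h2 : Tendsto F atBot (𝓝 (F a - ∫ x in Iio a, deriv F x)) := by
    refine (h.const_sub (F a)).congr' ?_
    filter_upwards [eventually_le_atBot a] with x hx
    simp [integral_deriv_eq_sub_of_ac (hac x hx)]
  exact (sub_eq_zero.1 (eq_zero_of_tendsto_atBot hF h2)).symm

theorem integrableOn_mul_star_of_memLp {f g : ℝ → ℂ} {s : Set ℝ}
    (hf : MemLp f 2 (volume.restrict s)) (hg : MemLp g 2 (volume.restrict s)) :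
    IntegrableOn (fun x => g x * star (f x)) s := by
  have h := MemLp.integrable_mul hg hf.star
  exact h

section IBP

variable {f g : ℝ → ℂ} {s : Set ℝ}

theorem IsAC1On.ac_mul_star (hf : IsAC1On f s) (hg : IsAC1On g s) {a b : ℝ} (ha : a ∈ closure s)
    (hb : b ∈ closure s) : AbsolutelyContinuousOnInterval (fun x => g x * star (f x)) a b :=
  (hg.ac a ha b hb).fun_smul (ac_star (hf.ac a ha b hb))

theorem IsAC1On.deriv_mul_star (hf : IsAC1On f s) (hg : IsAC1On g s) (hs : IsOpen s) :
    deriv (fun x => g x * star (f x)) =ᵐ[volume.restrict s]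
      fun x => g x * star (deriv f x) + deriv g x * star (f x) := by
  filter_upwards [hf.ae_differentiableAt hs, hg.ae_differentiableAt hs] with x hx hy
  rw [(hy.hasDerivAt.fun_mul hx.hasDerivAt.star).deriv, add_comm]

theorem IsAC1On.integrableOn_mul_star (hf : IsAC1On f s) (hg : IsAC1On g s) :
    IntegrableOn (fun x => g x * star (f x)) s :=
  integrableOn_mul_star_of_memLp hf.memLp hg.memLp

theorem IsAC1On.integrableOn_deriv_mul_star (hf : IsAC1On f s) (hg : IsAC1On g s) (hs : IsOpen s) :
    IntegrableOn (deriv fun x => g x * star (f x)) s :=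
  (Integrable.add (integrableOn_mul_star_of_memLp hf.memLp_deriv hg.memLp)
    (integrableOn_mul_star_of_memLp hf.memLp hg.memLp_deriv)).congr (hf.deriv_mul_star hg hs).symm

theorem IsAC1On.integral_Ioi {a : ℝ} (hf : IsAC1On f (Ioi a)) (hg : IsAC1On g (Ioi a)) :
    ∫ x in Ioi a, g x * star (deriv f x) + deriv g x * star (f x) = -(g a * star (f a)) := by
  rw [← integral_congr_ae (hf.deriv_mul_star hg isOpen_Ioi)]
  refine integral_Ioi_deriv_of_ac (F := fun x => g x * star (f x)) (fun x hx => ?_)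
    (hf.integrableOn_mul_star hg) (hf.integrableOn_deriv_mul_star hg isOpen_Ioi)
  refine hf.ac_mul_star hg ?_ ?_ <;> rw [closure_Ioi]
  exacts [self_mem_Ici, hx]

theorem IsAC1On.integral_Iio {a : ℝ} (hf : IsAC1On f (Iio a)) (hg : IsAC1On g (Iio a)) :
    ∫ x in Iio a, g x * star (deriv f x) + deriv g x * star (f x) = g a * star (f a) := by
  rw [← integral_congr_ae (hf.deriv_mul_star hg isOpen_Iio)]
  refine integral_Iio_deriv_of_ac (F := fun x => g x * star (f x)) (fun x hx => ?_)
    (hf.integrableOn_mul_star hg) (hf.integrableOn_deriv_mul_star hg isOpen_Iio)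
  refine hf.ac_mul_star hg ?_ ?_ <;> rw [closure_Iio]
  exacts [hx, self_mem_Iic]

end IBP

theorem disjoint_islands {Λ : ℝ} (hΛ : 0 ≤ Λ) : Disjoint (leftIsland Λ) (rightIsland Λ) := by
  rw [Set.disjoint_left]
  intro x h1 h2
  simp only [mem_Iio, mem_Ioi] at h1 h2
  linarith

/-- The inner product of `L²(Ω_Λ)` splits into the contributions of the two islands. -/
theorem inner_eq_add {Λ : ℝ} (hΛ : 0 ≤ Λ) (u v : L2 Λ) :
    ⟪u, v⟫_ℂ = (∫ x in leftIsland Λ, v x * star (u x)) + ∫ x in rightIsland Λ, v x * star (u x) := by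
  have h : IntegrableOn (fun x => v x * star (u x)) (config Λ) :=
    integrableOn_mul_star_of_memLp (Lp.memLp u) (Lp.memLp v)
  rw [L2.inner_def, ← setIntegral_union (disjoint_islands hΛ) measurableSet_Ioi
    (h.mono_set subset_union_left) (h.mono_set subset_union_right)]
  rfl

/-- Integration by parts on `Ω_Λ`. -/
theorem IsACRep.inner_derivLp {Λ : ℝ} (hΛ : 0 ≤ Λ) {u v : L2 Λ} {fL fR gL gR : ℝ → ℂ}
    (hu : IsACRep Λ u fL fR) (hv : IsACRep Λ v gL gR) :
    ⟪hu.derivLp, v⟫_ℂ + ⟪u, hv.derivLp⟫_ℂ =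
      gL (-Λ) * star (fL (-Λ)) - gR Λ * star (fR Λ) := by
  -- `derivLp` gives precedence to the left island, so membership there has to be excluded
  have hni : ∀ᵐ x ∂volume.restrict (rightIsland Λ), x ∉ leftIsland Λ := by
    filter_upwards [ae_restrict_mem (measurableSet_Ioi (a := Λ))] with x hx
    exact Set.disjoint_right.1 (disjoint_islands hΛ) hx
  rw [inner_eq_add hΛ, inner_eq_add hΛ, sub_eq_add_neg, ← hu.left.integral_Iio hv.left,
    ← hu.right.integral_Ioi hv.right,
    integral_add (integrableOn_mul_star_of_memLp hu.left.memLp_deriv hv.left.memLp)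
      (integrableOn_mul_star_of_memLp hu.left.memLp hv.left.memLp_deriv),
    integral_add (integrableOn_mul_star_of_memLp hu.right.memLp_deriv hv.right.memLp)
      (integrableOn_mul_star_of_memLp hu.right.memLp hv.right.memLp_deriv), add_add_add_comm]
  congr 2 <;> refine integral_congr_ae ?_
  · filter_upwards [hu.derivLp_left, hv.eq_left] with x h1 h2
    rw [h1, h2]
  · filter_upwards [hv.derivLp_left, hu.eq_left] with x h1 h2
    rw [h1, h2]
  · filter_upwards [hu.derivLp_right, hv.eq_right, hni] with x h1 h2 h3
    rw [h1 h3, h2]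
  · filter_upwards [hv.derivLp_right, hu.eq_right, hni] with x h1 h2 h3
    rw [h1 h3, h2]

/-- The boundary values of an absolutely continuous representative are unique, since the
representative is continuous up to the end points. -/
theorem HasBoundaryValues.unique {Λ : ℝ} {u : L2 Λ} {l r l' r' : ℂ}
    (h : HasBoundaryValues Λ u l r) (h' : HasBoundaryValues Λ u l' r') : l = l' ∧ r = r' := by
  obtain ⟨fL, fR, hu, rfl, rfl⟩ := h
  obtain ⟨gL, gR, hv, rfl, rfl⟩ := h'
  have eL : EqOn fL gL (Iio (-Λ)) :=
    Measure.eqOn_open_of_ae_eq (hu.eq_left.symm.trans hv.eq_left) isOpen_Iio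
      (hu.left.continuousOn isOpen_Iio) (hv.left.continuousOn isOpen_Iio)
  have eR : EqOn fR gR (Ioi Λ) :=
    Measure.eqOn_open_of_ae_eq (hu.eq_right.symm.trans hv.eq_right) isOpen_Ioi
      (hu.right.continuousOn isOpen_Ioi) (hv.right.continuousOn isOpen_Ioi)
  have cL : ∀ f, IsAC1On f (leftIsland Λ) → Tendsto f (𝓝[<] (-Λ)) (𝓝 (f (-Λ))) := by
    intro f hf
    have h := (hf.ac (-Λ - 1) (by rw [closure_Iio]; simp) (-Λ)
      (by rw [closure_Iio]; simp)).continuousOn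
    rw [uIcc_of_le (by linarith)] at h
    exact (h (-Λ) (by simp)).mono_left
      (nhdsWithin_le_of_mem (mem_of_superset (Ioo_mem_nhdsLT (by linarith)) Ioo_subset_Icc_self))
  have cR : ∀ f, IsAC1On f (rightIsland Λ) → Tendsto f (𝓝[>] Λ) (𝓝 (f Λ)) := by
    intro f hf
    have h := (hf.ac Λ (by rw [closure_Ioi]; simp) (Λ + 1) (by rw [closure_Ioi]; simp)).continuousOn
    rw [uIcc_of_le (by linarith)] at h
    exact (h Λ (by simp)).mono_left
      (nhdsWithin_le_of_mem (mem_of_superset (Ioo_mem_nhdsGT (by linarith)) Ioo_subset_Icc_self))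
  exact ⟨tendsto_nhds_unique (cL _ hu.left)
      ((cL _ hv.left).congr' (by filter_upwards [self_mem_nhdsWithin] with x hx using (eL hx).symm)),
    tendsto_nhds_unique (cR _ hu.right)
      ((cR _ hv.right).congr' (by filter_upwards [self_mem_nhdsWithin] with x hx using (eR hx).symm))⟩

/-! ### Weakly differentiable functions have absolutely continuous representatives -/

theorem intervalIntegrable_of_memLp {g : ℝ → ℂ} (hg : MemLp g 2 volume) (a b : ℝ) :
    IntervalIntegrable g volume a b :=
  ((hg.locallyIntegrable one_le_two).integrableOn_isCompact isCompact_uIcc).intervalIntegrable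

/-- The integral over a set containing `(c, d)` of a function supported in `(c, d)`. -/
theorem setIntegral_eq_intervalIntegral {F : ℝ → ℂ} {c d : ℝ} {s : Set ℝ} (hcd : c ≤ d)
    (hs : MeasurableSet s) (hsub : Ioo c d ⊆ s) (hF : ∀ x ∉ Ioo c d, F x = 0) :
    ∫ x in s, F x = ∫ x in c..d, F x := by
  rw [intervalIntegral.integral_of_le hcd, integral_Ioc_eq_integral_Ioo]
  exact setIntegral_eq_of_subset_of_forall_sdiff_eq_zero hs hsub fun x hx => hF x hx.2

section TestFunction

variable {g : ℝ → ℂ} {c d : ℝ}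

/-- The primitive of a function of mean zero supported in `(c, d)` is supported in `(c, d)`. -/
theorem primitive_eq_zero (hg : MemLp g 2 volume) (h0 : ∀ x ∉ Ioo c d, g x = 0)
    (hint : ∫ x in c..d, g x = 0) {x : ℝ} (hx : x ∉ Ioo c d) : ∫ t in c..x, g t = 0 := by
  rw [mem_Ioo, not_and_or, not_lt, not_lt] at hx
  rcases hx with hx | hx
  · refine intervalIntegral.integral_zero_ae (Eventually.of_forall fun t ht => h0 t ?_)
    rw [uIoc_of_ge hx] at ht
    exact fun h => absurd h.1 (not_lt.2 ht.2)
  · rw [← intervalIntegral.integral_add_adjacent_intervals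
      (intervalIntegrable_of_memLp hg c d) (intervalIntegrable_of_memLp hg d x), hint, zero_add]
    refine intervalIntegral.integral_zero_ae (Eventually.of_forall fun t ht => h0 t ?_)
    rw [uIoc_of_le hx] at ht
    exact fun h => absurd h.2 (not_lt.2 ht.1.le)

theorem isAC1On_primitive (hg : MemLp g 2 volume) (h0 : ∀ x ∉ Ioo c d, g x = 0)
    (hint : ∫ x in c..d, g x = 0) (s : Set ℝ) : IsAC1On (fun x => ∫ t in c..x, g t) s where
  ac a _ b _ := ac_integral (intervalIntegrable_of_memLp hg) c a b
  memLp := by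
    have hc : Continuous fun x => ∫ t in c..x, g t :=
      intervalIntegral.continuous_primitive (intervalIntegrable_of_memLp hg) c
    refine (hc.memLp_of_hasCompactSupport (HasCompactSupport.of_support_subset_isCompact
      (isCompact_Icc (a := c) (b := d)) fun x hx => ?_)).restrict s
    by_contra h
    exact hx (primitive_eq_zero hg h0 hint fun h' => h (Ioo_subset_Icc_self h'))
  memLp_deriv := by
    refine (memLp_congr_ae ?_).2 (hg.restrict s)
    filter_upwards [ae_restrict_of_ae (ae_hasDerivAt_integral (intervalIntegrable_of_memLp hg) c)]
      with x hx using hx.deriv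

end TestFunction

/-- `v` is the weak derivative of `u` on `Ω_Λ`, tested against `AC¹₀`. -/
def IsWeakDeriv (Λ : ℝ) (u v : L2 Λ) : Prop :=
  ∀ (f : L2 Λ) (fL fR : ℝ → ℂ) (h : IsACRep Λ f fL fR), fL (-Λ) = 0 → fR Λ = 0 →
    ⟪u, h.derivLp⟫_ℂ = -⟪v, f⟫_ℂ

/-- The extension of `v ∈ L²(Ω_Λ)` by zero to the real line. -/
def extendZero (Λ : ℝ) (v : L2 Λ) : ℝ → ℂ := (config Λ).indicator v

theorem measurableSet_config (Λ : ℝ) : MeasurableSet (config Λ) :=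
  measurableSet_Iio.union measurableSet_Ioi

theorem memLp_extendZero {Λ : ℝ} (v : L2 Λ) : MemLp (extendZero Λ v) 2 volume :=
  (memLp_indicator_iff_restrict (measurableSet_config Λ)).2 (Lp.memLp v)

/-- The weak derivative condition, tested against the primitive of a function `g` of mean zero. -/
theorem IsWeakDeriv.integral_eq {Λ : ℝ} {u v : L2 Λ} (h : IsWeakDeriv Λ u v) (hΛ : 0 ≤ Λ)
    {c d : ℝ} (hcd : c ≤ d) (hΩ : d ≤ -Λ ∨ Λ ≤ c) {g : ℝ → ℂ} (hg : MemLp g 2 volume)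
    (h0 : ∀ x ∉ Ioo c d, g x = 0) (hint : ∫ x in c..d, g x = 0) :
    ∫ x in c..d, g x * star (u x) = -∫ x in c..d, (∫ t in c..x, g t) * star (v x) := by
  have hsub : Ioo c d ⊆ config Λ := by
    rintro x ⟨h1, h2⟩
    rcases hΩ with h | h
    · exact Or.inl (h2.trans_le h)
    · exact Or.inr (h.trans_lt h1)
  have hac := fun s => isAC1On_primitive hg h0 hint s
  set f : ℝ → ℂ := fun x => ∫ t in c..x, g t
  have hrep : IsACRep Λ ((hac (config Λ)).memLp.toLp f) f f :=
    ⟨hac _, hac _, (MemLp.coeFn_toLp _).filter_mono (left_ac Λ),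
      (MemLp.coeFn_toLp _).filter_mono (right_ac Λ)⟩
  have hd : ∀ᵐ x : ℝ, deriv f x = g x := by
    filter_upwards [ae_hasDerivAt_integral (intervalIntegrable_of_memLp hg) c] with x hx
      using hx.deriv
  have hdl : hrep.derivLp = (hg.restrict (config Λ)).toLp g := by
    have hc := (hg.restrict (config Λ)).coeFn_toLp
    refine hrep.derivLp_ext ?_ ?_
    · filter_upwards [hc.filter_mono (left_ac Λ), ae_restrict_of_ae hd] with x h1 h2
      rw [h1, h2]
    · filter_upwards [hc.filter_mono (right_ac Λ), ae_restrict_of_ae hd] with x h1 h2 _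
      rw [h1, h2]
  have hb : ∀ x ∉ Ioo c d, f x = 0 := fun x hx => primitive_eq_zero hg h0 hint hx
  have key := h _ f f hrep (hb _ fun h' => by rcases hΩ with h | h <;> linarith [h'.1, h'.2])
    (hb _ fun h' => by rcases hΩ with h | h <;> linarith [h'.1, h'.2])
  rw [hdl, L2.inner_def, L2.inner_def] at key
  rw [← setIntegral_eq_intervalIntegral hcd (measurableSet_config Λ) hsub fun x hx => by
      rw [h0 x hx, zero_mul],
    ← setIntegral_eq_intervalIntegral hcd (measurableSet_config Λ) hsub fun x hx => by
      rw [primitive_eq_zero hg h0 hint hx, zero_mul]]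
  refine Eq.trans (integral_congr_ae ?_) (key.trans (congrArg Neg.neg (integral_congr_ae ?_)))
  · filter_upwards [(hg.restrict (config Λ)).coeFn_toLp] with x hx
    rw [hx]
    rfl
  · filter_upwards [(hac (config Λ)).memLp.coeFn_toLp] with x hx
    rw [hx]
    rfl

/-- A du Bois-Reymond lemma: on an interval inside one island, `u` differs from a primitive of its
weak derivative by a constant. The test function is the deviation of the difference from its mean. -/
theorem IsWeakDeriv.exists_const {Λ : ℝ} {u v : L2 Λ} (h : IsWeakDeriv Λ u v) (hΛ : 0 ≤ Λ)
    {c d : ℝ} (hcd : c < d) (hΩ : d ≤ -Λ ∨ Λ ≤ c) (p : ℝ) :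
    ∃ k : ℂ, ∀ᵐ x ∂volume.restrict (Ioo c d), u x = k + ∫ t in p..x, extendZero Λ v t := by
  have hsub : Ioo c d ⊆ config Λ := by
    rintro x ⟨h1, h2⟩
    rcases hΩ with h | h
    · exact Or.inl (h2.trans_le h)
    · exact Or.inr (h.trans_lt h1)
  set w := extendZero Λ v
  have hwi := intervalIntegrable_of_memLp (memLp_extendZero v)
  set V : ℝ → ℂ := fun x => ∫ t in p..x, w t
  have hVc : Continuous V := intervalIntegral.continuous_primitive hwi p
  have : IsFiniteMeasure (volume.restrict (Ioo c d)) := ⟨by simp⟩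
  have hVm : MemLp V 2 (volume.restrict (Ioo c d)) := by
    obtain ⟨C, hC⟩ := (isCompact_Icc (a := c) (b := d)).exists_bound_of_continuousOn
      hVc.continuousOn
    refine MemLp.of_bound hVc.aestronglyMeasurable C ?_
    filter_upwards [ae_restrict_mem measurableSet_Ioo] with x hx
      using hC x (Ioo_subset_Icc_self hx)
  have hum : MemLp u 2 (volume.restrict (Ioo c d)) :=
    (Lp.memLp u).mono_measure (Measure.restrict_mono hsub le_rfl)
  set k : ℂ := (∫ x in Ioo c d, (u x - V x)) / ((d - c : ℝ) : ℂ) with hk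
  have hDm : MemLp (fun x => u x - V x - k) 2 (volume.restrict (Ioo c d)) :=
    (hum.sub hVm).sub (memLp_const k)
  set g : ℝ → ℂ := (Ioo c d).indicator fun x => u x - V x - k
  have hgm : MemLp g 2 volume := (memLp_indicator_iff_restrict measurableSet_Ioo).2 hDm
  have hg0 : ∀ x ∉ Ioo c d, g x = 0 := fun x hx => indicator_of_notMem hx _
  have hdc : ((d - c : ℝ) : ℂ) ≠ 0 := Complex.ofReal_ne_zero.2 (sub_ne_zero.2 hcd.ne')
  have hto : ∀ F : ℝ → ℂ, ∫ x in c..d, F x = ∫ x in Ioo c d, F x := fun F => by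
    rw [intervalIntegral.integral_of_le hcd.le, integral_Ioc_eq_integral_Ioo]
  have hgD : ∀ᵐ x ∂volume.restrict (Ioo c d), g x = u x - V x - k := by
    filter_upwards [ae_restrict_mem measurableSet_Ioo] with x hx using indicator_of_mem hx _
  have hgint : ∫ x in c..d, g x = 0 := by
    have hi : Integrable (fun x => u x - V x) (volume.restrict (Ioo c d)) :=
      (hum.sub hVm).integrable one_le_two
    rw [hto, integral_congr_ae hgD, integral_sub hi (integrable_const k), setIntegral_const,
      measureReal_def, Real.volume_Ioo,
      ENNReal.toReal_ofReal (by linarith), Complex.real_smul, hk, mul_div_cancel₀ _ hdc, sub_self]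
  have key := h.integral_eq hΛ hcd.le hΩ hgm hg0 hgint
  set f : ℝ → ℂ := fun x => ∫ t in c..x, g t
  have hgi := intervalIntegrable_of_memLp hgm
  have hacF : AbsolutelyContinuousOnInterval (fun x => f x * star (V x)) c d :=
    (ac_integral hgi c c d).fun_smul (ac_star (ac_integral hwi p c d))
  have hwV : ∀ᵐ x ∂volume.restrict (Ioo c d), w x = v x := by
    filter_upwards [ae_restrict_mem measurableSet_Ioo] with x hx using indicator_of_mem (hsub hx) _
  have hvm : MemLp v 2 (volume.restrict (Ioo c d)) :=
    (Lp.memLp v).mono_measure (Measure.restrict_mono hsub le_rfl)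
  have hgm' := hgm.restrict (Ioo c d)
  have hfm : MemLp f 2 (volume.restrict (Ioo c d)) :=
    (isAC1On_primitive hgm hg0 hgint (Ioo c d)).memLp
  -- integrate `f V*` by parts; the boundary terms vanish with `f`
  have hparts : ∫ x in Ioo c d, (f x * star (v x) + g x * star (V x)) = 0 := by
    have h1 := integral_deriv_eq_sub_of_ac hacF
    have e1 : f c = 0 := primitive_eq_zero hgm hg0 hgint (by simp)
    have e2 : f d = 0 := primitive_eq_zero hgm hg0 hgint (by simp)
    rw [hto, e1, e2, zero_mul, zero_mul, sub_self] at h1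
    rw [← h1]
    refine integral_congr_ae ?_
    filter_upwards [hwV, ae_restrict_of_ae (ae_hasDerivAt_integral hgi c),
      ae_restrict_of_ae (ae_hasDerivAt_integral hwi p)] with x h2 h3 h4
    have h5 : deriv (fun x => f x * star (V x)) x = g x * star (V x) + f x * star (w x) :=
      (h3.fun_mul h4.star).deriv
    rw [h5, h2, add_comm]
  rw [integral_add (integrableOn_mul_star_of_memLp hvm hfm)
    (integrableOn_mul_star_of_memLp hVm hgm')] at hparts
  rw [hto, hto] at key
  -- `g` is orthogonal to `u - V` and to constants, hence to itself
  have hsq : ∫ x in Ioo c d, g x * star (g x) = 0 := by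
    have e : ∫ x in Ioo c d, g x * star (g x) =
        ∫ x in Ioo c d, (g x * star (u x) - g x * star (V x) - g x * star k) := by
      refine integral_congr_ae ?_
      filter_upwards [hgD] with x hx
      simp only [hx, star_sub]
      ring
    have hz : ∫ x in Ioo c d, g x = 0 := by rw [← hto, hgint]
    have i1 := integrableOn_mul_star_of_memLp hum hgm'
    have i2 := integrableOn_mul_star_of_memLp hVm hgm'
    have i3 : IntegrableOn (fun x => g x * star (u x) - g x * star (V x)) (Ioo c d) := i1.sub i2
    rw [e, integral_sub i3 ((hgm'.integrable one_le_two).mul_const _),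
      integral_sub i1 i2, integral_mul_const, hz, zero_mul, sub_zero, key]
    linear_combination -hparts
  have hsq' : ∫ x in Ioo c d, ‖g x‖ ^ 2 = 0 := by
    have e : ∀ x, g x * star (g x) = ((‖g x‖ ^ 2 : ℝ) : ℂ) := fun x => by
      rw [Complex.star_def, Complex.mul_conj, Complex.normSq_eq_norm_sq]
    simp only [e] at hsq
    exact Complex.ofReal_eq_zero.1 (integral_ofReal.symm.trans hsq)
  rw [integral_eq_zero_iff_of_nonneg (fun x => by positivity)
    ((memLp_two_iff_integrable_sq_norm hgm'.1).1 hgm')] at hsq'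
  refine ⟨k, ?_⟩
  filter_upwards [hsq', hgD] with x h1 h2
  have h3 : g x = 0 := by simpa using h1
  rw [h2] at h3
  linear_combination h3

/-- A function that is almost everywhere constant on each of a sequence of sets, all of which contain
the nonnegligible first one, is almost everywhere constant on their union. -/
theorem exists_const_iUnion {F : ℝ → ℂ} {s : ℕ → Set ℝ} (hs : ∀ n, s 0 ⊆ s n)
    (h0 : volume (s 0) ≠ 0) (h : ∀ n, ∃ k : ℂ, ∀ᵐ x ∂volume.restrict (s n), F x = k) :
    ∃ k : ℂ, ∀ᵐ x ∂volume.restrict (⋃ n, s n), F x = k := by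
  choose k hk using h
  have : (ae (volume.restrict (s 0))).NeBot := by
    rw [ae_neBot, Ne, Measure.restrict_eq_zero]
    exact h0
  have e : ∀ n, k n = k 0 := by
    intro n
    have h1 : ∀ᵐ x ∂volume.restrict (s 0), F x = k n :=
      (hk n).filter_mono (ae_mono (Measure.restrict_mono (hs n) le_rfl))
    obtain ⟨x, hx1, hx2⟩ := (h1.and (hk 0)).exists
    exact hx1.symm.trans hx2
  refine ⟨k 0, ?_⟩
  rw [ae_restrict_iUnion_iff]
  intro n
  filter_upwards [hk n] with x hx
  rw [hx, e n]

theorem IsWeakDeriv.exists_const_right {Λ : ℝ} {u v : L2 Λ} (h : IsWeakDeriv Λ u v) (hΛ : 0 ≤ Λ) :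
    ∃ k : ℂ, ∀ᵐ x ∂volume.restrict (rightIsland Λ),
      u x = k + ∫ t in Λ..x, extendZero Λ v t := by
  have hU : (⋃ n : ℕ, Ioo Λ (Λ + (n + 1))) = Ioi Λ := by
    ext x
    simp only [mem_iUnion, mem_Ioo, mem_Ioi]
    refine ⟨fun ⟨n, hn⟩ => hn.1, fun hx => ?_⟩
    obtain ⟨n, hn⟩ := exists_nat_gt (x - Λ)
    exact ⟨n, hx, by linarith⟩
  obtain ⟨k, hk⟩ := exists_const_iUnion (F := fun x => u x - ∫ t in Λ..x, extendZero Λ v t)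
    (s := fun n : ℕ => Ioo Λ (Λ + (n + 1)))
    (fun n => Ioo_subset_Ioo_right (by push_cast; linarith [n.cast_nonneg (α := ℝ)]))
    (by simp) (fun n => by
      obtain ⟨k, hk⟩ := h.exists_const hΛ (c := Λ) (d := Λ + (n + 1))
        (by linarith [n.cast_nonneg (α := ℝ)]) (Or.inr le_rfl) Λ
      exact ⟨k, hk.mono fun x hx => by rw [hx]; ring⟩)
  rw [hU] at hk
  exact ⟨k, hk.mono fun x hx => by rw [← hx]; ring⟩

theorem IsWeakDeriv.exists_const_left {Λ : ℝ} {u v : L2 Λ} (h : IsWeakDeriv Λ u v) (hΛ : 0 ≤ Λ) :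
    ∃ k : ℂ, ∀ᵐ x ∂volume.restrict (leftIsland Λ),
      u x = k + ∫ t in (-Λ)..x, extendZero Λ v t := by
  have hU : (⋃ n : ℕ, Ioo (-Λ - (n + 1)) (-Λ)) = Iio (-Λ) := by
    ext x
    simp only [mem_iUnion, mem_Ioo, mem_Iio]
    refine ⟨fun ⟨n, hn⟩ => hn.2, fun hx => ?_⟩
    obtain ⟨n, hn⟩ := exists_nat_gt (-Λ - x)
    exact ⟨n, by linarith, hx⟩
  obtain ⟨k, hk⟩ := exists_const_iUnion (F := fun x => u x - ∫ t in (-Λ)..x, extendZero Λ v t)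
    (s := fun n : ℕ => Ioo (-Λ - (n + 1)) (-Λ))
    (fun n => Ioo_subset_Ioo_left (by push_cast; linarith [n.cast_nonneg (α := ℝ)]))
    (by simp) (fun n => by
      obtain ⟨k, hk⟩ := h.exists_const hΛ (c := -Λ - (n + 1)) (d := -Λ)
        (by linarith [n.cast_nonneg (α := ℝ)]) (Or.inl le_rfl) (-Λ)
      exact ⟨k, hk.mono fun x hx => by rw [hx]; ring⟩)
  rw [hU] at hk
  exact ⟨k, hk.mono fun x hx => by rw [← hx]; ring⟩

theorem hasDerivAt_const_add_primitive {Λ : ℝ} (v : L2 Λ) (k : ℂ) (p : ℝ) :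
    ∀ᵐ x ∂volume.restrict (config Λ),
      HasDerivAt (fun x => k + ∫ t in p..x, extendZero Λ v t) (v x) x := by
  filter_upwards [ae_restrict_of_ae
    (ae_hasDerivAt_integral (intervalIntegrable_of_memLp (memLp_extendZero v)) p),
    ae_restrict_mem (measurableSet_config Λ)] with x hx hm
  have := hx.const_add k
  rwa [extendZero, indicator_of_mem hm] at this

theorem isAC1On_const_add_primitive {Λ : ℝ} {u v : L2 Λ} {s : Set ℝ} (hs : s ⊆ config Λ) {k : ℂ}
    {p : ℝ} (h : ∀ᵐ x ∂volume.restrict s, u x = k + ∫ t in p..x, extendZero Λ v t) :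
    IsAC1On (fun x => k + ∫ t in p..x, extendZero Λ v t) s where
  ac a _ b _ := (ac_const k a b).fun_add
    (ac_integral (intervalIntegrable_of_memLp (memLp_extendZero v)) p a b)
  memLp := (memLp_congr_ae h).1 ((Lp.memLp u).mono_measure (Measure.restrict_mono hs le_rfl))
  memLp_deriv := by
    refine (memLp_congr_ae ?_).2 ((Lp.memLp v).mono_measure (Measure.restrict_mono hs le_rfl))
    filter_upwards [(hasDerivAt_const_add_primitive v k p).filter_mono
      (ae_mono (Measure.restrict_mono hs le_rfl))] with x hx using hx.deriv

/-- An `L²` function with a weak derivative in `L²` is of class `AC¹` on the closed islands. -/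
theorem IsWeakDeriv.exists_rep {Λ : ℝ} {u v : L2 Λ} (h : IsWeakDeriv Λ u v) (hΛ : 0 ≤ Λ) :
    ∃ (fL fR : ℝ → ℂ) (hu : IsACRep Λ u fL fR), hu.derivLp = v := by
  obtain ⟨kL, hL⟩ := h.exists_const_left hΛ
  obtain ⟨kR, hR⟩ := h.exists_const_right hΛ
  refine ⟨_, _, ⟨isAC1On_const_add_primitive subset_union_left hL,
    isAC1On_const_add_primitive subset_union_right hR, hL, hR⟩, ?_⟩
  refine IsACRep.derivLp_ext _ ?_ ?_
  · filter_upwards [(hasDerivAt_const_add_primitive v kL (-Λ)).filter_mono (left_ac Λ)] with x hx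
      using hx.deriv.symm
  · filter_upwards [(hasDerivAt_const_add_primitive v kR Λ).filter_mono (right_ac Λ)] with x hx _
      using hx.deriv.symm

/-- A function orthogonal to `AC¹₀` is a weak derivative of zero, hence zero. -/
theorem dense_AC0 {Λ : ℝ} (hΛ : 0 ≤ Λ) : Dense (AC0 Λ : Set (L2 Λ)) := by
  rw [Submodule.dense_iff_topologicalClosure_eq_top, Submodule.topologicalClosure_eq_top_iff,
    Submodule.eq_bot_iff]
  intro v hv
  have hw : IsWeakDeriv Λ 0 v := by
    intro f fL fR hf h1 h2
    rw [inner_zero_left, Submodule.inner_left_of_mem_orthogonal (K := AC0 Λ) ⟨fL, fR, hf, h1, h2⟩ hv,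
      neg_zero]
  obtain ⟨fL, fR, h0, rfl⟩ := hw.exists_rep hΛ
  have hd : deriv (0 : ℝ → ℂ) = 0 := by funext x; exact deriv_const x (0 : ℂ)
  have hc := Lp.coeFn_zero ℂ 2 (volume.restrict (config Λ))
  rw [h0.derivLp_unique (IsACRep.zero Λ)]
  refine (IsACRep.zero Λ).derivLp_ext ?_ ?_
  · filter_upwards [hc.filter_mono (left_ac Λ)] with x hx
    rw [hx, hd]
  · filter_upwards [hc.filter_mono (right_ac Λ)] with x hx _
    rw [hx, hd]

/-! ### Self-adjoint extensions of a symmetric operator with equal finite deficiency indices -/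

section VonNeumann

open scoped Matrix

variable {E : Type*} [NormedAddCommGroup E] [InnerProductSpace ℂ E]
variable {ι : Type*} [Fintype ι]

/-- Bases `p` of `ker (i - T*)` and `q` of `ker (-i - T*)` for a densely defined symmetric operator
`T`. Both are orthogonal with vectors of the same squared norm `n`, and together with the domain
of `T` they span the domain of `T*`. -/
structure DeficiencyBases [CompleteSpace E] [DecidableEq ι] (T : E →ₗ.[ℂ] E) (p q : ι → E)
    (n : ℝ) : Prop where
  dense : Dense (T.domain : Set E)
  symmetric : T ≤ T†
  pos : 0 < n
  plus : ∀ j, ∃ h : p j ∈ T†.domain, T† ⟨p j, h⟩ = Complex.I • p j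
  minus : ∀ j, ∃ h : q j ∈ T†.domain, T† ⟨q j, h⟩ = -Complex.I • q j
  inner_plus : ∀ j k, ⟪p j, p k⟫_ℂ = if j = k then (n : ℂ) else 0
  inner_minus : ∀ j k, ⟪q j, q k⟫_ℂ = if j = k then (n : ℂ) else 0
  span : ∀ ψ ∈ T†.domain, ∃ x y : ι → ℂ, ψ - ∑ j, x j • p j - ∑ j, y j • q j ∈ T.domain

/-- `ψ` has coordinates `x` along `p` and `y` along `q` modulo the domain of `T`. -/
def HasCoords (T : E →ₗ.[ℂ] E) (p q : ι → E) (ψ : E) (x y : ι → ℂ) : Prop :=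
  ψ - ∑ j, x j • p j - ∑ j, y j • q j ∈ T.domain

/-- `{ψ₀ + ψ⁺ + U ψ⁺}` for `ψ₀` in the domain of `T` and `ψ⁺` in the span of `p`, where `U` sends
`p j` to `∑ k, U j k • q k`. Since the rows of `U` hold the images, the coordinates of `U ψ⁺` are
those of `ψ⁺` multiplied by `U` from the right. -/
def coordDomain (T : E →ₗ.[ℂ] E) (p q : ι → E) (U : Matrix ι ι ℂ) : Submodule ℂ E where
  carrier := {ψ | ∃ x, HasCoords T p q ψ x (x ᵥ* U)}
  add_mem' := by
    rintro ψ φ ⟨x, hx⟩ ⟨y, hy⟩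
    refine ⟨x + y, ?_⟩
    have h := add_mem hx hy
    rw [HasCoords, Matrix.add_vecMul]
    convert h using 1
    simp only [Pi.add_apply, add_smul, Finset.sum_add_distrib]
    abel
  zero_mem' := ⟨0, by simp [HasCoords, Matrix.zero_vecMul]⟩
  smul_mem' := by
    rintro c ψ ⟨x, hx⟩
    refine ⟨c • x, ?_⟩
    have h := Submodule.smul_mem _ c hx
    rw [HasCoords, Matrix.smul_vecMul]
    convert h using 1
    simp only [Pi.smul_apply, smul_sub, Finset.smul_sum, smul_smul, smul_eq_mul]

theorem hasCoords_add {T : E →ₗ.[ℂ] E} {p q : ι → E} {ψ₀ : E} (h : ψ₀ ∈ T.domain) (x y : ι → ℂ) :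
    HasCoords T p q (ψ₀ + ∑ j, x j • p j + ∑ j, y j • q j) x y := by
  rw [HasCoords]
  convert h using 1
  abel

theorem mem_coordDomain_of_mem_domain {T : E →ₗ.[ℂ] E} {p q : ι → E} (U : Matrix ι ι ℂ) {ψ : E}
    (h : ψ ∈ T.domain) : ψ ∈ coordDomain T p q U :=
  ⟨0, by simpa [HasCoords, Matrix.zero_vecMul] using h⟩

open scoped ComplexOrder in
theorem eq_zero_of_star_dotProduct_self {x : ι → ℂ} (h : star x ⬝ᵥ x = 0) : x = 0 :=
  dotProduct_star_self_eq_zero.1 h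

theorem star_dotProduct_vecMul [DecidableEq ι] {U : Matrix ι ι ℂ}
    (hU : U ∈ Matrix.unitaryGroup ι ℂ) (x x' : ι → ℂ) :
    star (x ᵥ* U) ⬝ᵥ (x' ᵥ* U) = star x ⬝ᵥ x' := by
  rw [Matrix.star_vecMul, dotProduct_comm, Matrix.dotProduct_mulVec, Matrix.vecMul_vecMul,
    ← Matrix.star_eq_conjTranspose, Matrix.mem_unitaryGroup_iff.1 hU, Matrix.vecMul_one,
    dotProduct_comm]

/-- Two restrictions of the same operator agree once their domains do. -/
theorem eq_of_le_of_domain_le {A B C : E →ₗ.[ℂ] E} (hA : A ≤ C) (hB : B ≤ C)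
    (h : A.domain ≤ B.domain) : A ≤ B :=
  ⟨h, fun x _ hxy => (hA.2 (y := ⟨x, hA.1 x.2⟩) rfl).trans
    (hB.2 (y := ⟨x, hA.1 x.2⟩) hxy.symm).symm⟩

theorem adjoint_antitone [CompleteSpace E] {A B : E →ₗ.[ℂ] E} (hA : Dense (A.domain : Set E))
    (h : A ≤ B) : B† ≤ A† := by
  have hB : Dense (B.domain : Set E) := hA.mono h.1
  refine LinearPMap.IsFormalAdjoint.le_adjoint hA fun x y => ?_
  have h1 := (LinearPMap.adjoint_isFormalAdjoint hB) y ⟨x, h.1 x.2⟩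
  rw [← h.2 (x := x) (y := ⟨x, h.1 x.2⟩) rfl] at h1
  rw [← inner_conj_symm, ← h1, inner_conj_symm]

theorem restrict_apply [CompleteSpace E] {T : E →ₗ.[ℂ] E} {p q : ι → E} {U : Matrix ι ι ℂ}
    (ψ : ((T†).domRestrict (coordDomain T p q U)).domain) :
    (T†).domRestrict (coordDomain T p q U) ψ = T† ⟨ψ, ψ.2.2⟩ :=
  LinearPMap.domRestrict_apply rfl

namespace DeficiencyBases

variable [CompleteSpace E] [DecidableEq ι] {T : E →ₗ.[ℂ] E} {p q : ι → E} {n : ℝ}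

theorem mem_plus (hT : DeficiencyBases T p q n) (x : ι → ℂ) : ∃ h : ∑ j, x j • p j ∈ T†.domain,
    T† ⟨∑ j, x j • p j, h⟩ = Complex.I • ∑ j, x j • p j := by
  choose h e using hT.plus
  refine ⟨Submodule.sum_mem _ fun j _ => Submodule.smul_mem _ _ (h j), ?_⟩
  have : (⟨∑ j, x j • p j, Submodule.sum_mem _ fun j _ => Submodule.smul_mem _ _ (h j)⟩ :
      T†.domain) = ∑ j, x j • ⟨p j, h j⟩ := by
    ext
    simp
  rw [this, ← LinearPMap.toFun_eq_coe, map_sum, Finset.smul_sum]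
  refine Finset.sum_congr rfl fun j _ => ?_
  rw [map_smul, LinearPMap.toFun_eq_coe, e, smul_comm]

theorem mem_minus (hT : DeficiencyBases T p q n) (x : ι → ℂ) : ∃ h : ∑ j, x j • q j ∈ T†.domain,
    T† ⟨∑ j, x j • q j, h⟩ = -Complex.I • ∑ j, x j • q j := by
  choose h e using hT.minus
  refine ⟨Submodule.sum_mem _ fun j _ => Submodule.smul_mem _ _ (h j), ?_⟩
  have : (⟨∑ j, x j • q j, Submodule.sum_mem _ fun j _ => Submodule.smul_mem _ _ (h j)⟩ :
      T†.domain) = ∑ j, x j • ⟨q j, h j⟩ := by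
    ext
    simp
  rw [this, ← LinearPMap.toFun_eq_coe, map_sum, Finset.smul_sum]
  refine Finset.sum_congr rfl fun j _ => ?_
  rw [map_smul, LinearPMap.toFun_eq_coe, e, smul_comm]

theorem inner_sum_plus (hT : DeficiencyBases T p q n) (x y : ι → ℂ) :
    ⟪∑ j, x j • p j, ∑ j, y j • p j⟫_ℂ = n * (star x ⬝ᵥ y) := by
  simp only [sum_inner, inner_sum, inner_smul_left, inner_smul_right, hT.inner_plus, dotProduct,
    Finset.mul_sum, Pi.star_apply]
  refine Finset.sum_congr rfl fun j _ => ?_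
  rw [Finset.sum_eq_single j]
  · simp; ring
  · intro k _ hk
    simp [hk]
  · simp

theorem inner_sum_minus (hT : DeficiencyBases T p q n) (x y : ι → ℂ) :
    ⟪∑ j, x j • q j, ∑ j, y j • q j⟫_ℂ = n * (star x ⬝ᵥ y) := by
  simp only [sum_inner, inner_sum, inner_smul_left, inner_smul_right, hT.inner_minus, dotProduct,
    Finset.mul_sum, Pi.star_apply]
  refine Finset.sum_congr rfl fun j _ => ?_
  rw [Finset.sum_eq_single j]
  · simp; ring
  · intro k _ hk
    simp [hk]
  · simp

theorem exists_hasCoords (hT : DeficiencyBases T p q n) {ψ : E} (h : ψ ∈ T†.domain) :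
    ∃ x y, HasCoords T p q ψ x y :=
  hT.span ψ h

/-- A vector with coordinates is in the domain of `T*`, which acts on it componentwise. -/
theorem _root_.DiracJunction.HasCoords.adjoint_apply {ψ : E} {x y : ι → ℂ}
    (h : HasCoords T p q ψ x y) (hT : DeficiencyBases T p q n) :
    ∃ (ψ₀ : T.domain) (hψ : ψ ∈ T†.domain), ψ = ψ₀ + ∑ j, x j • p j + ∑ j, y j • q j ∧
      T† ⟨ψ, hψ⟩ = T ψ₀ + Complex.I • ∑ j, x j • p j - Complex.I • ∑ j, y j • q j := by
  obtain ⟨h1, e1⟩ := hT.mem_plus x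
  obtain ⟨h2, e2⟩ := hT.mem_minus y
  have h' : ψ - ∑ j, x j • p j - ∑ j, y j • q j ∈ T.domain := h
  have h0 := hT.symmetric.1 h'
  have e0 := hT.symmetric.2 (x := ⟨_, h'⟩) (y := ⟨_, h0⟩) rfl
  have e : ψ = (ψ - ∑ j, x j • p j - ∑ j, y j • q j) + ∑ j, x j • p j + ∑ j, y j • q j := by abel
  have hψ : ψ ∈ T†.domain := by
    rw [e]
    exact add_mem (add_mem h0 h1) h2
  refine ⟨⟨_, h'⟩, hψ, e, ?_⟩
  have : (⟨ψ, hψ⟩ : T†.domain) = ⟨_, h0⟩ + ⟨_, h1⟩ + ⟨_, h2⟩ := Subtype.ext e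
  rw [this, LinearPMap.map_add, LinearPMap.map_add, e1, e2, ← e0, neg_smul, ← sub_eq_add_neg]

/-- The boundary form of `T*` in coordinates: it is a multiple of the indefinite form
`x* x' - y* y'`. -/
theorem green (hT : DeficiencyBases T p q n) {ψ φ : E} {x y x' y' : ι → ℂ}
    (h : HasCoords T p q ψ x y) (h' : HasCoords T p q φ x' y')
    (hψ : ψ ∈ T†.domain) (hφ : φ ∈ T†.domain) :
    ⟪T† ⟨ψ, hψ⟩, φ⟫_ℂ - ⟪ψ, T† ⟨φ, hφ⟩⟫_ℂ =
      -2 * Complex.I * n * (star x ⬝ᵥ x' - star y ⬝ᵥ y') := by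
  obtain ⟨ψ₀, _, e, eT⟩ := h.adjoint_apply hT
  obtain ⟨φ₀, _, e', eT'⟩ := h'.adjoint_apply hT
  have hsym : ∀ χ : T†.domain, ∀ χ₀ : T.domain, ⟪T† χ, (χ₀ : E)⟫_ℂ = ⟪(χ : E), T χ₀⟫_ℂ :=
    fun χ χ₀ => LinearPMap.adjoint_isFormalAdjoint hT.dense χ χ₀
  have hsym' : ∀ χ : T†.domain, ∀ χ₀ : T.domain, ⟪(χ₀ : E), T† χ⟫_ℂ = ⟪T χ₀, (χ : E)⟫_ℂ :=
    fun χ χ₀ => by rw [← inner_conj_symm, hsym, inner_conj_symm]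
  obtain ⟨h1, e1⟩ := hT.mem_plus x
  obtain ⟨h2, e2⟩ := hT.mem_minus y
  obtain ⟨h3, e3⟩ := hT.mem_plus x'
  obtain ⟨h4, e4⟩ := hT.mem_minus y'
  have h5 := hT.symmetric.1 φ₀.2
  have e5 := hT.symmetric.2 (x := φ₀) (y := ⟨_, h5⟩) rfl
  have s1 := hsym' ⟨_, h3⟩ ψ₀
  have s2 := hsym' ⟨_, h4⟩ ψ₀
  have s3 := hsym' ⟨_, h5⟩ ψ₀
  have s4 := hsym ⟨_, h1⟩ φ₀
  have s5 := hsym ⟨_, h2⟩ φ₀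
  rw [e3] at s1
  rw [e4] at s2
  rw [← e5] at s3
  rw [e1] at s4
  rw [e2] at s5
  have i1 := hT.inner_sum_plus x x'
  have i2 := hT.inner_sum_minus y y'
  rw [eT, eT', e, e']
  simp only [inner_add_left, inner_add_right, inner_sub_left, inner_sub_right, inner_smul_left,
    inner_smul_right, Complex.conj_I, map_neg] at s1 s2 s3 s4 s5 ⊢
  simp only [neg_neg] at s1 s2 s3 s4 s5 ⊢
  linear_combination s4 + s5 - s3 - s1 - s2 - 2 * Complex.I * i1 + 2 * Complex.I * i2

theorem coords_eq_zero (hT : DeficiencyBases T p q n) {ψ : E} {x y : ι → ℂ} (h : ψ ∈ T.domain)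
    (h' : HasCoords T p q ψ x y) : x = 0 ∧ y = 0 := by
  have h0 : HasCoords T p q ψ 0 0 := by simpa [HasCoords] using h
  have hd := hT.symmetric.1 h
  have hn : (n : ℂ) ≠ 0 := Complex.ofReal_ne_zero.2 hT.pos.ne'
  have key : ∀ x' y' : ι → ℂ, star x ⬝ᵥ x' - star y ⬝ᵥ y' = 0 := by
    intro x' y'
    have hφ := hasCoords_add (T := T) (p := p) (q := q) (zero_mem _) x' y'
    obtain ⟨-, hm, -, -⟩ := hφ.adjoint_apply hT
    have g1 := hT.green h' hφ hd hm
    have g0 := hT.green h0 hφ hd hm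
    rw [g0] at g1
    simpa [hn] using g1.symm
  refine ⟨?_, ?_⟩
  · have := key x 0
    rw [dotProduct_zero, sub_zero] at this
    exact eq_zero_of_star_dotProduct_self this
  · have := key 0 y
    rw [dotProduct_zero, zero_sub, neg_eq_zero] at this
    exact eq_zero_of_star_dotProduct_self this

theorem coords_unique (hT : DeficiencyBases T p q n) {ψ : E} {x y x' y' : ι → ℂ}
    (h : HasCoords T p q ψ x y) (h' : HasCoords T p q ψ x' y') : x = x' ∧ y = y' := by
  have hd := sub_mem h h'
  have h0 : HasCoords T p q 0 (x - x') (y - y') := by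
    rw [HasCoords]
    convert hd using 1
    simp only [Pi.sub_apply, sub_smul, Finset.sum_sub_distrib]
    abel
  obtain ⟨h1, h2⟩ := hT.coords_eq_zero (zero_mem _) h0
  exact ⟨sub_eq_zero.1 h1, sub_eq_zero.1 h2⟩

/-- The deficiency space `ker (i - T*)` is spanned by `p`. Subtracting the component along `p` leaves
a vector `χ` of the same space with coordinates `(0, y)`; its boundary form is `-2i ‖χ‖²` by the
eigenvalue equation and `2i n ‖y‖²` by the coordinates, so both vanish. -/
theorem mem_span_plus (hT : DeficiencyBases T p q n) {ψ : E} (h : ψ ∈ T†.domain)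
    (e : T† ⟨ψ, h⟩ = Complex.I • ψ) : ∃ x : ι → ℂ, ψ = ∑ j, x j • p j := by
  obtain ⟨x, y, hc⟩ := hT.exists_hasCoords h
  obtain ⟨h1, e1⟩ := hT.mem_plus x
  refine ⟨x, ?_⟩
  set χ := ψ - ∑ j, x j • p j with hχ
  have hχm : χ ∈ T†.domain := sub_mem h h1
  have hχe : T† ⟨χ, hχm⟩ = Complex.I • χ := by
    have : (⟨χ, hχm⟩ : T†.domain) = ⟨ψ, h⟩ - ⟨_, h1⟩ := rfl
    rw [this, LinearPMap.map_sub, e, e1, hχ, smul_sub]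
  have hχc : HasCoords T p q χ 0 y := by
    simpa [HasCoords] using hc
  have g := hT.green hχc hχc hχm hχm
  rw [hχe, inner_smul_left, inner_smul_right, Complex.conj_I, star_zero, zero_dotProduct, zero_sub,
    inner_self_eq_norm_sq_to_K] at g
  have hy : star y ⬝ᵥ y = ((∑ j, ‖y j‖ ^ 2 : ℝ) : ℂ) := by
    simp only [dotProduct, Pi.star_apply, Complex.ofReal_sum]
    refine Finset.sum_congr rfl fun j _ => ?_
    rw [mul_comm, Complex.star_def, Complex.mul_conj, Complex.normSq_eq_norm_sq]
  rw [hy] at g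
  have g' : ((‖χ‖ ^ 2 + n * ∑ j, ‖y j‖ ^ 2 : ℝ) : ℂ) = 0 := by
    have hI : (-2 * Complex.I) ≠ 0 := by simp
    refine mul_left_cancel₀ hI ?_
    push_cast at g ⊢
    simp only [Complex.coe_algebraMap] at g
    linear_combination g
  have g'' := Complex.ofReal_eq_zero.1 g'
  have hs : 0 ≤ n * ∑ j, ‖y j‖ ^ 2 :=
    mul_nonneg hT.pos.le (Finset.sum_nonneg fun _ _ => by positivity)
  have : ‖χ‖ ^ 2 = 0 := by nlinarith [sq_nonneg ‖χ‖]
  exact sub_eq_zero.1 (norm_eq_zero.1 (pow_eq_zero_iff two_ne_zero |>.1 this))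

theorem coordDomain_le (hT : DeficiencyBases T p q n) (U : Matrix ι ι ℂ) :
    coordDomain T p q U ≤ T†.domain := by
  rintro ψ ⟨x, hx⟩
  obtain ⟨-, h, -, -⟩ := hx.adjoint_apply hT
  exact h

theorem le_restrict (hT : DeficiencyBases T p q n) (U : Matrix ι ι ℂ) :
    T ≤ (T†).domRestrict (coordDomain T p q U) :=
  eq_of_le_of_domain_le hT.symmetric LinearPMap.domRestrict_le
    (le_inf (fun _ h => mem_coordDomain_of_mem_domain U h) hT.symmetric.1)

theorem isSelfAdjoint_restrict (hT : DeficiencyBases T p q n) {U : Matrix ι ι ℂ}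
    (hU : U ∈ Matrix.unitaryGroup ι ℂ) :
    IsSelfAdjoint ((T†).domRestrict (coordDomain T p q U)) := by
  set S := (T†).domRestrict (coordDomain T p q U)
  have hTS : T ≤ S := hT.le_restrict U
  have hdense : Dense (S.domain : Set E) := hT.dense.mono hTS.1
  have hadj : S† ≤ T† := adjoint_antitone hT.dense hTS
  rw [LinearPMap.isSelfAdjoint_def]
  refine le_antisymm (eq_of_le_of_domain_le hadj LinearPMap.domRestrict_le ?_) ?_
  · intro φ hφ
    have hφ' := hadj.1 hφ
    obtain ⟨x', y', hc⟩ := hT.exists_hasCoords hφ'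
    have hn : (n : ℂ) ≠ 0 := Complex.ofReal_ne_zero.2 hT.pos.ne'
    have key : ∀ x : ι → ℂ, star x' ⬝ᵥ x = star y' ⬝ᵥ (x ᵥ* U) := by
      intro x
      have hx := hasCoords_add (T := T) (p := p) (q := q) (zero_mem _) x (x ᵥ* U)
      have hxS : _ ∈ S.domain := ⟨⟨x, hx⟩, hT.coordDomain_le U ⟨x, hx⟩⟩
      have g := hT.green hc hx hφ' hxS.2
      have a := LinearPMap.adjoint_isFormalAdjoint hdense ⟨φ, hφ⟩ ⟨_, hxS⟩
      rw [restrict_apply, hadj.2 (x := ⟨φ, hφ⟩) (y := ⟨φ, hφ'⟩) rfl] at a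
      rw [a, sub_self] at g
      have g2 : star x' ⬝ᵥ x - star y' ⬝ᵥ (x ᵥ* U) = 0 := by simpa [hn] using g.symm
      exact sub_eq_zero.1 g2
    refine ⟨⟨x', ?_⟩, hφ'⟩
    have e : y' = x' ᵥ* U := by
      have h1 : ∀ x : ι → ℂ, (star y' - star (x' ᵥ* U)) ⬝ᵥ (x ᵥ* U) = 0 := fun x => by
        rw [sub_dotProduct, ← key, star_dotProduct_vecMul hU, sub_self]
      have h2 := h1 ((y' - x' ᵥ* U) ᵥ* star U)
      rw [Matrix.vecMul_vecMul, Matrix.mem_unitaryGroup_iff'.1 hU, Matrix.vecMul_one, ← star_sub]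
        at h2
      exact sub_eq_zero.1 (eq_zero_of_star_dotProduct_self h2)
    rwa [← e]
  · refine LinearPMap.IsFormalAdjoint.le_adjoint hdense fun ψ φ => ?_
    obtain ⟨x, hx⟩ := ψ.2.1
    obtain ⟨x', hx'⟩ := φ.2.1
    have g := hT.green hx hx' ψ.2.2 φ.2.2
    rw [star_dotProduct_vecMul hU, sub_self, mul_zero] at g
    rw [restrict_apply, restrict_apply]
    exact sub_eq_zero.1 g

theorem matrix_unique (hT : DeficiencyBases T p q n) {U V : Matrix ι ι ℂ}
    (h : (T†).domRestrict (coordDomain T p q U) = (T†).domRestrict (coordDomain T p q V)) :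
    U = V := by
  refine Matrix.ext_of_single_vecMul fun j => ?_
  have hx := hasCoords_add (T := T) (p := p) (q := q) (zero_mem _) (Pi.single j 1)
    (Pi.single j 1 ᵥ* U)
  have hm : _ ∈ ((T†).domRestrict (coordDomain T p q U)).domain :=
    ⟨⟨_, hx⟩, hT.coordDomain_le U ⟨_, hx⟩⟩
  rw [h] at hm
  obtain ⟨⟨x', hx'⟩, -⟩ := hm
  obtain ⟨e1, e2⟩ := hT.coords_unique hx hx'
  rw [e2, ← e1]

/-- Every vector of `ker (i - T*)` is the component of a vector in the domain of a self-adjoint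
extension: a vector orthogonal to all such components lies in the domain itself, hence is one. -/
theorem exists_hasCoords_of_isSelfAdjoint (hT : DeficiencyBases T p q n) {A : E →ₗ.[ℂ] E}
    (hA : T ≤ A) (hs : IsSelfAdjoint A) (x : ι → ℂ) :
    ∃ ψ ∈ A.domain, ∃ y, HasCoords T p q ψ x y := by
  have hAT : A ≤ T† := by
    have := adjoint_antitone hT.dense hA
    rwa [LinearPMap.isSelfAdjoint_def.1 hs] at this
  -- a linear form `f` vanishing on the space `W` of first coordinates would be represented by a
  -- vector `ψ` of `ker (i - T*)` in the domain of `A* = A`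
  let W : Submodule ℂ (ι → ℂ) :=
    { carrier := {x | ∃ ψ ∈ A.domain, ∃ y, HasCoords T p q ψ x y}
      add_mem' := by
        rintro x x' ⟨ψ, hψ, y, h⟩ ⟨ψ', hψ', y', h'⟩
        refine ⟨ψ + ψ', add_mem hψ hψ', y + y', ?_⟩
        have h := add_mem h h'
        rw [HasCoords]
        convert h using 1
        simp only [Pi.add_apply, add_smul, Finset.sum_add_distrib]
        abel
      zero_mem' := ⟨0, zero_mem _, 0, by simp [HasCoords]⟩
      smul_mem' := by
        rintro c x ⟨ψ, hψ, y, h⟩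
        refine ⟨c • ψ, Submodule.smul_mem _ c hψ, c • y, ?_⟩
        have h := Submodule.smul_mem _ c h
        rw [HasCoords]
        convert h using 1
        simp only [Pi.smul_apply, smul_sub, Finset.smul_sum, smul_smul, smul_eq_mul] }
  suffices hW : W = ⊤ by
    have : x ∈ W := hW ▸ Submodule.mem_top
    exact this
  by_contra hne
  obtain ⟨f, hf0, hfW⟩ := Submodule.exists_le_ker_of_lt_top W (lt_top_iff_ne_top.2 hne)
  set x₀ : ι → ℂ := fun j => star (f (Pi.single j 1)) with hx₀
  have hfx : ∀ x, f x = star x₀ ⬝ᵥ x := by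
    intro x
    conv_lhs => rw [pi_eq_sum_univ' x, map_sum]
    simp only [map_smul, smul_eq_mul, dotProduct, Pi.star_apply, hx₀, star_star]
    refine Finset.sum_congr rfl fun j _ => ?_
    rw [mul_comm]
  have hc := hasCoords_add (T := T) (p := p) (q := q) (zero_mem _) x₀ 0
  set ψ := 0 + ∑ j, x₀ j • p j + ∑ j, (0 : ι → ℂ) j • q j
  obtain ⟨-, hm, -, -⟩ := hc.adjoint_apply hT
  have hmA : ψ ∈ A†.domain := by
    refine LinearPMap.mem_adjoint_domain_of_exists _ ⟨T† ⟨ψ, hm⟩, fun φ => ?_⟩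
    obtain ⟨x, y, hφ⟩ := hT.exists_hasCoords (hAT.1 φ.2)
    have g := hT.green hc hφ hm (hAT.1 φ.2)
    have hx : f x = 0 := hfW ⟨φ, φ.2, y, hφ⟩
    rw [← hfx, hx, star_zero, zero_dotProduct, sub_zero, mul_zero] at g
    rw [hAT.2 (x := φ) (y := ⟨φ, hAT.1 φ.2⟩) rfl]
    exact sub_eq_zero.1 g
  rw [LinearPMap.isSelfAdjoint_def.1 hs] at hmA
  have h0 : f x₀ = 0 := hfW ⟨ψ, hmA, 0, hc⟩
  rw [hfx] at h0
  have h1 : x₀ = 0 := eq_zero_of_star_dotProduct_self h0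
  exact hf0 (LinearMap.ext fun x => by rw [hfx, h1]; simp)

theorem exists_unitary (hT : DeficiencyBases T p q n) {A : E →ₗ.[ℂ] E} (hA : T ≤ A)
    (hs : IsSelfAdjoint A) :
    ∃ U ∈ Matrix.unitaryGroup ι ℂ, A = (T†).domRestrict (coordDomain T p q U) := by
  have hAT : A ≤ T† := by
    have := adjoint_antitone hT.dense hA
    rwa [LinearPMap.isSelfAdjoint_def.1 hs] at this
  have hn : (n : ℂ) ≠ 0 := Complex.ofReal_ne_zero.2 hT.pos.ne'
  choose ψ hψ u hu using fun j =>
    hT.exists_hasCoords_of_isSelfAdjoint hA hs (Pi.single j 1)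
  set U : Matrix ι ι ℂ := Matrix.of u with hUdef
  -- the boundary form vanishes on the domain of `A`, so the rows of `U` are orthonormal
  have hiso : ∀ j k, star (u j) ⬝ᵥ u k = if j = k then 1 else 0 := by
    intro j k
    have g := hT.green (hu j) (hu k) (hAT.1 (hψ j)) (hAT.1 (hψ k))
    have a := LinearPMap.adjoint_isFormalAdjoint hs.dense_domain
    rw [LinearPMap.isSelfAdjoint_def.1 hs] at a
    have a := a ⟨_, hψ j⟩ ⟨_, hψ k⟩
    rw [hAT.2 (x := ⟨_, hψ j⟩) (y := ⟨_, hAT.1 (hψ j)⟩) rfl,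
      hAT.2 (x := ⟨_, hψ k⟩) (y := ⟨_, hAT.1 (hψ k)⟩) rfl] at a
    rw [a, sub_self] at g
    have g2 : star (Pi.single j (1 : ℂ)) ⬝ᵥ Pi.single k (1 : ℂ) - star (u j) ⬝ᵥ u k = 0 := by
      simpa [hn] using g.symm
    rw [← sub_eq_zero.1 g2]
    simp [Pi.single_apply, eq_comm]
  have hU : U ∈ Matrix.unitaryGroup ι ℂ := by
    rw [Matrix.mem_unitaryGroup_iff]
    ext j k
    have := hiso k j
    rw [Matrix.mul_apply, Matrix.one_apply]
    simp only [eq_comm (a := j), ← this, dotProduct, Matrix.star_apply, Pi.star_apply, hUdef,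
      Matrix.of_apply]
    exact Finset.sum_congr rfl fun _ _ => mul_comm _ _
  refine ⟨U, hU, ?_⟩
  -- it suffices that `A` extends the restriction given by `U`, since both are self-adjoint
  have hle : (T†).domRestrict (coordDomain T p q U) ≤ A := by
    refine eq_of_le_of_domain_le LinearPMap.domRestrict_le hAT ?_
    rintro φ ⟨⟨x, hx⟩, -⟩
    have hsum : ∑ j, x j • ψ j ∈ A.domain :=
      Submodule.sum_mem _ fun j _ => Submodule.smul_mem _ _ (hψ j)
    have hc : HasCoords T p q (∑ j, x j • ψ j) x (x ᵥ* U) := by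
      have h := Submodule.sum_mem _ fun j (_ : j ∈ Finset.univ) => Submodule.smul_mem _ (x j) (hu j)
      rw [HasCoords]
      convert h using 1
      simp only [smul_sub, Finset.sum_sub_distrib, Pi.single_apply, ite_smul, one_smul, zero_smul,
        Finset.sum_ite_eq', Finset.mem_univ, if_true]
      congr 1
      simp only [Finset.smul_sum, Matrix.vecMul, dotProduct, Finset.sum_smul, smul_smul, hUdef,
        Matrix.of_apply]
      exact Finset.sum_comm
    have hd := hA.1 (sub_mem hx hc)
    have := add_mem hd hsum
    convert this using 1
    abel
  refine le_antisymm ?_ hle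
  have := adjoint_antitone (hT.dense.mono (hT.le_restrict U).1) hle
  rwa [LinearPMap.isSelfAdjoint_def.1 hs,
    LinearPMap.isSelfAdjoint_def.1 (hT.isSelfAdjoint_restrict hU)] at this

/-- **Von Neumann's theorem**: the self-adjoint extensions of `T` are the restrictions of `T*`
to the domains given by unitary matrices, in a one-to-one way. -/
theorem isSelfAdjoint_iff (hT : DeficiencyBases T p q n) (A : E →ₗ.[ℂ] E) :
    T ≤ A ∧ IsSelfAdjoint A ↔
    ∃! U : Matrix.unitaryGroup ι ℂ, A = (T†).domRestrict (coordDomain T p q U) := by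
  constructor
  · rintro ⟨hA, hs⟩
    obtain ⟨U, hU, e⟩ := hT.exists_unitary hA hs
    exact ⟨⟨U, hU⟩, e, fun V hV => Subtype.ext (hT.matrix_unique (hV.symm.trans e))⟩
  · rintro ⟨U, rfl, -⟩
    exact ⟨hT.le_restrict _, hT.isSelfAdjoint_restrict U.2⟩

end DeficiencyBases

end VonNeumann

/-! ### The minimal and the maximal Dirac operator -/

section Dirac

open scoped Matrix

variable {m Λ : ℝ}

theorem minimalDirac_apply (ψ : (minimalDirac m Λ).domain) :
    minimalDirac m Λ ψ = WithLp.toLp 2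
      (-Complex.I • derivMap Λ ⟨ψ.1.snd, ψ.2.2⟩ + (m : ℂ) • ψ.1.fst,
        -Complex.I • derivMap Λ ⟨ψ.1.fst, ψ.2.1⟩ - (m : ℂ) • ψ.1.snd) := rfl

theorem inner_spinor (ψ φ : Spinor Λ) : ⟪ψ, φ⟫_ℂ = ⟪ψ.fst, φ.fst⟫_ℂ + ⟪ψ.snd, φ.snd⟫_ℂ := rfl

theorem dense_minimalDirac (hΛ : 0 ≤ Λ) : Dense ((minimalDirac m Λ).domain : Set (Spinor Λ)) := by
  have hAC := dense_AC0 hΛ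
  rw [Submodule.dense_iff_topologicalClosure_eq_top, Submodule.topologicalClosure_eq_top_iff,
    Submodule.eq_bot_iff] at hAC ⊢
  intro ψ hψ
  have h1 : ψ.fst = 0 := by
    refine hAC _ fun f hf => ?_
    have hm : WithLp.toLp 2 (f, 0) ∈ (minimalDirac m Λ).domain := ⟨hf, zero_mem _⟩
    simpa [inner_spinor] using hψ _ hm
  have h2 : ψ.snd = 0 := by
    refine hAC _ fun f hf => ?_
    have hm : WithLp.toLp 2 (0, f) ∈ (minimalDirac m Λ).domain := ⟨zero_mem _, hf⟩
    simpa [inner_spinor] using hψ _ hm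
  exact (WithLp.ofLp_injective 2) (Prod.ext h1 h2)

/-- Spinors of class `AC¹` belong to the domain of `H₀*`, which acts as the differential expression
of `H₀`: no boundary terms arise against functions that vanish at the boundary. -/
theorem adjoint_of_rep (hΛ : 0 ≤ Λ) {ψ : Spinor Λ} {aL aR bL bR : ℝ → ℂ}
    (hu : IsACRep Λ ψ.fst aL aR) (hd : IsACRep Λ ψ.snd bL bR) :
    ∃ h : ψ ∈ (minimalDirac m Λ)†.domain, (minimalDirac m Λ)† ⟨ψ, h⟩ =
      WithLp.toLp 2 (-Complex.I • hd.derivLp + (m : ℂ) • ψ.fst,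
        -Complex.I • hu.derivLp - (m : ℂ) • ψ.snd) := by
  have key : ∀ φ : (minimalDirac m Λ).domain,
      ⟪(WithLp.toLp 2 (-Complex.I • hd.derivLp + (m : ℂ) • ψ.fst,
        -Complex.I • hu.derivLp - (m : ℂ) • ψ.snd) : Spinor Λ), (φ : Spinor Λ)⟫_ℂ =
      ⟪ψ, minimalDirac m Λ φ⟫_ℂ := by
    intro φ
    obtain ⟨fL, fR, hf, f1, f2⟩ := φ.2.1
    obtain ⟨gL, gR, hg, g1, g2⟩ := φ.2.2
    have i1 := hu.inner_derivLp hΛ hg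
    have i2 := hd.inner_derivLp hΛ hf
    rw [f1, f2] at i2
    rw [g1, g2] at i1
    rw [minimalDirac_apply, derivMap_eq _ hg, derivMap_eq _ hf, inner_spinor, inner_spinor]
    simp only [WithLp.toLp_fst, WithLp.toLp_snd, inner_add_left, inner_add_right, inner_sub_left,
      inner_sub_right, inner_smul_left, inner_smul_right, map_neg, Complex.conj_I,
      Complex.conj_ofReal]
    linear_combination Complex.I * i1 + Complex.I * i2
  have h := LinearPMap.mem_adjoint_domain_of_exists ψ ⟨_, key⟩
  exact ⟨h, LinearPMap.adjoint_apply_eq (dense_minimalDirac hΛ) ⟨ψ, h⟩ key⟩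

theorem minimalDirac_le_adjoint (hΛ : 0 ≤ Λ) : minimalDirac m Λ ≤ (minimalDirac m Λ)† := by
  have key : ∀ φ : (minimalDirac m Λ).domain,
      ∃ h : (φ : Spinor Λ) ∈ (minimalDirac m Λ)†.domain,
        (minimalDirac m Λ)† ⟨φ, h⟩ = minimalDirac m Λ φ := by
    intro φ
    obtain ⟨fL, fR, hf, -, -⟩ := φ.2.1
    obtain ⟨gL, gR, hg, -, -⟩ := φ.2.2
    obtain ⟨h, e⟩ := adjoint_of_rep (m := m) hΛ hf hg
    refine ⟨h, e.trans ?_⟩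
    rw [minimalDirac_apply, derivMap_eq _ hg, derivMap_eq _ hf]
  refine ⟨fun φ hφ => (key ⟨φ, hφ⟩).1, fun x y hxy => ?_⟩
  obtain ⟨h, e⟩ := key x
  rw [← e]
  congr 1
  exact Subtype.ext hxy

/-- `ψ` is of class `AC¹` with boundary values `(uL, dL)` at `-Λ` and `(uR, dR)` at `+Λ`. -/
def HasSpinorBoundary (Λ : ℝ) (ψ : Spinor Λ) (uL dL uR dR : ℂ) : Prop :=
  HasBoundaryValues Λ ψ.fst uL uR ∧ HasBoundaryValues Λ ψ.snd dL dR

theorem HasSpinorBoundary.mem_domain (hΛ : 0 ≤ Λ) {ψ : Spinor Λ} {uL dL uR dR : ℂ}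
    (h : HasSpinorBoundary Λ ψ uL dL uR dR) : ψ ∈ (maximalDirac m Λ).domain := by
  obtain ⟨⟨_, _, hu, -, -⟩, ⟨_, _, hd, -, -⟩⟩ := h
  exact (adjoint_of_rep hΛ hu hd).1

/-- Elements of the domain of `H₀*` are of class `AC¹`. -/
theorem exists_spinorBoundary (hΛ : 0 ≤ Λ) {ψ : Spinor Λ} (hψ : ψ ∈ (maximalDirac m Λ).domain) :
    ∃ uL dL uR dR, HasSpinorBoundary Λ ψ uL dL uR dR := by
  have hadj := LinearPMap.adjoint_isFormalAdjoint (dense_minimalDirac (m := m) hΛ) ⟨ψ, hψ⟩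
  set w := (minimalDirac m Λ)† ⟨ψ, hψ⟩
  have w1 : IsWeakDeriv Λ ψ.snd (Complex.I • (w.fst - (m : ℂ) • ψ.fst)) := by
    intro f fL fR hf h1 h2
    have hm : WithLp.toLp 2 (f, 0) ∈ (minimalDirac m Λ).domain := ⟨⟨fL, fR, hf, h1, h2⟩, zero_mem _⟩
    have h := hadj ⟨_, hm⟩
    have e0 : derivMap Λ ⟨(0 : L2 Λ), zero_mem _⟩ = 0 := (derivMap Λ).map_zero
    have e1 : derivMap Λ ⟨f, ⟨fL, fR, hf, h1, h2⟩⟩ = hf.derivLp := derivMap_eq _ hf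
    rw [minimalDirac_apply, inner_spinor, inner_spinor] at h
    simp only [WithLp.toLp_fst, WithLp.toLp_snd, e0, e1, smul_zero, inner_zero_right, add_zero,
      zero_add, sub_zero, inner_smul_right] at h
    simp only [inner_smul_left, inner_sub_left, Complex.conj_I, Complex.conj_ofReal]
    linear_combination (-Complex.I) * h + ⟪ψ.snd, hf.derivLp⟫_ℂ * Complex.I_sq
  have w2 : IsWeakDeriv Λ ψ.fst (Complex.I • (w.snd + (m : ℂ) • ψ.snd)) := by
    intro f fL fR hf h1 h2
    have hm : WithLp.toLp 2 (0, f) ∈ (minimalDirac m Λ).domain := ⟨zero_mem _, ⟨fL, fR, hf, h1, h2⟩⟩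
    have h := hadj ⟨_, hm⟩
    have e0 : derivMap Λ ⟨(0 : L2 Λ), zero_mem _⟩ = 0 := (derivMap Λ).map_zero
    have e1 : derivMap Λ ⟨f, ⟨fL, fR, hf, h1, h2⟩⟩ = hf.derivLp := derivMap_eq _ hf
    rw [minimalDirac_apply, inner_spinor, inner_spinor] at h
    simp only [WithLp.toLp_fst, WithLp.toLp_snd, e0, e1, smul_zero, inner_zero_right, add_zero,
      zero_add, zero_sub, inner_smul_right, inner_neg_right] at h
    simp only [inner_smul_left, inner_add_left, Complex.conj_I, Complex.conj_ofReal]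
    linear_combination (-Complex.I) * h + ⟪ψ.fst, hf.derivLp⟫_ℂ * Complex.I_sq
  obtain ⟨bL, bR, hd, -⟩ := w1.exists_rep hΛ
  obtain ⟨aL, aR, hu, -⟩ := w2.exists_rep hΛ
  exact ⟨_, _, _, _, ⟨_, _, hu, rfl, rfl⟩, ⟨_, _, hd, rfl, rfl⟩⟩

theorem mem_minimalDirac_iff {ψ : Spinor Λ} {uL dL uR dR : ℂ}
    (h : HasSpinorBoundary Λ ψ uL dL uR dR) :
    ψ ∈ (minimalDirac m Λ).domain ↔ uL = 0 ∧ dL = 0 ∧ uR = 0 ∧ dR = 0 := by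
  constructor
  · rintro ⟨h1, h2⟩
    obtain ⟨e1, e2⟩ := h.1.unique h1
    obtain ⟨e3, e4⟩ := h.2.unique h2
    exact ⟨e1, e3, e2, e4⟩
  · rintro ⟨rfl, rfl, rfl, rfl⟩
    exact h

/-! ### The deficiency functions -/

/-- The boundary value `N exp(-√(1 + m²) Λ)` of the deficiency functions. -/
def edgeValue (m Λ : ℝ) : ℝ := normConst m Λ * Real.exp (-(Real.sqrt (1 + m ^ 2) * Λ))

theorem edgeValue_pos (m Λ : ℝ) : 0 < edgeValue m Λ := mul_pos (normConst_pos m Λ) (Real.exp_pos _)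

theorem hasDerivAt_exp_mul (N k x : ℝ) :
    HasDerivAt (fun x : ℝ => ((N * Real.exp (k * x) : ℝ) : ℂ))
      ((k : ℂ) * ((N * Real.exp (k * x) : ℝ) : ℂ)) x := by
  have h : HasDerivAt (fun x : ℝ => N * Real.exp (k * x)) (N * (Real.exp (k * x) * k)) x := by
    simpa using (((hasDerivAt_id x).const_mul k).exp).const_mul N
  convert h.ofReal_comp using 1
  push_cast
  ring

theorem isAC1On_exp_mul {N k : ℝ} {s : Set ℝ}
    (h : MemLp (fun x : ℝ => ((N * Real.exp (k * x) : ℝ) : ℂ)) 2 (volume.restrict s)) :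
    IsAC1On (fun x : ℝ => ((N * Real.exp (k * x) : ℝ) : ℂ)) s where
  ac a _ b _ := by
    have hc : ContDiff ℝ 1 fun x : ℝ => N * Real.exp (k * x) := by fun_prop
    exact ac_ofReal hc.contDiffOn.absolutelyContinuousOnInterval
  memLp := h
  memLp_deriv := by
    have e : deriv (fun x : ℝ => ((N * Real.exp (k * x) : ℝ) : ℂ)) =
        fun x => (k : ℂ) * ((N * Real.exp (k * x) : ℝ) : ℂ) :=
      funext fun x => (hasDerivAt_exp_mul N k x).deriv
    rw [e]
    exact h.const_mul _

theorem expLeft_rep (m : ℝ) (hΛ : 0 ≤ Λ) : ∃ h : IsACRep Λ (expLeft m Λ)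
    (fun x : ℝ => ((normConst m Λ * Real.exp (Real.sqrt (1 + m ^ 2) * x) : ℝ) : ℂ)) 0,
    h.derivLp = ((Real.sqrt (1 + m ^ 2) : ℝ) : ℂ) • expLeft m Λ := by
  have hc := (memLp_expLeft m Λ).coeFn_toLp
  have e1 : expLeft m Λ =ᵐ[volume.restrict (leftIsland Λ)]
      fun x : ℝ => ((normConst m Λ * Real.exp (Real.sqrt (1 + m ^ 2) * x) : ℝ) : ℂ) := by
    filter_upwards [hc.filter_mono (left_ac Λ), ae_restrict_mem (measurableSet_Iio (a := -Λ))]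
      with x h1 h2
    have h2' : x ∈ Iic (-Λ) := Iio_subset_Iic_self h2
    rw [expLeft, h1, expLeftFun, indicator_of_mem h2']
  have e2 : expLeft m Λ =ᵐ[volume.restrict (rightIsland Λ)] (0 : ℝ → ℂ) := by
    filter_upwards [hc.filter_mono (right_ac Λ), ae_restrict_mem (measurableSet_Ioi (a := Λ))]
      with x h1 h2
    have h2' : x ∉ Iic (-Λ) := by
      simp only [mem_Ioi, mem_Iic, not_le] at *
      linarith
    rw [expLeft, h1, expLeftFun, indicator_of_notMem h2', Pi.zero_apply]
  have hs := Lp.coeFn_smul ((Real.sqrt (1 + m ^ 2) : ℝ) : ℂ) (expLeft m Λ)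
  refine ⟨⟨isAC1On_exp_mul ((memLp_congr_ae e1).1 ((Lp.memLp _).mono_measure
    (Measure.restrict_mono subset_union_left le_rfl))), IsAC1On.zero _, e1, e2⟩, ?_⟩
  refine IsACRep.derivLp_ext _ ?_ ?_
  · filter_upwards [hs.filter_mono (left_ac Λ), e1] with x h1 h2
    rw [h1, Pi.smul_apply, h2, (hasDerivAt_exp_mul _ _ x).deriv, smul_eq_mul]
  · filter_upwards [hs.filter_mono (right_ac Λ), e2] with x h1 h2 _
    have hd : deriv (0 : ℝ → ℂ) x = 0 := deriv_const x (0 : ℂ)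
    rw [h1, Pi.smul_apply, h2, hd, Pi.zero_apply, smul_zero]

theorem expRight_rep (m : ℝ) (hΛ : 0 ≤ Λ) : ∃ h : IsACRep Λ (expRight m Λ) 0
    (fun x : ℝ => ((normConst m Λ * Real.exp (-Real.sqrt (1 + m ^ 2) * x) : ℝ) : ℂ)),
    h.derivLp = (-(Real.sqrt (1 + m ^ 2) : ℝ) : ℂ) • expRight m Λ := by
  have hc := (memLp_expRight m Λ).coeFn_toLp
  have e1 : expRight m Λ =ᵐ[volume.restrict (rightIsland Λ)]
      fun x : ℝ => ((normConst m Λ * Real.exp (-Real.sqrt (1 + m ^ 2) * x) : ℝ) : ℂ) := by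
    filter_upwards [hc.filter_mono (right_ac Λ), ae_restrict_mem (measurableSet_Ioi (a := Λ))]
      with x h1 h2
    have h2' : x ∈ Ici Λ := Ioi_subset_Ici_self h2
    rw [expRight, h1, expRightFun, indicator_of_mem h2']
  have e2 : expRight m Λ =ᵐ[volume.restrict (leftIsland Λ)] (0 : ℝ → ℂ) := by
    filter_upwards [hc.filter_mono (left_ac Λ), ae_restrict_mem (measurableSet_Iio (a := -Λ))]
      with x h1 h2
    have h2' : x ∉ Ici Λ := by
      simp only [mem_Iio, mem_Ici, not_le] at *
      linarith
    rw [expRight, h1, expRightFun, indicator_of_notMem h2', Pi.zero_apply]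
  have hs := Lp.coeFn_smul (-(Real.sqrt (1 + m ^ 2) : ℝ) : ℂ) (expRight m Λ)
  refine ⟨⟨IsAC1On.zero _, isAC1On_exp_mul ((memLp_congr_ae e1).1 ((Lp.memLp _).mono_measure
    (Measure.restrict_mono subset_union_right le_rfl))), e2, e1⟩, ?_⟩
  refine IsACRep.derivLp_ext _ ?_ ?_
  · filter_upwards [hs.filter_mono (left_ac Λ), e2] with x h1 h2
    have hd : deriv (0 : ℝ → ℂ) x = 0 := deriv_const x (0 : ℂ)
    rw [h1, Pi.smul_apply, h2, hd, Pi.zero_apply, smul_zero]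
  · filter_upwards [hs.filter_mono (right_ac Λ), e1] with x h1 h2 _
    rw [h1, Pi.smul_apply, h2, (hasDerivAt_exp_mul _ _ x).deriv, smul_eq_mul, Complex.ofReal_neg]

theorem expLeft_boundary (m : ℝ) (hΛ : 0 ≤ Λ) :
    HasBoundaryValues Λ (expLeft m Λ) (edgeValue m Λ) 0 := by
  obtain ⟨h, -⟩ := expLeft_rep m hΛ
  refine ⟨_, _, h, ?_, rfl⟩
  simp only [edgeValue, mul_neg]

theorem expRight_boundary (m : ℝ) (hΛ : 0 ≤ Λ) :
    HasBoundaryValues Λ (expRight m Λ) 0 (edgeValue m Λ) := by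
  obtain ⟨h, -⟩ := expRight_rep m hΛ
  refine ⟨_, _, h, rfl, ?_⟩
  simp only [edgeValue, neg_mul]

theorem sqrt_ne_zero_complex (m : ℝ) : ((Real.sqrt (1 + m ^ 2) : ℝ) : ℂ) ≠ 0 :=
  Complex.ofReal_ne_zero.2 (sqrt_pos' m).ne'

theorem sqrt_sq_complex (m : ℝ) : ((Real.sqrt (1 + m ^ 2) : ℝ) : ℂ) ^ 2 = 1 + (m : ℂ) ^ 2 := by
  rw [← Complex.ofReal_pow, Real.sq_sqrt (by positivity)]
  push_cast
  rfl

theorem sqrt_mul_mu (m : ℝ) : ((Real.sqrt (1 + m ^ 2) : ℝ) : ℂ) * mu m = 1 + Complex.I * m := by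
  rw [mu, mul_div_cancel₀ _ (sqrt_ne_zero_complex m)]

theorem sqrt_mul_star_mu (m : ℝ) :
    ((Real.sqrt (1 + m ^ 2) : ℝ) : ℂ) * star (mu m) = 1 - Complex.I * m := by
  have h := congrArg star (sqrt_mul_mu m)
  simpa [mul_comm, sub_eq_add_neg] using h

theorem mu_mul_star (m : ℝ) : mu m * star (mu m) = 1 := by
  have h : ((Real.sqrt (1 + m ^ 2) : ℝ) : ℂ) ^ 2 * (mu m * star (mu m)) =
      ((Real.sqrt (1 + m ^ 2) : ℝ) : ℂ) ^ 2 * 1 := by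
    rw [sqrt_sq_complex]
    have h1 := sqrt_mul_mu m
    have h2 := sqrt_mul_star_mu m
    have h3 := sqrt_sq_complex m
    linear_combination (-(mu m * star (mu m))) * h3 +
      ((Real.sqrt (1 + m ^ 2) : ℝ) : ℂ) * star (mu m) * h1 + (1 + Complex.I * m) * h2 -
      (m : ℂ) ^ 2 * Complex.I_sq
  exact mul_left_cancel₀ (pow_ne_zero 2 (sqrt_ne_zero_complex m)) h

theorem sqrt_mul_mu_add (m : ℝ) :
    ((Real.sqrt (1 + m ^ 2) : ℝ) : ℂ) * (mu m + star (mu m)) = 2 := by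
  linear_combination sqrt_mul_mu m + sqrt_mul_star_mu m

theorem mu_add_star_ne_zero (m : ℝ) : mu m + star (mu m) ≠ 0 := by
  intro h
  have := sqrt_mul_mu_add m
  rw [h, mul_zero] at this
  exact two_ne_zero this.symm

theorem two_sqrt_mul_inner_expLeft (m : ℝ) (hΛ : 0 ≤ Λ) :
    2 * ((Real.sqrt (1 + m ^ 2) : ℝ) : ℂ) * ⟪expLeft m Λ, expLeft m Λ⟫_ℂ = edgeValue m Λ ^ 2 := by
  obtain ⟨h, e⟩ := expLeft_rep m hΛ
  have g := h.inner_derivLp hΛ h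
  rw [e, inner_smul_left, inner_smul_right, Complex.conj_ofReal] at g
  have hb : ((normConst m Λ * Real.exp (Real.sqrt (1 + m ^ 2) * -Λ) : ℝ) : ℂ) = edgeValue m Λ := by
    simp only [edgeValue, mul_neg]
  simp only [hb, Pi.zero_apply, zero_mul, sub_zero, Complex.star_def, Complex.conj_ofReal] at g
  linear_combination g

theorem two_sqrt_mul_inner_expRight (m : ℝ) (hΛ : 0 ≤ Λ) :
    2 * ((Real.sqrt (1 + m ^ 2) : ℝ) : ℂ) * ⟪expRight m Λ, expRight m Λ⟫_ℂ =
      edgeValue m Λ ^ 2 := by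
  obtain ⟨h, e⟩ := expRight_rep m hΛ
  have g := h.inner_derivLp hΛ h
  rw [e, inner_smul_left, inner_smul_right, map_neg, Complex.conj_ofReal] at g
  have hb : ((normConst m Λ * Real.exp (-Real.sqrt (1 + m ^ 2) * Λ) : ℝ) : ℂ) = edgeValue m Λ := by
    simp only [edgeValue, neg_mul]
  simp only [hb, Pi.zero_apply, zero_mul, zero_sub, Complex.star_def, Complex.conj_ofReal] at g
  linear_combination -g

theorem inner_expRight_self (m : ℝ) (hΛ : 0 ≤ Λ) :
    ⟪expRight m Λ, expRight m Λ⟫_ℂ = ⟪expLeft m Λ, expLeft m Λ⟫_ℂ :=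
  mul_left_cancel₀ (mul_ne_zero two_ne_zero (sqrt_ne_zero_complex m))
    ((two_sqrt_mul_inner_expRight m hΛ).trans (two_sqrt_mul_inner_expLeft m hΛ).symm)

/-- A spinor `(e, c e)` with `e' = k e` is an eigenvector of `H₀*` once `c` solves the matrix
eigenvalue equation. -/
theorem adjoint_eigenvector (hΛ : 0 ≤ Λ) {e : L2 Λ} {fL fR : ℝ → ℂ} (h : IsACRep Λ e fL fR)
    {k c z : ℂ} (hk : h.derivLp = k • e) (h1 : -Complex.I * (c * k) + m = z)
    (h2 : -Complex.I * k - m * c = z * c) :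
    ∃ h : WithLp.toLp 2 (e, c • e) ∈ (minimalDirac m Λ)†.domain,
      (minimalDirac m Λ)† ⟨WithLp.toLp 2 (e, c • e), h⟩ = z • WithLp.toLp 2 (e, c • e) := by
  obtain ⟨hd, eq⟩ := adjoint_of_rep (m := m) hΛ (ψ := WithLp.toLp 2 (e, c • e)) h (h.smul c)
  have eq' : (minimalDirac m Λ)† ⟨WithLp.toLp 2 (e, c • e), hd⟩ =
      WithLp.toLp 2 (-Complex.I • (h.smul c).derivLp + (m : ℂ) • e,
        -Complex.I • h.derivLp - (m : ℂ) • c • e) := eq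
  refine ⟨hd, eq'.trans ?_⟩
  rw [h.derivLp_smul, hk, ← WithLp.toLp_smul, Prod.smul_mk, smul_smul z, ← h2, ← h1]
  simp only [smul_smul, add_smul, sub_smul]

theorem psiPlus_eigenvector (hΛ : 0 ≤ Λ) (j : Fin 2) :
    ∃ h : psiPlus m Λ j ∈ (minimalDirac m Λ)†.domain,
      (minimalDirac m Λ)† ⟨psiPlus m Λ j, h⟩ = Complex.I • psiPlus m Λ j := by
  have hμ := sqrt_mul_mu m
  have hμ' := mu_mul_star m
  have hs := sqrt_mul_star_mu m
  have hκ : ((Real.sqrt (1 + m ^ 2) : ℝ) : ℂ) = (1 - Complex.I * m) * mu m := by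
    linear_combination mu m * hs - ((Real.sqrt (1 + m ^ 2) : ℝ) : ℂ) * hμ'
  fin_cases j
  · obtain ⟨h, e⟩ := expLeft_rep m hΛ
    refine adjoint_eigenvector hΛ h e ?_ ?_
    · linear_combination Complex.I * hμ + m * Complex.I_sq
    · linear_combination (-Complex.I) * hκ + m * mu m * Complex.I_sq
  · obtain ⟨h, e⟩ := expRight_rep m hΛ
    refine adjoint_eigenvector hΛ h e ?_ ?_
    · linear_combination Complex.I * hμ + m * Complex.I_sq
    · linear_combination Complex.I * hκ - m * mu m * Complex.I_sq

theorem psiMinus_eigenvector (hΛ : 0 ≤ Λ) (j : Fin 2) :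
    ∃ h : psiMinus m Λ j ∈ (minimalDirac m Λ)†.domain,
      (minimalDirac m Λ)† ⟨psiMinus m Λ j, h⟩ = -Complex.I • psiMinus m Λ j := by
  have hμ := sqrt_mul_mu m
  have hμ' := mu_mul_star m
  have hs := sqrt_mul_star_mu m
  have hκ : ((Real.sqrt (1 + m ^ 2) : ℝ) : ℂ) = (1 + Complex.I * m) * star (mu m) := by
    linear_combination star (mu m) * hμ - ((Real.sqrt (1 + m ^ 2) : ℝ) : ℂ) * hμ'
  fin_cases j
  · obtain ⟨h, e⟩ := expLeft_rep m hΛ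
    refine adjoint_eigenvector hΛ h e ?_ ?_
    · linear_combination (-Complex.I) * hs + m * Complex.I_sq
    · linear_combination (-Complex.I) * hκ - m * star (mu m) * Complex.I_sq
  · obtain ⟨h, e⟩ := expRight_rep m hΛ
    refine adjoint_eigenvector hΛ h e ?_ ?_
    · linear_combination (-Complex.I) * hs + m * Complex.I_sq
    · linear_combination Complex.I * hκ + m * star (mu m) * Complex.I_sq

theorem inner_spinor_smul (e f : L2 Λ) (c d : ℂ) :
    ⟪(WithLp.toLp 2 (e, c • e) : Spinor Λ), WithLp.toLp 2 (f, d • f)⟫_ℂ =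
      (1 + star c * d) * ⟪e, f⟫_ℂ := by
  rw [inner_spinor]
  simp only [WithLp.toLp_fst, WithLp.toLp_snd, inner_smul_left, inner_smul_right, Complex.star_def]
  ring

theorem inner_psiPlus (hΛ : 0 ≤ Λ) (j k : Fin 2) : ⟪psiPlus m Λ j, psiPlus m Λ k⟫_ℂ =
    if j = k then ((2 * ‖expLeft m Λ‖ ^ 2 : ℝ) : ℂ) else 0 := by
  split_ifs with h
  · subst h
    have e : ⟪expLeft m Λ, expLeft m Λ⟫_ℂ = (‖expLeft m Λ‖ : ℂ) ^ 2 := inner_self_eq_norm_sq_to_K _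
    have hμ' := mu_mul_star m
    push_cast
    rw [← e]
    fin_cases j
    · refine (inner_spinor_smul _ _ _ _).trans ?_
      rw [star_neg]
      linear_combination ⟪expLeft m Λ, expLeft m Λ⟫_ℂ * hμ'
    · refine (inner_spinor_smul _ _ _ _).trans ?_
      rw [inner_expRight_self m hΛ]
      linear_combination ⟪expLeft m Λ, expLeft m Λ⟫_ℂ * hμ'
  · exact inner_psiPlus_of_ne hΛ h

theorem inner_psiMinus (hΛ : 0 ≤ Λ) (j k : Fin 2) : ⟪psiMinus m Λ j, psiMinus m Λ k⟫_ℂ =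
    if j = k then ((2 * ‖expLeft m Λ‖ ^ 2 : ℝ) : ℂ) else 0 := by
  have h := inner_expLeft_expRight (m := m) hΛ
  have h' : ⟪expRight m Λ, expLeft m Λ⟫_ℂ = 0 := inner_eq_zero_symm.1 h
  have e : ⟪expLeft m Λ, expLeft m Λ⟫_ℂ = (‖expLeft m Λ‖ : ℂ) ^ 2 := inner_self_eq_norm_sq_to_K _
  have hμ' := mu_mul_star m
  push_cast
  rw [← e]
  fin_cases j <;> fin_cases k <;> refine (inner_spinor_smul _ _ _ _).trans ?_
  · simp only [star_star, Fin.zero_eta, if_true]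
    linear_combination ⟪expLeft m Λ, expLeft m Λ⟫_ℂ * hμ'
  · simp [h]
  · simp [h']
  · simp only [star_star, star_neg, Fin.mk_one, if_true, inner_expRight_self m hΛ]
    linear_combination ⟪expLeft m Λ, expLeft m Λ⟫_ℂ * hμ'

/-! ### Coordinates and boundary values -/

theorem HasSpinorBoundary.sub_coords (hΛ : 0 ≤ Λ) {ψ : Spinor Λ} {uL dL uR dR : ℂ}
    (h : HasSpinorBoundary Λ ψ uL dL uR dR) (x y : Fin 2 → ℂ) :
    HasSpinorBoundary Λ (ψ - ∑ j, x j • psiPlus m Λ j - ∑ j, y j • psiMinus m Λ j)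
      (uL - edgeValue m Λ * (x 0 + y 0))
      (dL - edgeValue m Λ * (-mu m * x 0 + star (mu m) * y 0))
      (uR - edgeValue m Λ * (x 1 + y 1))
      (dR - edgeValue m Λ * (mu m * x 1 - star (mu m) * y 1)) := by
  have hL := expLeft_boundary m hΛ
  have hR := expRight_boundary m hΛ
  constructor
  · have e : (ψ - ∑ j, x j • psiPlus m Λ j - ∑ j, y j • psiMinus m Λ j).fst =
        ψ.fst + (-(x 0 + y 0)) • expLeft m Λ + (-(x 1 + y 1)) • expRight m Λ := by
      simp only [Fin.sum_univ_two, psiPlus, psiMinus, WithLp.sub_fst, WithLp.add_fst,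
        WithLp.smul_fst, Matrix.cons_val_zero, Matrix.cons_val_one, WithLp.toLp_fst]
      module
    rw [e]
    convert (h.1.add (hL.smul _)).add (hR.smul _) using 1 <;> ring
  · have e : (ψ - ∑ j, x j • psiPlus m Λ j - ∑ j, y j • psiMinus m Λ j).snd =
        ψ.snd + (-(-mu m * x 0 + star (mu m) * y 0)) • expLeft m Λ +
          (-(mu m * x 1 - star (mu m) * y 1)) • expRight m Λ := by
      simp only [Fin.sum_univ_two, psiPlus, psiMinus, WithLp.sub_snd, WithLp.add_snd,
        WithLp.smul_snd, Matrix.cons_val_zero, Matrix.cons_val_one, WithLp.toLp_snd]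
      module
    rw [e]
    convert (h.2.add (hL.smul _)).add (hR.smul _) using 1 <;> ring

/-- The boundary values as linear functions of the coordinates. -/
theorem HasSpinorBoundary.hasCoords_iff (hΛ : 0 ≤ Λ) {ψ : Spinor Λ} {uL dL uR dR : ℂ}
    (h : HasSpinorBoundary Λ ψ uL dL uR dR) (x y : Fin 2 → ℂ) :
    HasCoords (minimalDirac m Λ) (psiPlus m Λ) (psiMinus m Λ) ψ x y ↔
      uL = edgeValue m Λ * (x 0 + y 0) ∧
      dL = edgeValue m Λ * (-mu m * x 0 + star (mu m) * y 0) ∧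
      uR = edgeValue m Λ * (x 1 + y 1) ∧
      dR = edgeValue m Λ * (mu m * x 1 - star (mu m) * y 1) := by
  rw [HasCoords, mem_minimalDirac_iff (h.sub_coords hΛ x y)]
  simp only [sub_eq_zero]

theorem edgeValue_ne_zero (m Λ : ℝ) : (edgeValue m Λ : ℂ) ≠ 0 :=
  Complex.ofReal_ne_zero.2 (edgeValue_pos m Λ).ne'

/-- The coordinates as linear functions of the boundary values. -/
theorem HasSpinorBoundary.hasCoords_iff' (hΛ : 0 ≤ Λ) {ψ : Spinor Λ} {uL dL uR dR : ℂ}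
    (h : HasSpinorBoundary Λ ψ uL dL uR dR) (x y : Fin 2 → ℂ) :
    HasCoords (minimalDirac m Λ) (psiPlus m Λ) (psiMinus m Λ) ψ x y ↔
      edgeValue m Λ * (mu m + star (mu m)) * x 0 = star (mu m) * uL - dL ∧
      edgeValue m Λ * (mu m + star (mu m)) * y 0 = mu m * uL + dL ∧
      edgeValue m Λ * (mu m + star (mu m)) * x 1 = star (mu m) * uR + dR ∧
      edgeValue m Λ * (mu m + star (mu m)) * y 1 = mu m * uR - dR := by
  rw [h.hasCoords_iff hΛ]
  have hs := mu_add_star_ne_zero m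
  constructor
  · rintro ⟨rfl, rfl, rfl, rfl⟩
    refine ⟨?_, ?_, ?_, ?_⟩ <;> ring
  · rintro ⟨h1, h2, h3, h4⟩
    refine ⟨?_, ?_, ?_, ?_⟩ <;> refine mul_left_cancel₀ hs ?_
    · linear_combination -h1 - h2
    · linear_combination mu m * h1 - star (mu m) * h2
    · linear_combination -h3 - h4
    · linear_combination -mu m * h3 + star (mu m) * h4

theorem deficiencyBases (hΛ : 0 ≤ Λ) : DeficiencyBases (minimalDirac m Λ) (psiPlus m Λ)
    (psiMinus m Λ) (2 * ‖expLeft m Λ‖ ^ 2) where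
  dense := dense_minimalDirac hΛ
  symmetric := minimalDirac_le_adjoint hΛ
  pos := by
    have := norm_pos_iff.2 (expLeft_ne_zero m Λ)
    positivity
  plus := psiPlus_eigenvector hΛ
  minus := psiMinus_eigenvector hΛ
  inner_plus := inner_psiPlus hΛ
  inner_minus := inner_psiMinus hΛ
  span ψ hψ := by
    obtain ⟨uL, dL, uR, dR, h⟩ := exists_spinorBoundary hΛ hψ
    have hc := mul_ne_zero (edgeValue_ne_zero m Λ) (mu_add_star_ne_zero m)
    refine ⟨![(star (mu m) * uL - dL) / (edgeValue m Λ * (mu m + star (mu m))),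
      (star (mu m) * uR + dR) / (edgeValue m Λ * (mu m + star (mu m)))],
      ![(mu m * uL + dL) / (edgeValue m Λ * (mu m + star (mu m))),
      (mu m * uR - dR) / (edgeValue m Λ * (mu m + star (mu m)))], ?_⟩
    refine (h.hasCoords_iff' hΛ _ _).2 ⟨?_, ?_, ?_, ?_⟩ <;> exact mul_div_cancel₀ _ hc

/-- Every quadruple of boundary values occurs in the domain of `H₀*`. -/
theorem exists_of_spinorBoundary (m : ℝ) (hΛ : 0 ≤ Λ) (uL dL uR dR : ℂ) :
    ∃ ψ : Spinor Λ, HasSpinorBoundary Λ ψ uL dL uR dR := by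
  have hL := expLeft_boundary m hΛ
  have hR := expRight_boundary m hΛ
  have hc := edgeValue_ne_zero m Λ
  refine ⟨WithLp.toLp 2 ((uL / edgeValue m Λ) • expLeft m Λ + (uR / edgeValue m Λ) • expRight m Λ,
    (dL / edgeValue m Λ) • expLeft m Λ + (dR / edgeValue m Λ) • expRight m Λ), ?_, ?_⟩
  · convert (hL.smul (uL / edgeValue m Λ)).add (hR.smul (uR / edgeValue m Λ)) using 1 <;>
      simp [hc]
  · convert (hL.smul (dL / edgeValue m Λ)).add (hR.smul (dR / edgeValue m Λ)) using 1 <;>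
      simp [hc]

/-! ### The domains in terms of boundary values -/

theorem matrixOperator_sum (hΛ : 0 ≤ Λ) (U : Matrix (Fin 2) (Fin 2) ℂ) (x : Fin 2 → ℂ) :
    matrixOperator m Λ U (∑ j, x j • psiPlus m Λ j) = ∑ k, (x ᵥ* U) k • psiMinus m Λ k := by
  simp only [map_sum, map_smul, matrixOperator_psiPlus hΛ, Finset.smul_sum, smul_smul,
    Matrix.vecMul, dotProduct, Finset.sum_smul]
  exact Finset.sum_comm

theorem vonNeumannDomain_eq (hΛ : 0 ≤ Λ) (U : Matrix (Fin 2) (Fin 2) ℂ) :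
    vonNeumannDomain m Λ U = coordDomain (minimalDirac m Λ) (psiPlus m Λ) (psiMinus m Λ) U := by
  have hT := deficiencyBases (m := m) hΛ
  ext ψ
  rw [vonNeumannDomain, Submodule.mem_sup]
  constructor
  · rintro ⟨ψ₀, h0, _, ⟨φ, ⟨hφ, e⟩, rfl⟩, rfl⟩
    obtain ⟨x, rfl⟩ := hT.mem_span_plus hφ e
    refine ⟨x, ?_⟩
    rw [LinearMap.add_apply, LinearMap.id_apply, matrixOperator_sum hΛ, ← add_assoc]
    exact hasCoords_add h0 _ _
  · rintro ⟨x, hx⟩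
    refine ⟨_, hx, _, ⟨_, hT.mem_plus x, rfl⟩, ?_⟩
    rw [LinearMap.add_apply, LinearMap.id_apply, matrixOperator_sum hΛ]
    abel

theorem HU_eq (hΛ : 0 ≤ Λ) (U : Matrix (Fin 2) (Fin 2) ℂ) :
    HU m Λ U = ((minimalDirac m Λ)†).domRestrict
      (coordDomain (minimalDirac m Λ) (psiPlus m Λ) (psiMinus m Λ) U) := by
  rw [HU, vonNeumannDomain_eq hΛ, maximalDirac]

/-- The boundary conditions that define the domain of `H_U`. -/
theorem HasSpinorBoundary.mem_HU_iff (hΛ : 0 ≤ Λ) {ψ : Spinor Λ} {uL dL uR dR : ℂ}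
    (h : HasSpinorBoundary Λ ψ uL dL uR dR) (U : Matrix (Fin 2) (Fin 2) ℂ) :
    ψ ∈ (HU m Λ U).domain ↔
      mu m * uL + dL = (star (mu m) * uL - dL) * U 0 0 + (star (mu m) * uR + dR) * U 1 0 ∧
      mu m * uR - dR = (star (mu m) * uL - dL) * U 0 1 + (star (mu m) * uR + dR) * U 1 1 := by
  have hT := deficiencyBases (m := m) hΛ
  have hc := mul_ne_zero (edgeValue_ne_zero m Λ) (mu_add_star_ne_zero m)
  have hd : ψ ∈ (minimalDirac m Λ)†.domain := h.mem_domain hΛ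
  rw [HU_eq hΛ, LinearPMap.domRestrict_domain, Submodule.mem_inf, and_iff_left hd]
  obtain ⟨x, y, hxy⟩ := hT.exists_hasCoords hd
  obtain ⟨h1, h2, h3, h4⟩ := (h.hasCoords_iff' hΛ x y).1 hxy
  rw [← h1, ← h2, ← h3, ← h4]
  have e : ψ ∈ coordDomain (minimalDirac m Λ) (psiPlus m Λ) (psiMinus m Λ) U ↔ y = x ᵥ* U := by
    constructor
    · rintro ⟨x', hx'⟩
      obtain ⟨rfl, e⟩ := hT.coords_unique hxy hx'
      exact e
    · rintro rfl
      exact ⟨x, hxy⟩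
  rw [e, funext_iff, Fin.forall_fin_two]
  simp only [Matrix.vecMul, dotProduct, Fin.sum_univ_two]
  refine and_congr ⟨fun h => by rw [h]; ring, fun h => mul_left_cancel₀ hc (h.trans (by ring))⟩
    ⟨fun h => by rw [h]; ring, fun h => mul_left_cancel₀ hc (h.trans (by ring))⟩

theorem HasSpinorBoundary.mem_HRho_iff (hΛ : 0 ≤ Λ) {ψ : Spinor Λ} {uL dL uR dR : ℂ}
    (h : HasSpinorBoundary Λ ψ uL dL uR dR) (ρp ρm : WithTop ℝ) :
    ψ ∈ (HRho m Λ ρp ρm).domain ↔ RhoCondition ρm uL dL ∧ RhoCondition ρp uR dR := by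
  have hd := h.mem_domain (m := m) hΛ
  rw [HRho, LinearPMap.domRestrict_domain, Submodule.mem_inf, and_iff_left hd]
  constructor
  · rintro ⟨-, a, b, c, d, h1, h2, h3, h4⟩
    obtain ⟨rfl, rfl⟩ := h.1.unique h1
    obtain ⟨rfl, rfl⟩ := h.2.unique h2
    exact ⟨h4, h3⟩
  · rintro ⟨h4, h3⟩
    exact ⟨hd, _, _, _, _, h.1, h.2, h3, h4⟩

theorem HasSpinorBoundary.mem_HAlpha_iff (hΛ : 0 ≤ Λ) {ψ : Spinor Λ} {uL dL uR dR : ℂ}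
    (h : HasSpinorBoundary Λ ψ uL dL uR dR) (α₁ α₂ α₃ α₄ : ℂ) :
    ψ ∈ (HAlpha m Λ α₁ α₂ α₃ α₄).domain ↔ uR = α₁ * uL + α₂ * dL ∧ dR = α₃ * uL + α₄ * dL := by
  have hd := h.mem_domain (m := m) hΛ
  have e : ![uR, dR] = !![α₁, α₂; α₃, α₄].mulVec ![uL, dL] ↔
      uR = α₁ * uL + α₂ * dL ∧ dR = α₃ * uL + α₄ * dL := by
    rw [funext_iff, Fin.forall_fin_two]
    simp [Matrix.mulVec, dotProduct, Fin.sum_univ_two]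
  rw [HAlpha, LinearPMap.domRestrict_domain, Submodule.mem_inf, and_iff_left hd, ← e]
  constructor
  · rintro ⟨-, a, b, c, d, h1, h2, h3⟩
    obtain ⟨rfl, rfl⟩ := h.1.unique h1
    obtain ⟨rfl, rfl⟩ := h.2.unique h2
    exact h3
  · intro h3
    exact ⟨hd, _, _, _, _, h.1, h.2, h3⟩

/-- Two domains given by boundary conditions agree if and only if the conditions are equivalent,
since all boundary values occur. -/
theorem domain_eq_iff (hΛ : 0 ≤ Λ) {D₁ D₂ : Submodule ℂ (Spinor Λ)} {P Q : ℂ → ℂ → ℂ → ℂ → Prop}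
    (h₁ : D₁ ≤ (maximalDirac m Λ).domain) (h₂ : D₂ ≤ (maximalDirac m Λ).domain)
    (hP : ∀ ψ uL dL uR dR, HasSpinorBoundary Λ ψ uL dL uR dR → (ψ ∈ D₁ ↔ P uL dL uR dR))
    (hQ : ∀ ψ uL dL uR dR, HasSpinorBoundary Λ ψ uL dL uR dR → (ψ ∈ D₂ ↔ Q uL dL uR dR)) :
    D₁ = D₂ ↔ ∀ uL dL uR dR, P uL dL uR dR ↔ Q uL dL uR dR := by
  constructor
  · rintro rfl uL dL uR dR
    obtain ⟨ψ, h⟩ := exists_of_spinorBoundary m hΛ uL dL uR dR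
    rw [← hP _ _ _ _ _ h, hQ _ _ _ _ _ h]
  · intro hPQ
    ext ψ
    constructor <;> intro h
    · obtain ⟨_, _, _, _, hb⟩ := exists_spinorBoundary hΛ (h₁ h)
      exact (hQ _ _ _ _ _ hb).2 ((hPQ _ _ _ _).1 ((hP _ _ _ _ _ hb).1 h))
    · obtain ⟨_, _, _, _, hb⟩ := exists_spinorBoundary hΛ (h₂ h)
      exact (hP _ _ _ _ _ hb).2 ((hPQ _ _ _ _).2 ((hQ _ _ _ _ _ hb).1 h))

end Dirac

/-! ### Separated boundary conditions -/

theorem rhoCondition_coe {r : ℝ} {a b : ℂ} :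
    RhoCondition (r : WithTop ℝ) a b ↔ Complex.I * r * a = b :=
  ⟨fun h => h.1 r rfl, fun h => ⟨fun s hs => by rwa [← WithTop.coe_injective hs],
    fun h' => absurd h' (WithTop.coe_ne_top)⟩⟩

theorem rhoCondition_top {a b : ℂ} : RhoCondition ⊤ a b ↔ a = 0 :=
  ⟨fun h => h.2 rfl, fun h => ⟨fun _ hs => absurd hs.symm (WithTop.coe_ne_top), fun _ => h⟩⟩

/-- The parameter `ρ` is determined by its boundary condition. -/
theorem rhoCondition_iff_eq {ρ σ : WithTop ℝ} :
    (∀ a b, RhoCondition σ a b ↔ RhoCondition ρ a b) ↔ ρ = σ := by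
  refine ⟨fun h => ?_, fun h => h ▸ fun _ _ => Iff.rfl⟩
  induction σ using WithTop.recTopCoe with
  | top =>
    induction ρ using WithTop.recTopCoe with
    | top => rfl
    | coe r =>
      have h1 := rhoCondition_coe.1 ((h 0 1).1 (rhoCondition_top.2 rfl))
      simp at h1
  | coe s =>
    have h1 := (h 1 (Complex.I * s)).1 (rhoCondition_coe.2 (mul_one _))
    induction ρ using WithTop.recTopCoe with
    | top => exact absurd (rhoCondition_top.1 h1) one_ne_zero
    | coe r =>
      have h2 := rhoCondition_coe.1 h1
      rw [mul_one] at h2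
      rw [Complex.ofReal_injective (mul_left_cancel₀ Complex.I_ne_zero h2)]

theorem exp_arg0 {γ : ℂ} (hγ : ‖γ‖ = 1) : Complex.exp (Complex.I * arg0 γ) = γ := by
  have h1 : arg0 γ = Complex.arg γ - toIcoDiv Real.two_pi_pos 0 (Complex.arg γ) * (2 * Real.pi) := by
    rw [arg0, toIcoMod, zsmul_eq_mul]
  have h2 := Complex.norm_mul_exp_arg_mul_I γ
  rw [hγ, Complex.ofReal_one, one_mul] at h2
  rw [h1]
  push_cast
  have e : Complex.I * ((Complex.arg γ : ℂ) - toIcoDiv Real.two_pi_pos 0 (Complex.arg γ) *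
      (2 * Real.pi)) = Complex.arg γ * Complex.I -
      toIcoDiv Real.two_pi_pos 0 (Complex.arg γ) * (2 * Real.pi * Complex.I) := by ring
  rw [e, Complex.exp_sub, Complex.exp_int_mul_two_pi_mul_I, div_one, h2]

/-- The Cayley transform turns a phase into the tangent of half its argument. -/
theorem one_add_mul_tan {γ : ℂ} (hγ : ‖γ‖ = 1) (h1 : γ ≠ -1) :
    (1 + γ) * (Complex.I * (Real.tan (arg0 γ / 2) : ℝ)) = γ - 1 := by
  set c := Complex.cos ((arg0 γ / 2 : ℝ) : ℂ) with hc
  set s := Complex.sin ((arg0 γ / 2 : ℝ) : ℂ) with hs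
  have e : γ = (c + s * Complex.I) ^ 2 := by
    rw [hc, hs, ← Complex.exp_mul_I, ← Complex.exp_nat_mul]
    conv_lhs => rw [← exp_arg0 hγ]
    congr 1
    push_cast
    ring
  have hcs : s ^ 2 + c ^ 2 = 1 := Complex.sin_sq_add_cos_sq _
  have hc0 : c ≠ 0 := by
    intro h0
    rw [h0] at hcs e
    apply h1
    rw [e]
    linear_combination s ^ 2 * Complex.I_sq - hcs
  have h2 : 1 + γ = 2 * c * (c + s * Complex.I) := by
    rw [e]
    linear_combination s ^ 2 * Complex.I_sq - hcs
  have hsc : c * (s / c) = s := mul_div_cancel₀ _ hc0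
  rw [Complex.ofReal_tan, Complex.tan_eq_sin_div_cos, ← hs, ← hc, h2]
  linear_combination 2 * (c + s * Complex.I) * Complex.I * hsc + s ^ 2 * Complex.I_sq - hcs - e

theorem phase_mul_star_mu_sub (m : ℝ) {γ : ℂ} (hγ : ‖γ‖ = 1) (h1 : γ ≠ -1) :
    γ * star (mu m) - mu m = (1 + γ) *
      (Complex.I * ((Real.tan (arg0 γ / 2) - m) / Real.sqrt (1 + m ^ 2) : ℝ)) := by
  refine mul_left_cancel₀ (sqrt_ne_zero_complex m) ?_
  have ht := one_add_mul_tan hγ h1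
  have hk : ((Real.sqrt (1 + m ^ 2) : ℝ) : ℂ) *
      ((Real.tan (arg0 γ / 2) - m) / Real.sqrt (1 + m ^ 2) : ℝ) =
      (Real.tan (arg0 γ / 2) : ℝ) - (m : ℂ) := by
    rw [← Complex.ofReal_mul, mul_div_cancel₀ _ (sqrt_pos' m).ne', Complex.ofReal_sub]
  linear_combination γ * sqrt_mul_star_mu m - sqrt_mul_mu m - ht -
    (1 + γ) * Complex.I * hk

theorem one_add_ne_zero {γ : ℂ} (h1 : γ ≠ -1) : 1 + γ ≠ 0 := fun h =>
  h1 (eq_neg_of_add_eq_zero_right h)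

/-- At the left end point, the diagonal entry `γ` gives the condition with parameter `ρ` exactly for
one `ρ`. -/
theorem left_condition_iff (m : ℝ) {γ : ℂ} (hγ : ‖γ‖ = 1) (ρ : WithTop ℝ) :
    (∀ u d : ℂ, mu m * u + d = (star (mu m) * u - d) * γ ↔ RhoCondition ρ u d) ↔
      (γ ≠ -1 → ρ = (((Real.tan (arg0 γ / 2) - m) / Real.sqrt (1 + m ^ 2) : ℝ) : WithTop ℝ)) ∧
        (γ = -1 → ρ = ⊤) := by
  by_cases h1 : γ = -1
  · have e : ∀ u d : ℂ, mu m * u + d = (star (mu m) * u - d) * γ ↔ RhoCondition ⊤ u d := by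
      intro u d
      rw [rhoCondition_top, h1]
      refine ⟨fun h => ?_, fun h => by rw [h]; ring⟩
      refine (mul_eq_zero.1 ?_).resolve_left (mu_add_star_ne_zero m)
      linear_combination h
    simp only [e, rhoCondition_iff_eq]
    simp only [h1, ne_eq, not_true_eq_false, false_imp_iff, true_imp_iff, true_and]
  · have e : ∀ u d : ℂ, mu m * u + d = (star (mu m) * u - d) * γ ↔ RhoCondition
        (((Real.tan (arg0 γ / 2) - m) / Real.sqrt (1 + m ^ 2) : ℝ) : WithTop ℝ) u d := by
      intro u d
      have hp := phase_mul_star_mu_sub m hγ h1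
      rw [rhoCondition_coe]
      refine ⟨fun h => mul_left_cancel₀ (one_add_ne_zero h1) ?_, fun h => ?_⟩
      · linear_combination (-u) * hp - h
      · linear_combination (-u) * hp - (1 + γ) * h
    simp only [e, rhoCondition_iff_eq, h1, ne_eq, not_false_eq_true, false_imp_iff, true_imp_iff,
      and_true]

/-- The right end point differs from the left one by the sign of the spin-down component. -/
theorem right_condition_iff (m : ℝ) {γ : ℂ} (hγ : ‖γ‖ = 1) (ρ : WithTop ℝ) :
    (∀ u d : ℂ, mu m * u - d = (star (mu m) * u + d) * γ ↔ RhoCondition ρ u d) ↔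
      (γ ≠ -1 → ρ = ((-(Real.tan (arg0 γ / 2) - m) / Real.sqrt (1 + m ^ 2) : ℝ) : WithTop ℝ)) ∧
        (γ = -1 → ρ = ⊤) := by
  by_cases h1 : γ = -1
  · have e : ∀ u d : ℂ, mu m * u - d = (star (mu m) * u + d) * γ ↔ RhoCondition ⊤ u d := by
      intro u d
      rw [rhoCondition_top, h1]
      refine ⟨fun h => ?_, fun h => by rw [h]; ring⟩
      refine (mul_eq_zero.1 ?_).resolve_left (mu_add_star_ne_zero m)
      linear_combination h
    simp only [e, rhoCondition_iff_eq]
    simp only [h1, ne_eq, not_true_eq_false, false_imp_iff, true_imp_iff, true_and]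
  · have e : ∀ u d : ℂ, mu m * u - d = (star (mu m) * u + d) * γ ↔ RhoCondition
        ((-(Real.tan (arg0 γ / 2) - m) / Real.sqrt (1 + m ^ 2) : ℝ) : WithTop ℝ) u d := by
      intro u d
      have hp := phase_mul_star_mu_sub m hγ h1
      rw [rhoCondition_coe, neg_div, Complex.ofReal_neg]
      refine ⟨fun h => mul_left_cancel₀ (one_add_ne_zero h1) ?_, fun h => ?_⟩
      · linear_combination u * hp + h
      · linear_combination (-u) * hp + (1 + γ) * h
    simp only [e, rhoCondition_iff_eq, h1, ne_eq, not_false_eq_true, false_imp_iff, true_imp_iff,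
      and_true]

theorem HU_le (m Λ : ℝ) (U : Matrix (Fin 2) (Fin 2) ℂ) :
    (HU m Λ U).domain ≤ (maximalDirac m Λ).domain := inf_le_right

theorem HRho_le (m Λ : ℝ) (ρp ρm : WithTop ℝ) :
    (HRho m Λ ρp ρm).domain ≤ (maximalDirac m Λ).domain := inf_le_right

theorem HAlpha_le (m Λ : ℝ) (α₁ α₂ α₃ α₄ : ℂ) :
    (HAlpha m Λ α₁ α₂ α₃ α₄).domain ≤ (maximalDirac m Λ).domain := inf_le_right

theorem HU_diag_domain_eq_iff (m : ℝ) {Λ : ℝ} (hΛ : 0 ≤ Λ) {γL γR : ℂ} (hL : ‖γL‖ = 1)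
    (hR : ‖γR‖ = 1) (ρp ρm : WithTop ℝ) :
    (HU m Λ !![γL, 0; 0, γR]).domain = (HRho m Λ ρp ρm).domain ↔
      ((γL ≠ -1 → ρm = (((Real.tan (arg0 γL / 2) - m) / Real.sqrt (1 + m ^ 2) : ℝ) : WithTop ℝ)) ∧
        (γL = -1 → ρm = ⊤)) ∧
      ((γR ≠ -1 → ρp = ((-(Real.tan (arg0 γR / 2) - m) / Real.sqrt (1 + m ^ 2) : ℝ) : WithTop ℝ)) ∧
        (γR = -1 → ρp = ⊤)) := by
  rw [← left_condition_iff m hL, ← right_condition_iff m hR,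
    domain_eq_iff (m := m) hΛ (HU_le m Λ _) (HRho_le m Λ _ _)
      (fun ψ uL dL uR dR h => h.mem_HU_iff hΛ _) fun ψ uL dL uR dR h => h.mem_HRho_iff hΛ ρp ρm]
  simp only [Matrix.of_apply, Matrix.cons_val', Matrix.cons_val_zero, Matrix.cons_val_one,
    Matrix.cons_val_fin_one, mul_zero, add_zero, zero_add]
  refine ⟨fun h => ⟨fun u d => ?_, fun u d => ?_⟩,
    fun h uL dL uR dR => and_congr (h.1 _ _) (h.2 _ _)⟩
  · have := h u d 0 0
    simpa [RhoCondition.zero] using this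
  · have := h 0 0 u d
    simpa [RhoCondition.zero] using this

/-! ### Transmitting boundary conditions -/

theorem mul_star_eq_one {γ : ℂ} (h : ‖γ‖ = 1) : γ * star γ = 1 := by
  rw [Complex.star_def, Complex.mul_conj, Complex.normSq_eq_norm_sq, h]
  simp

theorem mul_star_add_mul_star {a b : ℂ} (h : ‖a‖ ^ 2 + ‖b‖ ^ 2 = 1) :
    a * star a + b * star b = 1 := by
  simp only [Complex.star_def, Complex.mul_conj, Complex.normSq_eq_norm_sq, ← Complex.ofReal_add, h,
    Complex.ofReal_one]

theorem two_mul_ofReal_re (z : ℂ) : 2 * (z.re : ℂ) = z + star z := by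
  rw [Complex.star_def, Complex.add_conj]
  push_cast
  rfl

theorem two_mul_ofReal_im (z : ℂ) : 2 * Complex.I * (z.im : ℂ) = z - star z := by
  rw [Complex.star_def, Complex.sub_conj]
  push_cast
  ring

/-- The real numbers `(r₁, r₂, r₃, r₄)` for which the boundary matrix of a nondiagonal `U` has the
entries `i r₁ / γ₂`, `r₂ / γ₂`, `r₃ / γ₂`, `i r₄ / γ₂`. -/
structure IsTransmission (m : ℝ) (γ₁ γ₃ : ℂ) (r₁ r₂ r₃ r₄ : ℝ) : Prop where
  one : 2 * Complex.I * r₁ = (Real.sqrt (1 + m ^ 2) : ℝ) *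
    (mu m * (star γ₁ + star γ₃) - star (mu m) * (γ₁ + γ₃))
  two : 2 * (r₂ : ℂ) = (Real.sqrt (1 + m ^ 2) : ℝ) * (γ₁ + star γ₁ + γ₃ + star γ₃)
  three : 2 * (r₃ : ℂ) = (Real.sqrt (1 + m ^ 2) : ℝ) *
    (-(γ₁ + star γ₁) + mu m ^ 2 * star γ₃ + star (mu m) ^ 2 * γ₃)
  four : 2 * Complex.I * r₄ = (Real.sqrt (1 + m ^ 2) : ℝ) *
    (mu m * (γ₁ + star γ₃) - star (mu m) * (star γ₁ + γ₃))

theorem isTransmission (m : ℝ) (γ₁ γ₃ : ℂ) : IsTransmission m γ₁ γ₃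
    (Real.sqrt (1 + m ^ 2) * ((star γ₁ * mu m).im + (star γ₃ * mu m).im))
    (Real.sqrt (1 + m ^ 2) * (γ₁.re + γ₃.re))
    (Real.sqrt (1 + m ^ 2) * (-γ₁.re + (star γ₃ * mu m ^ 2).re))
    (Real.sqrt (1 + m ^ 2) * ((γ₁ * mu m).im + (star γ₃ * mu m).im)) where
  one := by
    have h1 := two_mul_ofReal_im (star γ₁ * mu m)
    have h2 := two_mul_ofReal_im (star γ₃ * mu m)
    simp only [star_mul', star_star] at h1 h2
    push_cast
    linear_combination ((Real.sqrt (1 + m ^ 2) : ℝ) : ℂ) * (h1 + h2)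
  two := by
    have h1 := two_mul_ofReal_re γ₁
    have h2 := two_mul_ofReal_re γ₃
    push_cast
    linear_combination ((Real.sqrt (1 + m ^ 2) : ℝ) : ℂ) * (h1 + h2)
  three := by
    have h1 := two_mul_ofReal_re γ₁
    have h2 := two_mul_ofReal_re (star γ₃ * mu m ^ 2)
    simp only [star_mul', star_star, star_pow] at h2
    push_cast
    linear_combination ((Real.sqrt (1 + m ^ 2) : ℝ) : ℂ) * (-h1 + h2)
  four := by
    have h1 := two_mul_ofReal_im (γ₁ * mu m)
    have h2 := two_mul_ofReal_im (star γ₃ * mu m)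
    simp only [star_mul', star_star] at h1 h2
    push_cast
    linear_combination ((Real.sqrt (1 + m ^ 2) : ℝ) : ℂ) * (h1 + h2)

section Transmission

variable {m : ℝ} {γ₁ γ₂ γ₃ : ℂ} {r₁ r₂ r₃ r₄ : ℝ}

/-- The determinant identity behind membership in the class of admissible `α`. -/
theorem IsTransmission.mul_add_mul (h : IsTransmission m γ₁ γ₃ r₁ r₂ r₃ r₄)
    (h1 : ‖γ₁‖ ^ 2 + ‖γ₂‖ ^ 2 = 1) (h3 : ‖γ₃‖ = 1) :
    (r₁ : ℂ) * r₄ + r₂ * r₃ = γ₂ * star γ₂ := by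
  have e1 := mul_star_add_mul_star h1
  have e3 := mul_star_eq_one h3
  have eμ := mu_mul_star m
  have hs := sqrt_mul_mu_add m
  obtain ⟨a1, a2, a3, a4⟩ := h
  generalize ((Real.sqrt (1 + m ^ 2) : ℝ) : ℂ) = k at *
  generalize star (mu m) = N at *
  generalize mu m = M at *
  generalize star γ₁ = b at *
  generalize star γ₃ = d at *
  have hdet : (γ₁ + b + γ₃ + d) * (-(γ₁ + b) + M ^ 2 * d + N ^ 2 * γ₃) -
      (M * (b + d) - N * (γ₁ + γ₃)) * (M * (γ₁ + d) - N * (b + γ₃)) =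
      (1 - γ₁ * b) * (M + N) ^ 2 := by
    linear_combination (M ^ 2 + N ^ 2 + 2) * e3 +
      ((b + d) * (b + γ₃) + (γ₁ + γ₃) * (γ₁ + d) - 2 * (1 - γ₁ * b)) * eμ
  have h4 : 4 * ((r₁ : ℂ) * r₄ + r₂ * r₃) = k ^ 2 * ((1 - γ₁ * b) * (M + N) ^ 2) := by
    rw [← hdet]
    have p1 : (2 * Complex.I * r₁) * (2 * Complex.I * r₄) = -4 * ((r₁ : ℂ) * r₄) := by
      linear_combination 4 * r₁ * r₄ * Complex.I_sq
    have p2 : (2 * (r₂ : ℂ)) * (2 * r₃) = 4 * (r₂ * r₃) := by ring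
    rw [a1, a4] at p1
    rw [a2, a3] at p2
    linear_combination p1 - p2
  have h5 : k ^ 2 * ((1 - γ₁ * b) * (M + N) ^ 2) = 4 * (γ₂ * star γ₂) := by
    linear_combination (1 - γ₁ * b) * (k * (M + N) + 2) * hs - 4 * e1
  exact mul_left_cancel₀ (by norm_num : (4 : ℂ) ≠ 0) (h4.trans h5)

theorem IsTransmission.alphaClass (h : IsTransmission m γ₁ γ₃ r₁ r₂ r₃ r₄)
    (h1 : ‖γ₁‖ ^ 2 + ‖γ₂‖ ^ 2 = 1) (h3 : ‖γ₃‖ = 1) (h2 : γ₂ ≠ 0) :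
    AlphaClass (Complex.I * γ₂⁻¹ * r₁) (γ₂⁻¹ * r₂) (γ₂⁻¹ * r₃) (Complex.I * γ₂⁻¹ * r₄) := by
  have hd := h.mul_add_mul h1 h3
  have hg : γ₂⁻¹ * star γ₂⁻¹ = ((‖γ₂⁻¹‖ ^ 2 : ℝ) : ℂ) := by
    rw [Complex.star_def, Complex.mul_conj, Complex.normSq_eq_norm_sq]
  have hgg : γ₂⁻¹ * star γ₂⁻¹ * (γ₂ * star γ₂) = 1 := by
    have := star_ne_zero.2 h2
    rw [star_inv₀]
    field_simp
  have him : ∀ r s t : ℝ, (Complex.I * ((t : ℝ) : ℂ) * r * s).re = 0 := by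
    intro r s t
    simp
  refine ⟨?_, ?_, ?_, ?_, ?_, ?_⟩
  · rw [← him r₁ r₂ (‖γ₂⁻¹‖ ^ 2), ← hg]
    congr 1
    simp only [star_mul', Complex.star_def, Complex.conj_ofReal]
    ring
  · rw [← him r₁ r₃ (‖γ₂⁻¹‖ ^ 2), ← hg]
    congr 1
    simp only [star_mul', Complex.star_def, Complex.conj_ofReal]
    ring
  · rw [← him (-r₂) r₄ (‖γ₂⁻¹‖ ^ 2), ← hg]
    congr 1
    simp only [star_mul', Complex.star_def, Complex.conj_ofReal, Complex.conj_I]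
    push_cast
    ring
  · rw [← him (-r₃) r₄ (‖γ₂⁻¹‖ ^ 2), ← hg]
    congr 1
    simp only [star_mul', Complex.star_def, Complex.conj_ofReal, Complex.conj_I]
    push_cast
    ring
  · simp only [Complex.star_def, map_mul, Complex.conj_ofReal, Complex.conj_I] at hd hgg ⊢
    linear_combination γ₂⁻¹ * (starRingEnd ℂ) γ₂⁻¹ * hd + hgg -
      γ₂⁻¹ * (starRingEnd ℂ) γ₂⁻¹ * r₁ * r₄ * Complex.I_sq
  · simp only [Complex.star_def, map_mul, Complex.conj_ofReal, Complex.conj_I] at hd hgg ⊢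
    linear_combination γ₂⁻¹ * (starRingEnd ℂ) γ₂⁻¹ * hd + hgg -
      γ₂⁻¹ * (starRingEnd ℂ) γ₂⁻¹ * r₁ * r₄ * Complex.I_sq

/-- The boundary condition of a nondiagonal `U`, solved for the values at `+Λ`. -/
theorem IsTransmission.condition_iff (h : IsTransmission m γ₁ γ₃ r₁ r₂ r₃ r₄)
    (h1 : ‖γ₁‖ ^ 2 + ‖γ₂‖ ^ 2 = 1) (h3 : ‖γ₃‖ = 1) (h2 : γ₂ ≠ 0) (uL dL uR dR : ℂ) :
    (mu m * uL + dL = (star (mu m) * uL - dL) * (γ₃ * γ₁) + (star (mu m) * uR + dR) * (γ₃ * γ₂) ∧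
      mu m * uR - dR =
        (star (mu m) * uL - dL) * (γ₃ * -star γ₂) + (star (mu m) * uR + dR) * (γ₃ * star γ₁)) ↔
    uR = Complex.I * γ₂⁻¹ * r₁ * uL + γ₂⁻¹ * r₂ * dL ∧
      dR = γ₂⁻¹ * r₃ * uL + Complex.I * γ₂⁻¹ * r₄ * dL := by
  have e1 := mul_star_add_mul_star h1
  have e3 := mul_star_eq_one h3
  have eμ := mu_mul_star m
  have hs := sqrt_mul_mu_add m
  obtain ⟨a1, a2, a3, a4⟩ := h
  -- the right-hand side, cleared of denominators
  have e : (uR = Complex.I * γ₂⁻¹ * r₁ * uL + γ₂⁻¹ * r₂ * dL ∧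
      dR = γ₂⁻¹ * r₃ * uL + Complex.I * γ₂⁻¹ * r₄ * dL) ↔
      (2 * γ₂ * uR = 2 * Complex.I * r₁ * uL + 2 * r₂ * dL ∧
        2 * γ₂ * dR = 2 * r₃ * uL + 2 * Complex.I * r₄ * dL) := by
    have hi := mul_inv_cancel₀ h2
    have h20 := mul_ne_zero two_ne_zero h2
    constructor
    · rintro ⟨rfl, rfl⟩
      constructor
      · linear_combination (2 * Complex.I * r₁ * uL + 2 * r₂ * dL) * hi
      · linear_combination (2 * r₃ * uL + 2 * Complex.I * r₄ * dL) * hi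
    · rintro ⟨b1, b2⟩
      constructor <;> refine mul_left_cancel₀ h20 ?_
      · linear_combination b1 - (2 * Complex.I * r₁ * uL + 2 * r₂ * dL) * hi
      · linear_combination b2 - (2 * r₃ * uL + 2 * Complex.I * r₄ * dL) * hi
  rw [e, a1, a2, a3, a4]
  generalize ((Real.sqrt (1 + m ^ 2) : ℝ) : ℂ) = k at *
  generalize star (mu m) = N at *
  generalize mu m = M at *
  generalize star γ₁ = b at *
  generalize star γ₂ = c at *
  generalize star γ₃ = d at *
  -- the left-hand side, solved for the combinations `N uR + dR` and `M uR - dR`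
  have e' : (M * uL + dL = (N * uL - dL) * (γ₃ * γ₁) + (N * uR + dR) * (γ₃ * γ₂) ∧
      M * uR - dR = (N * uL - dL) * (γ₃ * -c) + (N * uR + dR) * (γ₃ * b)) ↔
      (γ₂ * (N * uR + dR) = d * (M * uL + dL) - (N * uL - dL) * γ₁ ∧
        γ₂ * (M * uR - dR) = b * (M * uL + dL) - (N * uL - dL) * γ₃) := by
    constructor
    · rintro ⟨b1, b2⟩
      have c1 : γ₂ * (N * uR + dR) = d * (M * uL + dL) - (N * uL - dL) * γ₁ := by
        linear_combination (-d) * b1 - ((N * uL - dL) * γ₁ + (N * uR + dR) * γ₂) * e3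
      refine ⟨c1, ?_⟩
      linear_combination γ₂ * b2 + γ₃ * b * c1 + b * (M * uL + dL) * e3 -
        (N * uL - dL) * γ₃ * e1
    · rintro ⟨c1, c2⟩
      refine ⟨?_, mul_left_cancel₀ h2 ?_⟩
      · linear_combination (-γ₃) * c1 - (M * uL + dL) * e3
      · linear_combination c2 - γ₃ * b * c1 - b * (M * uL + dL) * e3 +
          (N * uL - dL) * γ₃ * e1
  rw [e']
  constructor
  · rintro ⟨c1, c2⟩
    constructor
    · linear_combination (-γ₂ * uR) * hs + k * (c1 + c2)
    · linear_combination (-γ₂ * dR) * hs + k * (M * c1 - N * c2) -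
        k * uL * (γ₁ + b) * eμ
  · rintro ⟨c1, c2⟩
    constructor <;> refine mul_left_cancel₀ (two_ne_zero (α := ℂ)) ?_
    · linear_combination N * c1 + c2 + k * uL * (b + γ₁) * eμ +
        (d * M * uL - N * γ₁ * uL + (γ₁ + d) * dL) * hs
    · linear_combination M * c1 - c2 - k * uL * (b + γ₁) * eμ +
        (b * dL + γ₃ * dL - N * γ₃ * uL + M * b * uL) * hs

end Transmission

theorem alpha_eq_iff {a₁ a₂ a₃ a₄ α₁ α₂ α₃ α₄ : ℂ} :
    (∀ uL dL uR dR : ℂ, (uR = a₁ * uL + a₂ * dL ∧ dR = a₃ * uL + a₄ * dL) ↔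
      (uR = α₁ * uL + α₂ * dL ∧ dR = α₃ * uL + α₄ * dL)) ↔
    α₁ = a₁ ∧ α₂ = a₂ ∧ α₃ = a₃ ∧ α₄ = a₄ := by
  constructor
  · intro h
    obtain ⟨h1, h2⟩ := (h 1 0 a₁ a₃).1 (by simp)
    obtain ⟨h3, h4⟩ := (h 0 1 a₂ a₄).1 (by simp)
    simp only [mul_one, mul_zero, add_zero, zero_add] at h1 h2 h3 h4
    exact ⟨h1.symm, h3.symm, h2.symm, h4.symm⟩
  · rintro ⟨rfl, rfl, rfl, rfl⟩ _ _ _ _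
    rfl

theorem HU_domain_eq_HAlpha_iff {m Λ : ℝ} (hΛ : 0 ≤ Λ) {γ₁ γ₂ γ₃ : ℂ} {r₁ r₂ r₃ r₄ : ℝ}
    (h : IsTransmission m γ₁ γ₃ r₁ r₂ r₃ r₄)
    (h1 : ‖γ₁‖ ^ 2 + ‖γ₂‖ ^ 2 = 1) (h3 : ‖γ₃‖ = 1) (h2 : γ₂ ≠ 0) (α₁ α₂ α₃ α₄ : ℂ) :
    (HU m Λ (γ₃ • !![γ₁, -star γ₂; γ₂, star γ₁])).domain = (HAlpha m Λ α₁ α₂ α₃ α₄).domain ↔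
      α₁ = Complex.I * γ₂⁻¹ * r₁ ∧ α₂ = γ₂⁻¹ * r₂ ∧ α₃ = γ₂⁻¹ * r₃ ∧
        α₄ = Complex.I * γ₂⁻¹ * r₄ := by
  rw [← alpha_eq_iff, domain_eq_iff (m := m) hΛ (HU_le m Λ _) (HAlpha_le m Λ _ _ _ _)
      (fun ψ uL dL uR dR hb => hb.mem_HU_iff hΛ _)
      fun ψ uL dL uR dR hb => hb.mem_HAlpha_iff hΛ α₁ α₂ α₃ α₄]
  simp only [Matrix.smul_apply, Matrix.of_apply, Matrix.cons_val', Matrix.cons_val_zero,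
    Matrix.cons_val_one, Matrix.cons_val_fin_one, smul_eq_mul, h.condition_iff h1 h3 h2]

/-! ### Unitary matrices of order two -/

theorem unitary_columns {U : Matrix (Fin 2) (Fin 2) ℂ} (hU : U ∈ Matrix.unitaryGroup (Fin 2) ℂ) :
    star (U 0 0) * U 0 0 + star (U 1 0) * U 1 0 = 1 ∧
      star (U 0 0) * U 0 1 + star (U 1 0) * U 1 1 = 0 ∧
      star (U 0 1) * U 0 1 + star (U 1 1) * U 1 1 = 1 := by
  have h := Matrix.mem_unitaryGroup_iff'.1 hU
  have h00 := congrFun (congrFun h 0) 0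
  have h01 := congrFun (congrFun h 0) 1
  have h11 := congrFun (congrFun h 1) 1
  simp only [Matrix.mul_apply, Fin.sum_univ_two, Matrix.star_apply, Matrix.one_apply] at h00 h01 h11
  exact ⟨by simpa using h00, by simpa using h01, by simpa using h11⟩

theorem norm_eq_one_of_star_mul {z : ℂ} (h : star z * z = 1) : ‖z‖ = 1 := by
  rw [mul_comm, Complex.star_def, Complex.mul_conj, Complex.normSq_eq_norm_sq] at h
  have h' : ‖z‖ ^ 2 = 1 := by exact_mod_cast h
  exact (pow_eq_one_iff_of_nonneg (norm_nonneg z) two_ne_zero).1 h'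

theorem unitary_diag {U : Matrix (Fin 2) (Fin 2) ℂ} (hU : U ∈ Matrix.unitaryGroup (Fin 2) ℂ)
    (hd : U.IsDiag) : ∃ γL γR : ℂ, U = !![γL, 0; 0, γR] ∧ ‖γL‖ = 1 ∧ ‖γR‖ = 1 := by
  obtain ⟨h00, -, h11⟩ := unitary_columns hU
  have h1 : U 0 1 = 0 := hd (by decide)
  have h2 : U 1 0 = 0 := hd (by decide)
  rw [h2, mul_zero, add_zero] at h00
  rw [h1, mul_zero, zero_add] at h11
  refine ⟨U 0 0, U 1 1, ?_, norm_eq_one_of_star_mul h00, norm_eq_one_of_star_mul h11⟩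
  rw [← h1]
  nth_rw 2 [h1]
  rw [← h2]
  exact Matrix.eta_fin_two U

theorem unitary_not_diag {U : Matrix (Fin 2) (Fin 2) ℂ} (hU : U ∈ Matrix.unitaryGroup (Fin 2) ℂ)
    (hd : ¬U.IsDiag) : ∃ γ₁ γ₂ γ₃ : ℂ, U = γ₃ • !![γ₁, -star γ₂; γ₂, star γ₁] ∧
      ‖γ₁‖ ^ 2 + ‖γ₂‖ ^ 2 = 1 ∧ ‖γ₃‖ = 1 ∧ γ₂ ≠ 0 := by
  obtain ⟨h00, h01, -⟩ := unitary_columns hU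
  -- `γ₃` is a square root of the determinant
  obtain ⟨g, hg⟩ := IsAlgClosed.exists_pow_nat_eq U.det two_pos
  have hdet : ‖U.det‖ = 1 :=
    norm_eq_one_of_star_mul (Unitary.star_mul_self_of_mem (Matrix.det_of_mem_unitary hU))
  have hg1 : ‖g‖ = 1 := by
    rw [← hg, norm_pow] at hdet
    exact (pow_eq_one_iff_of_nonneg (norm_nonneg g) two_ne_zero).1 hdet
  rw [Matrix.det_fin_two] at hg
  have e11 : g ^ 2 * star (U 0 0) = U 1 1 := by
    rw [hg]
    linear_combination U 1 1 * h00 - U 1 0 * h01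
  have e01 : g ^ 2 * star (U 1 0) = -U 0 1 := by
    rw [hg]
    linear_combination U 0 0 * h01 - U 0 1 * h00
  have hgg := mul_star_eq_one hg1
  refine ⟨star g * U 0 0, star g * U 1 0, g, ?_, ?_, hg1, ?_⟩
  · rw [Matrix.eta_fin_two U]
    simp only [Matrix.smul_of, Matrix.smul_cons, smul_eq_mul, Matrix.smul_empty, star_mul',
      star_star, Matrix.of_apply, Matrix.cons_val', Matrix.cons_val_zero, Matrix.cons_val_one,
      Matrix.cons_val_fin_one]
    congr 1
    have q00 : U 0 0 = g * (star g * U 0 0) := by linear_combination (-U 0 0) * hgg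
    have q10 : U 1 0 = g * (star g * U 1 0) := by linear_combination (-U 1 0) * hgg
    have q01 : U 0 1 = g * -(g * star (U 1 0)) := by linear_combination e01
    have q11 : U 1 1 = g * (g * star (U 0 0)) := by linear_combination -e11
    rw [← q00, ← q10, ← q01, ← q11]
  · rw [norm_mul, norm_mul, norm_star, hg1, one_mul, one_mul]
    have : ((‖U 0 0‖ ^ 2 + ‖U 1 0‖ ^ 2 : ℝ) : ℂ) = 1 := by
      rw [← h00, Complex.ofReal_add, ← Complex.normSq_eq_norm_sq, ← Complex.normSq_eq_norm_sq,
        ← Complex.mul_conj, ← Complex.mul_conj, Complex.star_def]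
      ring
    exact_mod_cast this
  · intro h0
    have hg0 : star g ≠ 0 := by
      rw [← norm_ne_zero_iff, norm_star, hg1]
      exact one_ne_zero
    have h10 : U 1 0 = 0 := (mul_eq_zero.1 h0).resolve_left hg0
    rw [h10, star_zero, mul_zero, zero_eq_neg] at e01
    refine hd fun i j hij => ?_
    fin_cases i <;> fin_cases j
    exacts [absurd rfl hij, e01, h10, absurd rfl hij]

end DiracJunction

end

theorem theorem2 (m Λ : ℝ) (hm : 0 ≤ m) (hΛ : 0 ≤ Λ) :
    -- the self-adjoint extensions of the minimal Dirac operator are exactly the `H_U`, `U ∈ U(2)`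
    (∀ A : DiracJunction.Spinor Λ →ₗ.[ℂ] DiracJunction.Spinor Λ,
      DiracJunction.IsSelfAdjointExtension m Λ A ↔
        ∃! U : Matrix.unitaryGroup (Fin 2) ℂ, A = DiracJunction.HU m Λ U) ∧
    -- (i) diagonal `U`
    (∀ U ∈ Matrix.unitaryGroup (Fin 2) ℂ, U.IsDiag →
      ∃ γL γR : ℂ, U = !![γL, 0; 0, γR] ∧ ‖γL‖ = 1 ∧ ‖γR‖ = 1) ∧
    (∀ γL γR : ℂ, ‖γL‖ = 1 → ‖γR‖ = 1 → ∀ ρp ρm : WithTop ℝ,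
      (DiracJunction.HU m Λ !![γL, 0; 0, γR]).domain = (DiracJunction.HRho m Λ ρp ρm).domain ↔
        (γL ≠ -1 → ρm = ((((Real.tan (DiracJunction.arg0 γL / 2) - m) /
          Real.sqrt (1 + m ^ 2) : ℝ)) : WithTop ℝ)) ∧
        (γL = -1 → ρm = ⊤) ∧
        (γR ≠ -1 → ρp = (((-(Real.tan (DiracJunction.arg0 γR / 2) - m) /
          Real.sqrt (1 + m ^ 2) : ℝ)) : WithTop ℝ)) ∧
        (γR = -1 → ρp = ⊤)) ∧
    -- (ii) non-diagonal `U`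
    (∀ U ∈ Matrix.unitaryGroup (Fin 2) ℂ, ¬ U.IsDiag →
      ∃ γ₁ γ₂ γ₃ : ℂ, U = γ₃ • !![γ₁, -star γ₂; γ₂, star γ₁] ∧
        ‖γ₁‖ ^ 2 + ‖γ₂‖ ^ 2 = 1 ∧ ‖γ₃‖ = 1 ∧ γ₂ ≠ 0) ∧
    (∀ γ₁ γ₂ γ₃ : ℂ, ‖γ₁‖ ^ 2 + ‖γ₂‖ ^ 2 = 1 → ‖γ₃‖ = 1 → γ₂ ≠ 0 → ∀ α₁ α₂ α₃ α₄ : ℂ,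
      (DiracJunction.AlphaClass α₁ α₂ α₃ α₄ ∧
        (DiracJunction.HU m Λ (γ₃ • !![γ₁, -star γ₂; γ₂, star γ₁])).domain =
          (DiracJunction.HAlpha m Λ α₁ α₂ α₃ α₄).domain) ↔
        α₁ = Complex.I * γ₂⁻¹ * (Real.sqrt (1 + m ^ 2) : ℝ) *
          (((star γ₁ * DiracJunction.mu m).im + (star γ₃ * DiracJunction.mu m).im : ℝ) : ℂ) ∧
        α₂ = γ₂⁻¹ * (Real.sqrt (1 + m ^ 2) : ℝ) * ((γ₁.re + γ₃.re : ℝ) : ℂ) ∧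
        α₃ = γ₂⁻¹ * (Real.sqrt (1 + m ^ 2) : ℝ) *
          ((-γ₁.re + (star γ₃ * DiracJunction.mu m ^ 2).re : ℝ) : ℂ) ∧
        α₄ = Complex.I * γ₂⁻¹ * (Real.sqrt (1 + m ^ 2) : ℝ) *
          (((γ₁ * DiracJunction.mu m).im + (star γ₃ * DiracJunction.mu m).im : ℝ) : ℂ)) := by
  refine ⟨fun A => ?_, fun U hU hd => DiracJunction.unitary_diag hU hd,
    fun γL γR hL hR ρp ρm =>
      (DiracJunction.HU_diag_domain_eq_iff m hΛ hL hR ρp ρm).trans and_assoc,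
    fun U hU hd => DiracJunction.unitary_not_diag hU hd, ?_⟩
  · simp only [DiracJunction.HU_eq hΛ]
    exact (DiracJunction.deficiencyBases (m := m) hΛ).isSelfAdjoint_iff A
  · intro γ₁ γ₂ γ₃ h1 h3 h2 α₁ α₂ α₃ α₄
    have ht := DiracJunction.isTransmission m γ₁ γ₃
    have hiff := DiracJunction.HU_domain_eq_HAlpha_iff hΛ ht h1 h3 h2 α₁ α₂ α₃ α₄
    have hclass := ht.alphaClass h1 h3 h2
    simp only [Complex.ofReal_mul (Real.sqrt (1 + m ^ 2)), ← mul_assoc] at hiff hclass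
    constructor
    · exact fun h => hiff.1 h.2
    · intro h
      refine ⟨?_, hiff.2 h⟩
      obtain ⟨rfl, rfl, rfl, rfl⟩ := h
      exact hclass
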